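/- Let $N\in\mathbb Z_{\ge 0}$, $a,b\in\mathbb R_{\ge 0}$ and $\omega>0$. Let $\varepsilon_1,\dots,\varepsilon_N$ be the standard orthonormal basis of $\mathbb R^N$, $R=\{\varepsilon_j-\varepsilon_k : j\ne k\}$ with simple roots $\alpha_j=\varepsilon_j-\varepsilon_{j+1}$, positive roots $R_+$, $R_-=-R_+$, $Q_+=\sum_j\mathbb Z_{\ge0}\alpha_j$, $\rho=\frac12\sum_{\alpha\in R_+}\alpha$, $\alpha^\vee=2\alpha/\langle\alpha,\alpha\rangle$, and Weyl group $W\simeq\mathfrak S_N$ generated by the simple reflections $s_j$. For $w\in W$ put $R_w=R_+\cap w^{-1}R_-$ and $\ell(w)=|R_w|$. Compositions are the $\mu\in\mathbb Z_{\ge0}^N$, with $|\mu|=\sum_j\mu_j$, and partitions are the weakly decreasing ones. Let $w_\mu$ be the shortest $w\in W$ such that $w^{-1}(\mu)$ is a partition, $\mu^+=w_\mu^{-1}(\mu)$ and $\rho(\mu)=w_\mu(\rho)$. Write $\nu\preceq\mu$ if either $\nu\in W(\mu^+)$ and $\mu-\nu\in Q_+$, or $\nu\notin W(\mu^+)$,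 $|\nu|=|\mu|$ and $\sum_{k\le l}\nu^+_k\le\sum_{k\le l}\mu^+_k$ for all $l$. On $\mathbb C[x_1,\dots,x_N]$ let $K_{jk}$ exchange $x_j$ and $x_k$, let $t_j$ replace $x_j$ by $-x_j$, and let $$\nabla^{(A)}_j=\frac{\partial}{\partial x_j}+a\sum_{k\ne j}\frac{1-K_{jk}}{x_j-x_k},\qquad \nabla^{(B)}_j=\frac{\partial}{\partial x_j}+a\sum_{k\ne j}\Bigl(\frac{1-K_{jk}}{x_j-x_k}+\frac{1-t_jt_kK_{jk}}{x_j+x_k}\Bigr)+\frac{b}{x_j}(1-t_j),$$ $$d^{(A)}_j=\Bigl(x_j-\tfrac1{2\omega}\nabla^{(A)}_j\Bigr)\nabla^{(A)}_j+a\sum_{k>j}K_{jk},\qquad d^{(B)}_j=\Bigl(x_j-\tfrac1{2\omega}\nabla^{(B)}_j\Bigr)\nabla^{(B)}_j+a\sum_{k>j}(1+t_jt_k)K_{jk}+b\,t_j .$$ For every composition $\mu$ there is exactly one polynomial $h^{(A)}_\mu$ (non-symmetric Hermite), and exactly one polynomial $h^{(B)}_\mu$ (non-symmetric Laguerre), of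 the form $x^\mu+\sum_\nu v_\nu x^\nu$, summed over $\nu\neq\mu$ with $\nu\preceq\mu$ or $|\nu|<|\mu|$, such that for all compositions $\lambda$ $$\sum_j\lambda_jd^{(A)}_jh^{(A)}_\mu=\langle\lambda,\mu+a\rho(\mu)+\tfrac12a(N-1)1^N\rangle h^{(A)}_\mu,\qquad \sum_j\lambda_jd^{(B)}_jh^{(B)}_\mu=\langle\lambda,\mu+2a\rho(\mu)+(a(N-1)+b)1^N\rangle h^{(B)}_\mu,$$ where $1^N=\sum_j\varepsilon_j$. Let $\langle f,g\rangle_{(A,B)}=\int_{\mathbb R^N}|\phi^{(A,B)}(x)|^2\,\overline{f(x)}\,g(x)\,dx$ with $$\phi^{(A)}=\prod_{j<k}|x_j-x_k|^a\,e^{-\frac{\omega}2\sum_m x_m^2},\qquad \phi^{(B)}=\prod_{j<k}|x_j^2-x_k^2|^a\prod_l|x_l|^b\,e^{-\frac{\omega}2\sum_m x_m^2}.$$ Then for every partition $\mu^+$ and every $\mu\in W(\mu^+)$, $$\langle h^{(A)}_\mu,h^{(A)}_\mu\rangle_{(A)}=\prod_{\alpha\in R_{w_\mu}}\frac{\langle\alpha^\vee,\mu^++a\rho\rangle^2}{\langle\alpha^\vee,\mu^++a\rho\rangle^2-a^2}\;\langle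 h^{(A)}_{\mu^+},h^{(A)}_{\mu^+}\rangle_{(A)},$$ $$\langle h^{(B)}_\mu,h^{(B)}_\mu\rangle_{(B)}=\prod_{\alpha\in R_{w_\mu}}\frac{\langle\alpha^\vee,\mu^++2a\rho\rangle^2}{\langle\alpha^\vee,\mu^++2a\rho\rangle^2-a^2\bigl(1+(-1)^{\langle\alpha^\vee,\mu^+\rangle}\bigr)^2}\;\langle h^{(B)}_{\mu^+},h^{(B)}_{\mu^+}\rangle_{(B)},$$ where all denominators and both $\langle h^{(A,B)}_{\mu^+},h^{(A,B)}_{\mu^+}\rangle_{(A,B)}$ are non-zero. The products do not depend on a reduced expression: for every reduced expression $w_\mu=s_{j_l}\cdots s_{j_2}s_{j_1}$, the product of the same factors over the roots $\alpha_{j_1},\,s_{j_1}(\alpha_{j_2}),\,\dots,\,s_{j_1}\cdots s_{j_{l-1}}(\alpha_{j_l})$ has the same value. -/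

import Mathlib

noncomputable section

namespace Calogero

open MvPolynomial

/-! ## The root system of type A and the symmetric group -/

section Roots

variable {N : ℕ}

/-- The standard basis vector `ε_j` of `V = ℝ^N`. -/
def eps (j : Fin N) : Fin N → ℝ := Pi.single j 1

/-- The standard positive definite form on `V`, for which the `ε_j` are orthonormal. -/
def form (u v : Fin N → ℝ) : ℝ := ∑ i, u i * v i

/-- The coroot `α^∨ = 2α / ⟨α, α⟩`. -/
def coroot (α : Fin N → ℝ) : Fin N → ℝ := (2 / form α α) • α

/-- The reflection `s_α(v) = v - ⟨α^∨, v⟩ α`. -/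
def reflection (α v : Fin N → ℝ) : Fin N → ℝ := v - form (coroot α) v • α

/-- The indices of the simple roots (counted from `0`): all `j` with `j + 1 < N`. -/
def SimpleIndex (N : ℕ) : Type := {j : ℕ // j + 1 < N}

def SimpleIndex.lo (j : SimpleIndex N) : Fin N := ⟨j.1, Nat.lt_of_succ_lt j.2⟩

def SimpleIndex.hi (j : SimpleIndex N) : Fin N := ⟨j.1 + 1, j.2⟩

/-- The simple root `α_j = ε_j - ε_{j+1}`. -/
def simpleRoot (j : SimpleIndex N) : Fin N → ℝ := eps j.lo - eps j.hi

open Classical in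
/-- The root system `R = {ε_j - ε_k | j ≠ k}`. -/
def roots (N : ℕ) : Finset (Fin N → ℝ) :=
  ((Finset.univ : Finset (Fin N × Fin N)).filter fun q => q.1 ≠ q.2).image
    fun q => eps q.1 - eps q.2

/-- The positive root lattice `Q₊`: sums of simple roots with coefficients in `ℕ`. -/
def posRootLattice (N : ℕ) : AddSubmonoid (Fin N → ℝ) :=
  AddSubmonoid.closure (Set.range simpleRoot)

open Classical in
/-- The positive roots `R₊` relative to the simple roots. -/
def posRoots (N : ℕ) : Finset (Fin N → ℝ) :=
  (roots N).filter fun α => α ∈ posRootLattice N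

/-- The Weyl group is realized as the symmetric group, `w(ε_j) = ε_{w j}`. -/
def act (w : Equiv.Perm (Fin N)) (v : Fin N → ℝ) : Fin N → ℝ := fun i => v (w⁻¹ i)

/-- The simple reflection `s_j`, the transposition of `j` and `j + 1`. -/
def simpleRefl (j : SimpleIndex N) : Equiv.Perm (Fin N) := Equiv.swap j.lo j.hi

/-- Transpositions act on `V` as the reflections in the roots. -/
theorem act_swap (j k : Fin N) (hjk : j ≠ k) (v : Fin N → ℝ) :
    act (Equiv.swap j k) v = reflection (eps j - eps k) v := by
  have h2 : ∀ u : Fin N → ℝ, form (eps j - eps k) u = u j - u k := by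
    intro u
    simp [form, eps, sub_mul, Finset.sum_sub_distrib, Pi.single_apply]
  have h3 : form (eps j - eps k) (eps j - eps k) = 2 := by
    rw [h2]
    simp [eps, hjk, hjk.symm]
    norm_num
  have h1 : coroot (eps j - eps k) = eps j - eps k := by
    rw [coroot, h3]
    norm_num
  funext i
  rw [reflection, h1, h2]
  by_cases hi : i = j
  · subst hi
    simp [act, eps, hjk]
  · by_cases hk : i = k
    · subst hk
      simp [act, eps, hjk.symm]
    · simp [act, eps, hi, hk, Equiv.swap_apply_of_ne_of_ne hi hk]

open Classical in
/-- `R_w = R₊ ∩ w⁻¹ R₋`. -/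
def inversionRoots (w : Equiv.Perm (Fin N)) : Finset (Fin N → ℝ) :=
  (posRoots N).filter fun α => -(act w α) ∈ posRoots N

/-- The length `ℓ(w) = |R_w|`. -/
def length (w : Equiv.Perm (Fin N)) : ℕ := (inversionRoots w).card

/-- The list `[j_1, …, j_l]` is a reduced expression `w = s_{j_l} ⋯ s_{j_2} s_{j_1}`. -/
def IsReducedWord (J : List (SimpleIndex N)) (w : Equiv.Perm (Fin N)) : Prop :=
  (J.map simpleRefl).reverse.prod = w ∧ J.length = length w

/-- The roots `α_{j_1}, s_{j_1}(α_{j_2}), …, s_{j_1} s_{j_2} ⋯ s_{j_{l-1}}(α_{j_l})`. -/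
def wordRoots : List (SimpleIndex N) → List (Fin N → ℝ)
  | [] => []
  | j :: J => simpleRoot j :: (wordRoots J).map (act (simpleRefl j))

/-- `ρ = ½ ∑_{α ∈ R₊} α`. -/
def rho (N : ℕ) : Fin N → ℝ := (1 / 2 : ℝ) • ∑ α ∈ posRoots N, α

/-! ## Compositions and partitions -/

/-- A composition `μ`, viewed as a vector of `V`. -/
def vec (μ : Fin N →₀ ℕ) : Fin N → ℝ := fun i => (μ i : ℝ)

/-- The action of the Weyl group on compositions. -/
def actComp (w : Equiv.Perm (Fin N)) (μ : Fin N →₀ ℕ) : Fin N →₀ ℕ :=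
  Finsupp.equivMapDomain w μ

/-- Partitions: `μ_1 ≥ μ_2 ≥ ⋯ ≥ μ_N`. -/
def IsPartition (μ : Fin N →₀ ℕ) : Prop := ∀ i j : Fin N, i ≤ j → μ j ≤ μ i

/-- The orbit `W(μ)`. -/
def orbit (μ : Fin N →₀ ℕ) : Set (Fin N →₀ ℕ) := {ν | ∃ w, ν = actComp w μ}

/-- The degree `|μ|`. -/
def deg (μ : Fin N →₀ ℕ) : ℕ := ∑ i, μ i

theorem exists_shortest (μ : Fin N →₀ ℕ) :
    ∃ w : Equiv.Perm (Fin N), IsPartition (actComp w⁻¹ μ) ∧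
      ∀ w' : Equiv.Perm (Fin N), IsPartition (actComp w'⁻¹ μ) → length w ≤ length w' := by
  classical
  have hne : ((Finset.univ : Finset (Equiv.Perm (Fin N))).filter
      fun w => IsPartition (actComp w⁻¹ μ)).Nonempty := by
    let f : Fin N → ℕᵒᵈ := fun i => OrderDual.toDual (μ i)
    refine ⟨Tuple.sort f, ?_⟩
    simp only [Finset.mem_filter, Finset.mem_univ, true_and]
    intro i j hij
    exact Tuple.monotone_sort f hij
  obtain ⟨w, hw, hmin⟩ := Finset.exists_min_image _ length hne
  refine ⟨w, (Finset.mem_filter.mp hw).2, fun w' hw' => hmin w' ?_⟩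
  exact Finset.mem_filter.mpr ⟨Finset.mem_univ _, hw'⟩

/-- `w_μ`, the shortest element `w` of `W` such that `w⁻¹(μ)` is a partition. -/
def shortest (μ : Fin N →₀ ℕ) : Equiv.Perm (Fin N) := (exists_shortest μ).choose

/-- The partition `μ⁺ = w_μ⁻¹(μ)` in the orbit of `μ`. -/
def plus (μ : Fin N →₀ ℕ) : Fin N →₀ ℕ := actComp (shortest μ)⁻¹ μ

/-- `ρ(μ) = w_μ(ρ)`. -/
def rhoOf (μ : Fin N →₀ ℕ) : Fin N → ℝ := act (shortest μ) (rho N)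

/-- The (strict) dominance order among partitions. -/
def DomLT (ν μ : Fin N →₀ ℕ) : Prop :=
  ν ≠ μ ∧ deg ν = deg μ ∧
    ∀ l : Fin N, ∑ k ∈ Finset.Iic l, ν k ≤ ∑ k ∈ Finset.Iic l, μ k

/-- The order `ν ⪯ μ` on compositions. -/
def CompLE (ν μ : Fin N →₀ ℕ) : Prop :=
  (ν ∉ orbit (plus μ) ∧ DomLT (plus ν) (plus μ)) ∨
    (ν ∈ orbit (plus μ) ∧ vec μ - vec ν ∈ posRootLattice N)

end Roots

/-! ## Dunkl and Cherednik operators -/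

section Operators

variable {N : ℕ}

/-- The coordinate exchange operator `K_{jk}`. -/
def exch (j k : Fin N) : MvPolynomial (Fin N) ℂ →ₐ[ℂ] MvPolynomial (Fin N) ℂ :=
  rename (Equiv.swap j k)

/-- The reflection operator `t_j`, which replaces `x_j` by `-x_j`. -/
def sgn (j : Fin N) : MvPolynomial (Fin N) ℂ →ₐ[ℂ] MvPolynomial (Fin N) ℂ :=
  aeval fun i => if i = j then -X i else X i

/-- The operator `t_j t_k K_{jk}`. -/
def sgnExch (j k : Fin N) : MvPolynomial (Fin N) ℂ →ₐ[ℂ] MvPolynomial (Fin N) ℂ :=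
  (sgn j).comp ((sgn k).comp (exch j k))

theorem dvd_sub_of_X (l : MvPolynomial (Fin N) ℂ)
    (σ : MvPolynomial (Fin N) ℂ →ₐ[ℂ] MvPolynomial (Fin N) ℂ)
    (h : ∀ i, l ∣ X i - σ (X i)) (p : MvPolynomial (Fin N) ℂ) : l ∣ p - σ p := by
  have key : (Ideal.Quotient.mkₐ ℂ (Ideal.span {l})).comp σ
      = Ideal.Quotient.mkₐ ℂ (Ideal.span {l}) := by
    apply MvPolynomial.algHom_ext
    intro i
    simp only [AlgHom.comp_apply, Ideal.Quotient.mkₐ_eq_mk]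
    refine (Ideal.Quotient.eq.mpr ?_).symm
    exact Ideal.mem_span_singleton.mpr (h i)
  have hp := DFunLike.congr_fun key p
  simp only [AlgHom.comp_apply, Ideal.Quotient.mkₐ_eq_mk] at hp
  exact Ideal.mem_span_singleton.mp (Ideal.Quotient.eq.mp hp.symm)

/-- For a non-zero polynomial `l` dividing every `p - σ p`, the linear operator
`p ↦ l⁻¹ (p - σ p)` on polynomials. -/
def divDiff (l : MvPolynomial (Fin N) ℂ) (hl : l ≠ 0)
    (σ : MvPolynomial (Fin N) ℂ →ₐ[ℂ] MvPolynomial (Fin N) ℂ)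
    (h : ∀ i, l ∣ X i - σ (X i)) :
    MvPolynomial (Fin N) ℂ →ₗ[ℂ] MvPolynomial (Fin N) ℂ where
  toFun p := (dvd_sub_of_X l σ h p).choose
  map_add' p q := by
    apply mul_left_cancel₀ hl
    rw [mul_add, ← (dvd_sub_of_X l σ h (p + q)).choose_spec,
      ← (dvd_sub_of_X l σ h p).choose_spec, ← (dvd_sub_of_X l σ h q).choose_spec, map_add]
    ring
  map_smul' c p := by
    apply mul_left_cancel₀ hl
    rw [RingHom.id_apply, mul_smul_comm, ← (dvd_sub_of_X l σ h (c • p)).choose_spec,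
      ← (dvd_sub_of_X l σ h p).choose_spec, map_smul, smul_sub]

theorem mul_divDiff (l : MvPolynomial (Fin N) ℂ) (hl : l ≠ 0)
    (σ : MvPolynomial (Fin N) ℂ →ₐ[ℂ] MvPolynomial (Fin N) ℂ)
    (h : ∀ i, l ∣ X i - σ (X i)) (p : MvPolynomial (Fin N) ℂ) :
    l * divDiff l hl σ h p = p - σ p :=
  (dvd_sub_of_X l σ h p).choose_spec.symm

theorem X_sub_X_ne_zero (j k : Fin N) (hjk : k ≠ j) :
    (X j - X k : MvPolynomial (Fin N) ℂ) ≠ 0 :=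
  sub_ne_zero.mpr fun h => hjk (X_injective h).symm

theorem X_add_X_ne_zero (j k : Fin N) : (X j + X k : MvPolynomial (Fin N) ℂ) ≠ 0 := by
  intro h
  have h1 := congrArg (eval fun _ => (1 : ℂ)) h
  norm_num at h1

theorem exch_dvd (j k i : Fin N) :
    (X j - X k : MvPolynomial (Fin N) ℂ) ∣ X i - exch j k (X i) := by
  simp only [exch, rename_X]
  by_cases hi : i = j
  · subst hi
    simp
  · by_cases hk : i = k
    · subst hk
      simp only [Equiv.swap_apply_right]
      exact ⟨-1, by ring⟩
    · simp [Equiv.swap_apply_of_ne_of_ne hi hk]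

theorem sgn_dvd (j i : Fin N) : (X j : MvPolynomial (Fin N) ℂ) ∣ X i - sgn j (X i) := by
  simp only [sgn, aeval_X]
  split_ifs with hi
  · subst hi
    exact ⟨2, by ring⟩
  · simp

theorem sgnExch_dvd (j k : Fin N) (hjk : k ≠ j) (i : Fin N) :
    (X j + X k : MvPolynomial (Fin N) ℂ) ∣ X i - sgnExch j k (X i) := by
  simp only [sgnExch, exch, AlgHom.comp_apply, rename_X]
  by_cases hi : i = j
  · subst hi
    simp [sgn, hjk]
  · by_cases hk : i = k
    · subst hk
      simp [sgn, hjk.symm, add_comm]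
    · simp [Equiv.swap_apply_of_ne_of_ne hi hk, sgn, hi, hk]

/-- The Dunkl operator `∇_j = ∂_j + a ∑_{k ≠ j} (x_j - x_k)⁻¹ (1 - K_{jk})` of type A. -/
def dunklA (a : ℝ) (j : Fin N) : Module.End ℂ (MvPolynomial (Fin N) ℂ) :=
  (pderiv j).toLinearMap +
    (a : ℂ) • ∑ k : {k : Fin N // k ≠ j},
      divDiff (X j - X k.1) (X_sub_X_ne_zero j k.1 k.2) (exch j k.1) (exch_dvd j k.1)

/-- The Dunkl operator of type B,
`∇_j = ∂_j + a ∑_{k ≠ j} ((x_j - x_k)⁻¹ (1 - K_{jk}) + (x_j + x_k)⁻¹ (1 - t_j t_k K_{jk}))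
  + b x_j⁻¹ (1 - t_j)`. -/
def dunklB (a b : ℝ) (j : Fin N) : Module.End ℂ (MvPolynomial (Fin N) ℂ) :=
  (pderiv j).toLinearMap +
    (a : ℂ) • ∑ k : {k : Fin N // k ≠ j},
      (divDiff (X j - X k.1) (X_sub_X_ne_zero j k.1 k.2) (exch j k.1) (exch_dvd j k.1) +
        divDiff (X j + X k.1) (X_add_X_ne_zero j k.1) (sgnExch j k.1)
          (sgnExch_dvd j k.1 k.2)) +
    (b : ℂ) • divDiff (X j) (X_ne_zero j) (sgn j) (sgn_dvd j)

/-- The annihilation-like operator `(2ω)⁻¹ ∇_j` attached to a Dunkl operator. -/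
def annih (ω : ℝ) (nabla : Module.End ℂ (MvPolynomial (Fin N) ℂ)) :
    Module.End ℂ (MvPolynomial (Fin N) ℂ) :=
  ((1 / (2 * ω) : ℝ) : ℂ) • nabla

/-- The creation-like operator `x_j - (2ω)⁻¹ ∇_j` attached to a Dunkl operator. -/
def creat (ω : ℝ) (j : Fin N) (nabla : Module.End ℂ (MvPolynomial (Fin N) ℂ)) :
    Module.End ℂ (MvPolynomial (Fin N) ℂ) :=
  LinearMap.mulLeft ℂ (X j) - ((1 / (2 * ω) : ℝ) : ℂ) • nabla

/-- The Cherednik operator `d_j = 2ω α_j† α_j + a ∑_{k > j} K_{jk}` of type A. -/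
def cherednikA (a ω : ℝ) (j : Fin N) : Module.End ℂ (MvPolynomial (Fin N) ℂ) :=
  ((2 * ω : ℝ) : ℂ) • (creat ω j (dunklA a j) * annih ω (dunklA a j)) +
    (a : ℂ) • ∑ k ∈ Finset.Ioi j, (exch j k).toLinearMap

/-- The Cherednik operator `d_j = 2ω α_j† α_j + a ∑_{k > j} (1 + t_j t_k) K_{jk} + b t_j`
of type B. -/
def cherednikB (a b ω : ℝ) (j : Fin N) : Module.End ℂ (MvPolynomial (Fin N) ℂ) :=
  ((2 * ω : ℝ) : ℂ) • (creat ω j (dunklB a b j) * annih ω (dunklB a b j)) +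
    (a : ℂ) • ∑ k ∈ Finset.Ioi j, ((exch j k).toLinearMap + (sgnExch j k).toLinearMap) +
    (b : ℂ) • (sgn j).toLinearMap

/-! ## Non-symmetric Hermite and Laguerre polynomials -/

/-- `p = x^μ + ∑ v_ν x^ν`, the sum being over `ν ≠ μ` with `ν ⪯ μ` or `|ν| < |μ|`. -/
def IsMonicTriangular (μ : Fin N →₀ ℕ) (p : MvPolynomial (Fin N) ℂ) : Prop :=
  p.coeff μ = 1 ∧ ∀ ν, ν ≠ μ → p.coeff ν ≠ 0 → CompLE ν μ ∨ deg ν < deg μ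

/-- The defining properties of the non-symmetric multivariable Hermite polynomial `h_μ`:
triangularity and
`∑_j λ_j d_j h_μ = ⟨λ, μ + a ρ(μ) + ½ a (N - 1) 1^N⟩ h_μ` for all compositions `λ`. -/
def IsHermite (a ω : ℝ) (μ : Fin N →₀ ℕ) (p : MvPolynomial (Fin N) ℂ) : Prop :=
  IsMonicTriangular μ p ∧
    ∀ lam : Fin N →₀ ℕ,
      (∑ j, (lam j : ℂ) • cherednikA a ω j) p =
        ((form (vec lam) (vec μ + a • rhoOf μ + fun _ => a * ((N : ℝ) - 1) / 2) : ℝ) : ℂ) • p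

/-- The defining properties of the non-symmetric multivariable Laguerre polynomial `h_μ`:
triangularity and
`∑_j λ_j d_j h_μ = ⟨λ, μ + 2 a ρ(μ) + (a (N - 1) + b) 1^N⟩ h_μ` for all compositions `λ`. -/
def IsLaguerre (a b ω : ℝ) (μ : Fin N →₀ ℕ) (p : MvPolynomial (Fin N) ℂ) : Prop :=
  IsMonicTriangular μ p ∧
    ∀ lam : Fin N →₀ ℕ,
      (∑ j, (lam j : ℂ) • cherednikB a b ω j) p =
        ((form (vec lam)
          (vec μ + (2 * a) • rhoOf μ + fun _ => a * ((N : ℝ) - 1) + b) : ℝ) : ℂ) • p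

/-- The non-symmetric Hermite polynomial `h_μ^{(A)}`; the polynomial with the defining
properties (the theorem asserts that it exists and is unique). -/
def hermite (a ω : ℝ) (μ : Fin N →₀ ℕ) : MvPolynomial (Fin N) ℂ :=
  Classical.epsilon (IsHermite a ω μ)

/-- The non-symmetric Laguerre polynomial `h_μ^{(B)}`; the polynomial with the defining
properties (the theorem asserts that it exists and is unique). -/
def laguerre (a b ω : ℝ) (μ : Fin N →₀ ℕ) : MvPolynomial (Fin N) ℂ :=
  Classical.epsilon (IsLaguerre a b ω μ)

/-! ## Inner products -/

/-- The reference state of type A. -/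
def groundA (a ω : ℝ) (x : Fin N → ℝ) : ℝ :=
  (∏ j, ∏ k ∈ Finset.Ioi j, |x j - x k| ^ a) * Real.exp (-(1 / 2) * ω * ∑ m, x m ^ 2)

/-- The reference state of type B. -/
def groundB (a b ω : ℝ) (x : Fin N → ℝ) : ℝ :=
  (∏ j, ∏ k ∈ Finset.Ioi j, |x j ^ 2 - x k ^ 2| ^ a) * (∏ l, |x l| ^ b) *
    Real.exp (-(1 / 2) * ω * ∑ m, x m ^ 2)

/-- `⟨f, g⟩ = ∫ |φ(x)|² conj(f(x)) g(x) dx` over `ℝ^N`. -/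
def innerWith (φ : (Fin N → ℝ) → ℝ) (f g : MvPolynomial (Fin N) ℂ) : ℂ :=
  ∫ x : Fin N → ℝ, ((|φ x| ^ 2 : ℝ) : ℂ) *
    (starRingEnd ℂ) (eval (fun i => (x i : ℂ)) f) * eval (fun i => (x i : ℂ)) g

def innerA (a ω : ℝ) (f g : MvPolynomial (Fin N) ℂ) : ℂ := innerWith (groundA a ω) f g

def innerB (a b ω : ℝ) (f g : MvPolynomial (Fin N) ℂ) : ℂ := innerWith (groundB a b ω) f g

/-! ## The factors of the norm formulas -/

/-- `⟨α^∨, μ + aρ⟩² - a²`. -/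
def denomA (a : ℝ) (μ : Fin N →₀ ℕ) (α : Fin N → ℝ) : ℝ :=
  form (coroot α) (vec μ + a • rho N) ^ 2 - a ^ 2

/-- `⟨α^∨, μ + aρ⟩² / (⟨α^∨, μ + aρ⟩² - a²)`. -/
def factorA (a : ℝ) (μ : Fin N →₀ ℕ) (α : Fin N → ℝ) : ℝ :=
  form (coroot α) (vec μ + a • rho N) ^ 2 / denomA a μ α

/-- `⟨α^∨, μ + 2aρ⟩² - a² (1 + (-1)^⟨α^∨, μ⟩)²`; the exponent is an integer for every root
`α`, and the floor only turns this real number into an element of `ℤ`. -/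
def denomB (a : ℝ) (μ : Fin N →₀ ℕ) (α : Fin N → ℝ) : ℝ :=
  form (coroot α) (vec μ + (2 * a) • rho N) ^ 2 -
    a ^ 2 * (1 + (-1 : ℝ) ^ ⌊form (coroot α) (vec μ)⌋) ^ 2

/-- `⟨α^∨, μ + 2aρ⟩² / (⟨α^∨, μ + 2aρ⟩² - a² (1 + (-1)^⟨α^∨, μ⟩)²)`. -/
def factorB (a : ℝ) (μ : Fin N →₀ ℕ) (α : Fin N → ℝ) : ℝ :=
  form (coroot α) (vec μ + (2 * a) • rho N) ^ 2 / denomB a μ α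

end Operators

end Calogero

end

noncomputable section

namespace Calogero

open MvPolynomial

/-! ## Roots and inversions -/

section Combinatorics

variable {N : ℕ}

/-! Both types are instances of one construction. Give the mirrors x_j = s x_k (s = ±1) a
multiplicity A s ≥ 0 and the mirrors x_j = 0 a multiplicity b ≥ 0. Type A is A 1 = a, A (-1) = 0, b
= 0; type B is A 1 = A (-1) = a with its b. Put q = A 1 + A (-1), and let e_j(μ) = μ_j + q (N - 1 -
p_j) + b, where p_j is the 0-based position of the entry j after stable decreasing sorting. Stable
sorting is exactly w_μ⁻¹ (`stablySorts_shortest`), so these are the prescribed eigenvalues.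

Three facts carry the proof. First, d_j x^μ = e_j(μ) x^μ plus strictly lower monomials
(`cherednik_triangular`); this comes from one computation for each pair of entries
(`pair_triangular`). Second, d_j is self-adjoint (`moment_cherednik`), because 2ω x_j - ∇_j is the
adjoint of ∇_j (`moment_dunkl_add`). The weight need not be smooth on the mirrors, so the
integration by parts is done for ∏ (ℓ² + δ)^κ times the Gaussian, followed by δ → 0
(`integral_weight_eq_zero`). Third, the tuple (e_j(μ))_j determines μ (`eigenval_injective`).

Existence is orthogonal projection. Let h be x^μ minus its projection to the span V of the lower
monomials. Then (d_j - e_j(μ)) h lies in V by triangularity and is orthogonal to V by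
self-adjointness, so it vanishes; commutativity of the d_j plays no role. Uniqueness holds because a
maximal monomial of a joint eigenvector must have the same eigenvalues, hence is x^μ
(`IsEigen.eq_or_below`).

For the norms let μ_j < μ_{j+1}, f = h_μ, and let K exchange x_j and x_{j+1}. The relations between
K and the d_i show that g = K f + c f is the polynomial of s_j μ, with c = (A 1 + A (-1) (-1)^{μ_j +
μ_{j+1}}) / (e_{j+1}(μ) - e_j(μ)) (`nonsym_actComp`). Since K is a self-adjoint involution and f is
orthogonal to g, ⟨g, g⟩ = (1 - c²) ⟨f, f⟩. Passing back from s_j μ to μ adds one inversion to the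
sorting permutation, and its root contributes exactly 1 / (1 - c²). Induction on the number of
inversions gives the product over R_{w_μ} (`norm_formula`). The denominators are positive because |A
1 ± A (-1)| ≤ q while the eigenvalue gap exceeds q.

For reduced words, the listed roots contain R_w and there are only ℓ(w) of them, so they enumerate
R_w without repetition (`prod_wordRoots`). -/

theorem form_coroot_eps_sub {j k : Fin N} (hjk : j ≠ k) (v : Fin N → ℝ) :
    form (coroot (eps j - eps k)) v = v j - v k := by
  have h2 : ∀ u : Fin N → ℝ, form (eps j - eps k) u = u j - u k := by
    intro u
    simp [form, eps, sub_mul, Finset.sum_sub_distrib, Pi.single_apply]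
  have h3 : form (eps j - eps k) (eps j - eps k) = 2 := by
    rw [h2]
    simp [eps, hjk, hjk.symm]
    norm_num
  rw [coroot, h3, div_self two_ne_zero, one_smul, h2]

theorem eps_sub_apply (j k i : Fin N) :
    (eps j - eps k) i = (if i = j then 1 else 0) - (if i = k then (1 : ℝ) else 0) := by
  simp [eps, Pi.single_apply]

theorem eps_sub_injective {j k j' k' : Fin N} (hjk : j ≠ k)
    (h : eps j - eps k = eps j' - eps k') : j = j' ∧ k = k' := by
  have hj := congrFun h j
  have hk := congrFun h k
  rw [eps_sub_apply, eps_sub_apply] at hj hk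
  constructor
  · by_contra hne
    simp only [if_true, if_neg hjk, if_neg hne] at hj
    split_ifs at hj <;> norm_num at hj
  · by_contra hne
    simp only [if_true, if_neg hjk.symm, if_neg hne] at hk
    split_ifs at hk <;> norm_num at hk

theorem sum_Iic_eps_sub (j k l : Fin N) :
    ∑ i ∈ Finset.Iic l, (eps j - eps k) i
      = (if j ≤ l then 1 else 0) - (if k ≤ l then (1 : ℝ) else 0) := by
  simp [eps, Pi.single_apply]

theorem SimpleIndex.lo_lt_hi (j : SimpleIndex N) : j.lo < j.hi := by
  simp [SimpleIndex.lo, SimpleIndex.hi]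

/-- Partial sums are additive and nonnegative on simple roots. They serve as the functionals that
tell positive roots from negative ones and make the order on an orbit antisymmetric. -/
theorem sum_Iic_nonneg_of_mem_posRootLattice {v : Fin N → ℝ} (hv : v ∈ posRootLattice N)
    (l : Fin N) : 0 ≤ ∑ i ∈ Finset.Iic l, v i := by
  induction hv using AddSubmonoid.closure_induction with
  | mem x hx =>
    obtain ⟨j, rfl⟩ := hx
    rw [simpleRoot, sum_Iic_eps_sub]
    split_ifs with h1 h2 h2
    · norm_num
    · norm_num
    · exact absurd (j.lo_lt_hi.le.trans h2) h1
    · norm_num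
  | zero => simp
  | add x y _ _ hx hy =>
    simp only [Pi.add_apply, Finset.sum_add_distrib]
    exact add_nonneg hx hy

theorem eps_sub_mem_posRootLattice {j k : Fin N} (hjk : j < k) :
    eps j - eps k ∈ posRootLattice N := by
  obtain ⟨k, hk⟩ := k
  induction k with
  | zero => exact absurd hjk (by simp [Fin.lt_def])
  | succ k ih =>
    let s : SimpleIndex N := ⟨k, hk⟩
    have hs : eps (s.lo) - eps (⟨k + 1, hk⟩ : Fin N) ∈ posRootLattice N :=
      AddSubmonoid.subset_closure ⟨s, rfl⟩
    by_cases h : j = s.lo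
    · rw [h]; exact hs
    · have hlt : j < s.lo := by
        rw [Fin.lt_def] at hjk ⊢
        have : j.1 ≠ k := fun h' => h (Fin.ext h')
        simp only [SimpleIndex.lo, s] at hjk ⊢
        omega
      have := add_mem (ih s.lo.2 hlt) hs
      simpa [SimpleIndex.lo, s] using this

theorem mem_posRoots_iff {α : Fin N → ℝ} :
    α ∈ posRoots N ↔ ∃ j k : Fin N, j < k ∧ α = eps j - eps k := by
  classical
  simp only [posRoots, roots, Finset.mem_filter, Finset.mem_image, Finset.mem_univ, true_and,
    Prod.exists]
  constructor
  · rintro ⟨⟨j, k, hjk, rfl⟩, hα⟩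
    refine ⟨j, k, ?_, rfl⟩
    by_contra hlt
    have hkj : k < j := lt_of_le_of_ne (not_lt.mp hlt) (Ne.symm hjk)
    have := sum_Iic_nonneg_of_mem_posRootLattice hα k
    rw [sum_Iic_eps_sub, if_neg (not_le.mpr hkj), if_pos le_rfl] at this
    norm_num at this
  · rintro ⟨j, k, hjk, rfl⟩
    exact ⟨⟨j, k, hjk.ne, rfl⟩, eps_sub_mem_posRootLattice hjk⟩

theorem eps_sub_mem_posRoots_iff {j k : Fin N} (hjk : j ≠ k) :
    eps j - eps k ∈ posRoots N ↔ j < k := by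
  rw [mem_posRoots_iff]
  constructor
  · rintro ⟨j', k', h, he⟩
    obtain ⟨rfl, rfl⟩ := eps_sub_injective hjk he
    exact h
  · exact fun h => ⟨j, k, h, rfl⟩

theorem act_eps_sub (w : Equiv.Perm (Fin N)) (j k : Fin N) :
    act w (eps j - eps k) = eps (w j) - eps (w k) := by
  funext i
  simp only [act, eps_sub_apply, Equiv.Perm.inv_eq_iff_eq]

/-- The inversions of a permutation. -/
def inversions (w : Equiv.Perm (Fin N)) : Finset (Fin N × Fin N) :=
  Finset.univ.filter fun p => p.1 < p.2 ∧ w p.2 < w p.1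

theorem mem_inversions {w : Equiv.Perm (Fin N)} {p : Fin N × Fin N} :
    p ∈ inversions w ↔ p.1 < p.2 ∧ w p.2 < w p.1 := by
  simp [inversions]

theorem mem_inversionRoots_iff {w : Equiv.Perm (Fin N)} {α : Fin N → ℝ} :
    α ∈ inversionRoots w ↔ ∃ p ∈ inversions w, eps p.1 - eps p.2 = α := by
  classical
  simp only [inversionRoots, Finset.mem_filter, mem_posRoots_iff (α := α)]
  constructor
  · rintro ⟨⟨j, k, hjk, rfl⟩, h⟩
    refine ⟨(j, k), mem_inversions.mpr ⟨hjk, ?_⟩, rfl⟩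
    rw [act_eps_sub, neg_sub] at h
    exact (eps_sub_mem_posRoots_iff (fun e => hjk.ne' (w.injective e))).mp h
  · rintro ⟨⟨j, k⟩, hp, rfl⟩
    obtain ⟨hjk, hw⟩ := mem_inversions.mp hp
    refine ⟨⟨j, k, hjk, rfl⟩, ?_⟩
    rw [act_eps_sub, neg_sub]
    exact (eps_sub_mem_posRoots_iff hw.ne).mpr hw

open Classical in
theorem inversionRoots_eq_image (w : Equiv.Perm (Fin N)) :
    inversionRoots w = (inversions w).image fun p => eps p.1 - eps p.2 := by
  ext α
  rw [mem_inversionRoots_iff, Finset.mem_image]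

theorem injOn_inversions (w : Equiv.Perm (Fin N)) :
    Set.InjOn (fun p : Fin N × Fin N => eps p.1 - eps p.2) (inversions w : Set (Fin N × Fin N)) := by
  intro p hp q _ h
  obtain ⟨h1, h2⟩ := eps_sub_injective (mem_inversions.mp (Finset.mem_coe.mp hp)).1.ne h
  exact Prod.ext h1 h2

theorem length_eq (w : Equiv.Perm (Fin N)) : length w = (inversions w).card := by
  classical
  rw [length, inversionRoots_eq_image, Finset.card_image_of_injOn (injOn_inversions w)]

theorem prod_inversionRoots (w : Equiv.Perm (Fin N)) (f : (Fin N → ℝ) → ℝ) :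
    ∏ α ∈ inversionRoots w, f α = ∏ p ∈ inversions w, f (eps p.1 - eps p.2) := by
  classical
  rw [inversionRoots_eq_image, Finset.prod_image (injOn_inversions w)]

/-- The index i occurs as the smaller index of N - 1 - i positive roots and as the larger index of i
of them, counting from 0. -/
theorem rho_apply (i : Fin N) : rho N i = ((N : ℝ) - 1) / 2 - i := by
  classical
  have h : posRoots N
      = ((Finset.univ : Finset (Fin N)).sigma fun j => Finset.Ioi j).image
        fun p => eps p.1 - eps p.2 := by
    ext α
    simp [mem_posRoots_iff, eq_comm]
  have hinj : Set.InjOn (fun p : (_ : Fin N) × Fin N => eps p.1 - eps p.2)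
      (((Finset.univ : Finset (Fin N)).sigma fun j => Finset.Ioi j) :
        Set ((_ : Fin N) × Fin N)) := by
    rintro ⟨j, k⟩ hp ⟨j', k'⟩ _ h
    have hjk : j < k := by simpa using hp
    obtain ⟨rfl, rfl⟩ := eps_sub_injective hjk.ne h
    rfl
  have h1 : ∑ j : Fin N, ∑ k ∈ Finset.Ioi j, (if i = j then (1 : ℝ) else 0) = N - 1 - i := by
    simp only [Finset.sum_const, nsmul_eq_mul, Fin.card_Ioi, mul_ite, mul_one, mul_zero,
      Finset.sum_ite_eq, Finset.mem_univ, if_true]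
    have : (i : ℕ) + 1 ≤ N := i.2
    rw [Nat.sub_sub, Nat.cast_sub (by omega)]
    push_cast; ring
  have h2 : ∑ j : Fin N, ∑ k ∈ Finset.Ioi j, (if i = k then (1 : ℝ) else 0) = i := by
    simp only [Finset.sum_ite_eq, Finset.mem_Ioi]
    rw [Finset.sum_boole, Finset.filter_gt_eq_Iio]
    simp
  rw [rho, h, Finset.sum_image hinj, Finset.sum_sigma, Pi.smul_apply, Finset.sum_apply]
  simp only [Finset.sum_apply, eps_sub_apply, Finset.sum_sub_distrib]
  rw [h1, h2, smul_eq_mul]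
  ring

/-! ## Reduced words -/

theorem simpleRefl_inv (j : SimpleIndex N) : (simpleRefl j)⁻¹ = simpleRefl j := by
  simp [simpleRefl]

theorem act_simpleRefl_act_simpleRefl (j : SimpleIndex N) (v : Fin N → ℝ) :
    act (simpleRefl j) (act (simpleRefl j) v) = v := by
  funext i
  simp [act, simpleRefl]

/-- A simple reflection reverses only one pair. This drives both the enumeration of inversions by a
word and the count of inversions under an adjacent exchange. -/
theorem simpleRefl_lt {j : SimpleIndex N} {p q : Fin N} (hpq : p < q)
    (h : ¬(p = j.lo ∧ q = j.hi)) : simpleRefl j p < simpleRefl j q := by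
  have hlo : (j.lo : ℕ) = j.1 := rfl
  have hhi : (j.hi : ℕ) = j.1 + 1 := rfl
  simp only [simpleRefl, Equiv.swap_apply_def, Fin.ext_iff, Fin.lt_def] at *
  split_ifs <;> omega

/-- The first letter s_j of the word acts first. An inversion of the whole product is either α_j
itself, or s_j carries it to an inversion of the remaining product, because s_j keeps the order of
every other pair. Reducedness is not needed for this inclusion. -/
theorem inversionRoots_subset_wordRoots (J : List (SimpleIndex N)) :
    ∀ α ∈ inversionRoots (J.map simpleRefl).reverse.prod, α ∈ wordRoots J := by
  induction J with
  | nil =>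
    intro α hα
    obtain ⟨p, hp, -⟩ := mem_inversionRoots_iff.mp hα
    obtain ⟨h1, h2⟩ := mem_inversions.mp hp
    simp only [List.map_nil, List.reverse_nil, List.prod_nil, Equiv.Perm.one_apply] at h2
    exact absurd h1 h2.asymm
  | cons j J ih =>
    intro α hα
    simp only [List.map_cons, List.reverse_cons, List.prod_append, List.prod_cons, List.prod_nil,
      mul_one] at hα
    obtain ⟨⟨p, q⟩, hp, rfl⟩ := mem_inversionRoots_iff.mp hα
    obtain ⟨hpq, hw⟩ := mem_inversions.mp hp
    simp only [wordRoots, List.mem_cons, List.mem_map]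
    by_cases h : p = j.lo ∧ q = j.hi
    · left; rw [simpleRoot, ← h.1, ← h.2]
    · right
      refine ⟨act (simpleRefl j) (eps p - eps q), ih _ ?_, act_simpleRefl_act_simpleRefl _ _⟩
      rw [act_eps_sub, mem_inversionRoots_iff]
      exact ⟨(simpleRefl j p, simpleRefl j q),
        mem_inversions.mpr ⟨simpleRefl_lt hpq h, hw⟩, rfl⟩

theorem length_wordRoots (J : List (SimpleIndex N)) : (wordRoots J).length = J.length := by
  induction J with
  | nil => rfl
  | cons j J ih => simp [wordRoots, ih]

/-- A list that covers a finite set and has no more terms than the set has elements cannot repeat or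
contain anything else. -/
theorem prod_map_eq_prod_of_subset {β : Type*} {L : List β} {S : Finset β}
    (hS : ∀ x ∈ S, x ∈ L) (hL : L.length = S.card) (f : β → ℝ) :
    (L.map f).prod = ∏ x ∈ S, f x := by
  classical
  have hsub : S ⊆ L.toFinset := fun x hx => List.mem_toFinset.mpr (hS x hx)
  have hcard : L.toFinset.card ≤ S.card := hL ▸ L.toFinset_card_le
  have hEq : S = L.toFinset := Finset.eq_of_subset_of_card_le hsub hcard
  have hnd : L.Nodup := by
    rw [← Multiset.coe_nodup, ← Multiset.toFinset_card_eq_card_iff_nodup]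
    have : L.toFinset.card = L.length := by rw [← hEq, hL]
    simpa using this
  rw [hEq, List.prod_toFinset f hnd]

theorem prod_wordRoots {J : List (SimpleIndex N)} {w : Equiv.Perm (Fin N)}
    (hJ : IsReducedWord J w) (f : (Fin N → ℝ) → ℝ) :
    ((wordRoots J).map f).prod = ∏ α ∈ inversionRoots w, f α := by
  obtain ⟨rfl, hl⟩ := hJ
  exact prod_map_eq_prod_of_subset (inversionRoots_subset_wordRoots J)
    ((length_wordRoots J).trans hl) f

end Combinatorics

/-! ## The shortest sorting permutation -/

section Sorting

variable {N : ℕ}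

/-- `w` sorts `μ` decreasingly and keeps the order of equal entries. -/
def StablySorts (w : Equiv.Perm (Fin N)) (μ : Fin N →₀ ℕ) : Prop :=
  ∀ i j, i < j → μ (w j) < μ (w i) ∨ μ (w i) = μ (w j) ∧ w i < w j

theorem actComp_apply (w : Equiv.Perm (Fin N)) (μ : Fin N →₀ ℕ) (i : Fin N) :
    actComp w μ i = μ (w⁻¹ i) := rfl

theorem actComp_mul (v w : Equiv.Perm (Fin N)) (μ : Fin N →₀ ℕ) :
    actComp (v * w) μ = actComp v (actComp w μ) := by
  ext i
  simp [actComp_apply, mul_inv_rev]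

theorem isPartition_actComp_inv {w : Equiv.Perm (Fin N)} {μ : Fin N →₀ ℕ} :
    IsPartition (actComp w⁻¹ μ) ↔ ∀ i j, i ≤ j → μ (w j) ≤ μ (w i) := by
  simp [IsPartition, actComp_apply]

theorem exists_stablySorts (μ : Fin N →₀ ℕ) : ∃ w, StablySorts w μ := by
  let f : Fin N → ℕᵒᵈ := fun i => OrderDual.toDual (μ i)
  obtain ⟨h1, h2⟩ := (Tuple.eq_sort_iff (f := f) (σ := Tuple.sort f)).mp rfl
  refine ⟨Tuple.sort f, fun i j hij => ?_⟩
  have h3 : μ (Tuple.sort f j) ≤ μ (Tuple.sort f i) := h1 hij.le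
  rcases h3.lt_or_eq with h | h
  · exact Or.inl h
  · exact Or.inr ⟨h.symm, h2 i j hij (congrArg OrderDual.toDual h.symm)⟩

theorem StablySorts.unique {v w : Equiv.Perm (Fin N)} {μ : Fin N →₀ ℕ}
    (hv : StablySorts v μ) (hw : StablySorts w μ) : v = w := by
  let f : Fin N → ℕᵒᵈ := fun i => OrderDual.toDual (μ i)
  have key : ∀ u, StablySorts u μ → u = Tuple.sort f := by
    intro u hu
    refine Tuple.eq_sort_iff.mpr ⟨?_, ?_⟩
    · intro i j hij
      rcases hij.lt_or_eq with h | rfl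
      · rcases hu i j h with h | h
        · exact h.le
        · exact h.1.symm.le
      · exact le_rfl
    · intro i j hij he
      have he : μ (u i) = μ (u j) := he
      rcases hu i j hij with h | h
      · omega
      · exact h.2
  rw [key v hv, key w hw]

theorem StablySorts.lt_iff {w : Equiv.Perm (Fin N)} {μ : Fin N →₀ ℕ} (hw : StablySorts w μ)
    (j k : Fin N) : w⁻¹ j < w⁻¹ k ↔ μ k < μ j ∨ μ j = μ k ∧ j < k := by
  have key : ∀ j k, w⁻¹ j < w⁻¹ k → μ k < μ j ∨ μ j = μ k ∧ j < k := by
    intro j k h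
    simpa using hw _ _ h
  refine ⟨key j k, fun h => ?_⟩
  by_contra hlt
  rcases (not_lt.mp hlt).lt_or_eq with h' | h'
  · rcases key k j h' with h'' | h'' <;> omega
  · have := w⁻¹.injective h'
    subst this
    omega

/-- Let v be the stable sort. Its inversions only involve entries of different size, and every
sorting w must invert the same pairs of entries; this is the injection g from the inversions of v to
those of w. Minimality of w makes g onto, so w inverts no pair of equal entries either, which is
stability. -/
theorem stablySorts_shortest (μ : Fin N →₀ ℕ) : StablySorts (shortest μ) μ := by
  obtain ⟨hpart, hmin⟩ := (exists_shortest μ).choose_spec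
  change IsPartition (actComp (shortest μ)⁻¹ μ) at hpart
  change ∀ w', _ → length (shortest μ) ≤ _ at hmin
  obtain ⟨v, hv⟩ := exists_stablySorts μ
  rw [isPartition_actComp_inv] at hpart
  have hvpart : IsPartition (actComp v⁻¹ μ) := by
    rw [isPartition_actComp_inv]
    intro i j hij
    rcases hij.lt_or_eq with h | rfl
    · rcases hv i j h with h | h <;> omega
    · exact le_rfl
  have hle := hmin v hvpart
  rw [length_eq, length_eq] at hle
  set w := shortest μ
  let g : Fin N × Fin N → Fin N × Fin N := fun p => (w⁻¹ (v p.1), w⁻¹ (v p.2))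
  have hginj : Function.Injective g := by
    intro p q h
    simp only [g, Prod.mk.injEq, EmbeddingLike.apply_eq_iff_eq] at h
    exact Prod.ext h.1 h.2
  have hstrict : ∀ p ∈ inversions v, μ (v p.2) < μ (v p.1) := by
    intro p hp
    obtain ⟨h1, h2⟩ := mem_inversions.mp hp
    rcases hv _ _ h1 with h | h
    · exact h
    · exact absurd h.2 h2.asymm
  have hsub : (inversions v).image g ⊆ inversions w := by
    intro q hq
    obtain ⟨p, hp, rfl⟩ := Finset.mem_image.mp hq
    obtain ⟨h1, h2⟩ := mem_inversions.mp hp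
    refine mem_inversions.mpr ⟨?_, by simpa [g] using h2⟩
    by_contra hlt
    have := hpart _ _ (not_lt.mp hlt)
    simp only [g, Equiv.Perm.inv_def, Equiv.apply_symm_apply] at this
    exact absurd (hstrict p hp) (not_lt.mpr this)
  have heq : (inversions v).image g = inversions w :=
    Finset.eq_of_subset_of_card_le hsub
      (by rw [Finset.card_image_of_injective _ hginj]; exact hle)
  intro i j hij
  rcases (hpart i j hij.le).lt_or_eq with h | h
  · exact Or.inl h
  · refine Or.inr ⟨h.symm, ?_⟩
    by_contra hlt
    have hji : w j < w i :=
      lt_of_le_of_ne (not_lt.mp hlt) fun e => hij.ne' (w.injective e)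
    have hmem : (i, j) ∈ inversions w := mem_inversions.mpr ⟨hij, hji⟩
    rw [← heq] at hmem
    obtain ⟨p, hp, hpg⟩ := Finset.mem_image.mp hmem
    have := hstrict p hp
    simp only [g, Prod.mk.injEq, Equiv.Perm.inv_eq_iff_eq] at hpg
    rw [hpg.1, hpg.2] at this
    omega

/-- The position of the entry `j` of `μ` after sorting. -/
def pos (μ : Fin N →₀ ℕ) (j : Fin N) : Fin N := (shortest μ)⁻¹ j

theorem pos_lt_pos_iff {μ : Fin N →₀ ℕ} {j k : Fin N} :
    pos μ j < pos μ k ↔ μ k < μ j ∨ μ j = μ k ∧ j < k :=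
  (stablySorts_shortest μ).lt_iff j k

theorem pos_injective (μ : Fin N →₀ ℕ) : Function.Injective (pos μ) := (shortest μ)⁻¹.injective

theorem rhoOf_apply (μ : Fin N →₀ ℕ) (j : Fin N) :
    rhoOf μ j = ((N : ℝ) - 1) / 2 - (pos μ j : ℕ) := rho_apply _

theorem card_pos_lt (μ : Fin N →₀ ℕ) (j : Fin N) :
    (Finset.univ.filter fun k => pos μ j < pos μ k).card = N - 1 - pos μ j := by
  have h : (Finset.univ.filter fun k => pos μ j < pos μ k)
      = (Finset.Ioi (pos μ j)).map (shortest μ).toEmbedding := by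
    ext k
    simp only [Finset.mem_filter, Finset.mem_univ, true_and, Finset.mem_map, Finset.mem_Ioi,
      Equiv.coe_toEmbedding]
    constructor
    · exact fun h => ⟨_, h, by simp [pos]⟩
    · rintro ⟨i, hi, rfl⟩
      simpa [pos] using hi
  rw [h, Finset.card_map, Fin.card_Ioi]

theorem card_lt_pos (μ : Fin N →₀ ℕ) (j : Fin N) :
    (Finset.univ.filter fun k => pos μ k < pos μ j).card = pos μ j := by
  have h : (Finset.univ.filter fun k => pos μ k < pos μ j)
      = (Finset.Iio (pos μ j)).map (shortest μ).toEmbedding := by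
    ext k
    simp only [Finset.mem_filter, Finset.mem_univ, true_and, Finset.mem_map, Finset.mem_Iio,
      Equiv.coe_toEmbedding]
    constructor
    · exact fun h => ⟨_, h, by simp [pos]⟩
    · rintro ⟨i, hi, rfl⟩
      simpa [pos] using hi
  rw [h, Finset.card_map, Fin.card_Iio]

theorem plus_apply (μ : Fin N →₀ ℕ) (i : Fin N) : plus μ i = μ (shortest μ i) := by
  simp [plus, actComp_apply]

theorem plus_pos (μ : Fin N →₀ ℕ) (j : Fin N) : plus μ (pos μ j) = μ j := by
  simp [plus_apply, pos]

theorem isPartition_plus (μ : Fin N →₀ ℕ) : IsPartition (plus μ) :=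
  (exists_shortest μ).choose_spec.1

theorem mem_orbit_refl (μ : Fin N →₀ ℕ) : μ ∈ orbit μ := ⟨1, by ext; simp [actComp_apply]⟩

theorem mem_orbit_plus (μ : Fin N →₀ ℕ) : μ ∈ orbit (plus μ) :=
  ⟨shortest μ, by ext; simp [plus_apply, actComp_apply]⟩

theorem IsPartition.eq_of_mem_orbit {μ ν : Fin N →₀ ℕ} (hμ : IsPartition μ) (hν : IsPartition ν)
    (h : ν ∈ orbit μ) : ν = μ := by
  obtain ⟨w, rfl⟩ := h
  have h1 : Antitone (⇑μ ∘ ((1 : Equiv.Perm (Fin N)) : Fin N → Fin N)) := fun i j hij => hμ i j hij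
  have h2 : Antitone (⇑μ ∘ (w⁻¹ : Equiv.Perm (Fin N))) := fun i j hij => hν i j hij
  ext i
  exact congrFun (Tuple.unique_antitone h2 h1) i

theorem orbit_trans {μ ν κ : Fin N →₀ ℕ} (h1 : μ ∈ orbit ν) (h2 : ν ∈ orbit κ) : μ ∈ orbit κ := by
  obtain ⟨v, rfl⟩ := h1
  obtain ⟨w, rfl⟩ := h2
  exact ⟨v * w, (actComp_mul _ _ _).symm⟩

theorem orbit_symm {μ ν : Fin N →₀ ℕ} (h : μ ∈ orbit ν) : ν ∈ orbit μ := by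
  obtain ⟨v, rfl⟩ := h
  exact ⟨v⁻¹, by ext; simp [actComp_apply]⟩

theorem plus_eq_of_mem_orbit {μ κ : Fin N →₀ ℕ} (hκ : IsPartition κ) (h : μ ∈ orbit κ) :
    plus μ = κ :=
  hκ.eq_of_mem_orbit (isPartition_plus μ) (orbit_trans (orbit_symm (mem_orbit_plus μ)) h)

theorem mem_orbit_plus_iff {μ ν : Fin N →₀ ℕ} : ν ∈ orbit (plus μ) ↔ plus ν = plus μ :=
  ⟨plus_eq_of_mem_orbit (isPartition_plus μ), fun h => h ▸ mem_orbit_plus ν⟩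

theorem shortest_eq_one {μ : Fin N →₀ ℕ} (hμ : IsPartition μ) : shortest μ = 1 := by
  refine (stablySorts_shortest μ).unique fun i j hij => ?_
  rcases (hμ i j hij.le).lt_or_eq with h | h
  · exact Or.inl h
  · exact Or.inr ⟨h.symm, hij⟩

/-- Composition with s_j preserves stability unless the two exchanged entries are equal, in which
case it would reverse their order; hence the hypothesis. -/
theorem shortest_actComp_simpleRefl {μ : Fin N →₀ ℕ} {j : SimpleIndex N} (h : μ j.lo ≠ μ j.hi) :
    shortest (actComp (simpleRefl j) μ) = simpleRefl j * shortest μ := by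
  refine (stablySorts_shortest _).unique fun p q hpq => ?_
  have hv : ∀ i, actComp (simpleRefl j) μ ((simpleRefl j * shortest μ) i) = μ (shortest μ i) := by
    intro i; simp [actComp_apply]
  rw [hv, hv]
  rcases stablySorts_shortest μ p q hpq with h' | ⟨h1, h2⟩
  · exact Or.inl h'
  · refine Or.inr ⟨h1, simpleRefl_lt h2 ?_⟩
    rintro ⟨hp, hq⟩
    rw [hp, hq] at h1
    exact h h1

theorem pos_actComp_simpleRefl {μ : Fin N →₀ ℕ} {j : SimpleIndex N} (h : μ j.lo ≠ μ j.hi)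
    (i : Fin N) : pos (actComp (simpleRefl j) μ) i = pos μ (simpleRefl j i) := by
  rw [pos, shortest_actComp_simpleRefl h, mul_inv_rev, simpleRefl_inv]
  rfl

theorem simpleRefl_lo (j : SimpleIndex N) : simpleRefl j j.lo = j.hi := Equiv.swap_apply_left _ _

theorem simpleRefl_hi (j : SimpleIndex N) : simpleRefl j j.hi = j.lo := Equiv.swap_apply_right _ _

theorem simpleRefl_simpleRefl (j : SimpleIndex N) (i : Fin N) :
    simpleRefl j (simpleRefl j i) = i := Equiv.swap_apply_self _ _ _

/-- If `μ_j > μ_{j+1}`, passing from `μ` to `s_j μ` adds the inversion that moves the two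
entries past each other. -/
theorem inversions_shortest_actComp {μ : Fin N →₀ ℕ} {j : SimpleIndex N} (h : μ j.hi < μ j.lo) :
    (pos μ j.lo, pos μ j.hi) ∉ inversions (shortest μ) ∧
      inversions (shortest (actComp (simpleRefl j) μ))
        = insert (pos μ j.lo, pos μ j.hi) (inversions (shortest μ)) := by
  have hlh := j.lo_lt_hi
  have hpos : pos μ j.lo < pos μ j.hi := pos_lt_pos_iff.mpr (Or.inl h)
  have hw : ∀ i, shortest μ (pos μ i) = i := fun i => by simp [pos]
  refine ⟨fun hm => ?_, ?_⟩
  · have := (mem_inversions.mp hm).2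
    simp only [hw] at this
    exact this.asymm hlh
  · ext ⟨p, q⟩
    rw [Finset.mem_insert, mem_inversions, mem_inversions, shortest_actComp_simpleRefl h.ne']
    simp only [Equiv.Perm.mul_apply, Prod.mk.injEq]
    constructor
    · rintro ⟨hpq, hlt⟩
      by_cases hc : p = pos μ j.lo ∧ q = pos μ j.hi
      · exact Or.inl hc
      · refine Or.inr ⟨hpq, ?_⟩
        by_contra hge
        have hlt' : shortest μ p < shortest μ q :=
          lt_of_le_of_ne (not_lt.mp hge) fun e => hpq.ne ((shortest μ).injective e)
        refine absurd (simpleRefl_lt (j := j) hlt' fun hh => hc ⟨?_, ?_⟩) hlt.asymm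
        · rw [← hh.1]; simp [pos]
        · rw [← hh.2]; simp [pos]
    · rintro (⟨rfl, rfl⟩ | ⟨hpq, hlt⟩)
      · exact ⟨hpos, by rw [hw, hw, simpleRefl_lo, simpleRefl_hi]; exact hlh⟩
      · refine ⟨hpq, simpleRefl_lt hlt fun hh => ?_⟩
        have : p = pos μ j.hi ∧ q = pos μ j.lo := by
          constructor
          · rw [← hh.2]; simp [pos]
          · rw [← hh.1]; simp [pos]
        rw [this.1, this.2] at hpq
        exact hpq.asymm hpos

theorem exists_ascent_of_not_isPartition {μ : Fin N →₀ ℕ} (hμ : ¬IsPartition μ) :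
    ∃ j : SimpleIndex N, μ j.lo < μ j.hi := by
  by_contra hne
  simp only [not_exists, not_lt] at hne
  apply hμ
  intro i k hik
  obtain ⟨k, hk⟩ := k
  induction k with
  | zero =>
    have : i = ⟨0, hk⟩ := Fin.ext (Nat.le_zero.mp hik)
    rw [this]
  | succ k ih =>
    let s : SimpleIndex N := ⟨k, hk⟩
    rcases Nat.lt_or_ge k i.1 with h | h
    · have : i = ⟨k + 1, hk⟩ := Fin.ext (le_antisymm hik h)
      rw [this]
    · exact (hne s).trans (ih s.lo.2 h)

/-! ## The order on compositions -/

/-- The strict order of the triangularity condition. -/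
def Below (ν μ : Fin N →₀ ℕ) : Prop := ν ≠ μ ∧ (CompLE ν μ ∨ deg ν < deg μ)

theorem deg_actComp (w : Equiv.Perm (Fin N)) (μ : Fin N →₀ ℕ) : deg (actComp w μ) = deg μ :=
  Equiv.sum_comp w⁻¹ μ

theorem deg_plus (μ : Fin N →₀ ℕ) : deg (plus μ) = deg μ := deg_actComp _ _

/-- Only ν ≠ κ needs an argument: if ν = κ, all partial sums of ν and μ agree, and the entries are
recovered as differences of consecutive partial sums. -/
theorem DomLT.trans {ν μ κ : Fin N →₀ ℕ} (h1 : DomLT ν μ) (h2 : DomLT μ κ) : DomLT ν κ := by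
  refine ⟨?_, h1.2.1.trans h2.2.1, fun l => (h1.2.2 l).trans (h2.2.2 l)⟩
  rintro rfl
  apply h1.1
  ext i
  have hs : ∀ l, ∑ k ∈ Finset.Iic l, ν k = ∑ k ∈ Finset.Iic l, μ k :=
    fun l => le_antisymm (h1.2.2 l) (h2.2.2 l)
  have hIio : ∑ k ∈ Finset.Iio i, ν k = ∑ k ∈ Finset.Iio i, μ k := by
    rcases Nat.eq_zero_or_pos i.1 with h | h
    · have : Finset.Iio i = ∅ := by
        ext k; simp [Fin.lt_def, h]
      simp [this]
    · have : Finset.Iio i = Finset.Iic (⟨i.1 - 1, by omega⟩ : Fin N) := by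
        ext k
        simp only [Finset.mem_Iio, Finset.mem_Iic, Fin.lt_def, Fin.le_def]
        omega
      rw [this, hs]
  have := hs i
  rw [← Finset.Iio_insert, Finset.sum_insert (by simp), Finset.sum_insert (by simp), hIio] at this
  omega

theorem CompLE.deg_eq {ν μ : Fin N →₀ ℕ} (h : CompLE ν μ) : deg ν = deg μ := by
  rcases h with ⟨-, h⟩ | ⟨h, -⟩
  · rw [← deg_plus ν, ← deg_plus μ, h.2.1]
  · rw [← deg_plus ν, ← deg_plus μ, mem_orbit_plus_iff.mp h]

theorem CompLE.trans {ν μ κ : Fin N →₀ ℕ} (h1 : CompLE ν μ) (h2 : CompLE μ κ) : CompLE ν κ := by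
  simp only [CompLE, mem_orbit_plus_iff] at *
  rcases h1 with ⟨-, h1⟩ | ⟨h1, h1'⟩ <;> rcases h2 with ⟨-, h2⟩ | ⟨h2, h2'⟩
  · exact Or.inl ⟨(h1.trans h2).1, h1.trans h2⟩
  · rw [h2] at h1
    exact Or.inl ⟨h1.1, h1⟩
  · rw [← h1] at h2
    exact Or.inl ⟨h2.1, h2⟩
  · refine Or.inr ⟨h1.trans h2, ?_⟩
    have := add_mem h1' h2'
    rwa [add_comm, sub_add_sub_cancel] at this

theorem eq_zero_of_mem_posRootLattice {v : Fin N → ℝ} (h1 : v ∈ posRootLattice N)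
    (h2 : -v ∈ posRootLattice N) : v = 0 := by
  have hs : ∀ l, ∑ k ∈ Finset.Iic l, v k = 0 := by
    intro l
    have a1 := sum_Iic_nonneg_of_mem_posRootLattice h1 l
    have a2 := sum_Iic_nonneg_of_mem_posRootLattice h2 l
    simp only [Pi.neg_apply, Finset.sum_neg_distrib] at a2
    linarith
  funext i
  have hIio : ∑ k ∈ Finset.Iio i, v k = 0 := by
    rcases Nat.eq_zero_or_pos i.1 with h | h
    · have : Finset.Iio i = ∅ := by
        ext k; simp [Fin.lt_def, h]
      simp [this]
    · have : Finset.Iio i = Finset.Iic (⟨i.1 - 1, by omega⟩ : Fin N) := by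
        ext k
        simp only [Finset.mem_Iio, Finset.mem_Iic, Fin.lt_def, Fin.le_def]
        omega
      rw [this, hs]
  have := hs i
  rwa [← Finset.Iio_insert, Finset.sum_insert (by simp), hIio, add_zero] at this

theorem CompLE.antisymm {ν μ : Fin N →₀ ℕ} (h1 : CompLE ν μ) (h2 : CompLE μ ν) : ν = μ := by
  simp only [CompLE, mem_orbit_plus_iff] at *
  rcases h1 with ⟨-, h1⟩ | ⟨h1, h1'⟩ <;> rcases h2 with ⟨-, h2⟩ | ⟨h2, h2'⟩
  · exact absurd rfl (h1.trans h2).1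
  · exact absurd h2.symm h1.1
  · exact absurd h1.symm h2.1
  · have h := eq_zero_of_mem_posRootLattice h1' (by rwa [neg_sub])
    ext i
    have hi := congrFun h i
    simp only [Pi.sub_apply, Pi.zero_apply, vec, sub_eq_zero, Nat.cast_inj] at hi
    exact hi.symm

theorem Below.trans {ν μ κ : Fin N →₀ ℕ} (h1 : Below ν μ) (h2 : Below μ κ) : Below ν κ := by
  obtain ⟨n1, h1⟩ := h1
  obtain ⟨n2, h2⟩ := h2
  rcases h1 with h1 | h1 <;> rcases h2 with h2 | h2
  · refine ⟨?_, Or.inl (h1.trans h2)⟩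
    rintro rfl
    exact n1 (h1.antisymm h2)
  all_goals
    have hlt : deg ν < deg κ := by
      first
        | exact h1.deg_eq.trans_lt h2
        | exact h1.trans_eq h2.deg_eq
        | exact h1.trans h2
    exact ⟨fun e => hlt.ne (congrArg deg e), Or.inr hlt⟩

theorem Below.irrefl (μ : Fin N →₀ ℕ) : ¬Below μ μ := fun h => h.1 rfl

theorem Below.deg_le {ν μ : Fin N →₀ ℕ} (h : Below ν μ) : deg ν ≤ deg μ := by
  rcases h.2 with h | h
  · exact h.deg_eq.le
  · exact h.le

theorem deg_eq_degree (μ : Fin N →₀ ℕ) : deg μ = μ.degree := by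
  rw [Finsupp.degree_eq_sum]; rfl

theorem finite_below (μ : Fin N →₀ ℕ) : {ν | Below ν μ}.Finite := by
  refine (Finsupp.finite_of_degree_le (deg μ)).subset fun ν hν => ?_
  rw [Set.mem_ofPred_eq, ← deg_eq_degree]
  exact hν.deg_le

/-- Exchange argument: T and the initial segment differ by equally many indices, where f is at most
f l on one side and at least f l on the other. -/
theorem sum_le_sum_Iic_of_antitone {f : Fin N → ℕ} (hf : Antitone f) {l : Fin N}
    {T : Finset (Fin N)} (hT : T.card = (Finset.Iic l).card) :
    ∑ i ∈ T, f i ≤ ∑ i ∈ Finset.Iic l, f i := by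
  rw [← Finset.sum_sdiff_le_sum_sdiff]
  have hcard : (T \ Finset.Iic l).card = (Finset.Iic l \ T).card := by
    have h1 := Finset.card_sdiff_add_card_inter T (Finset.Iic l)
    have h2 := Finset.card_sdiff_add_card_inter (Finset.Iic l) T
    rw [Finset.inter_comm] at h2
    omega
  calc ∑ i ∈ T \ Finset.Iic l, f i ≤ (T \ Finset.Iic l).card • f l := by
        refine Finset.sum_le_card_nsmul _ _ _ fun i hi => hf ?_
        simp only [Finset.mem_sdiff, Finset.mem_Iic, not_le] at hi
        exact hi.2.le
    _ = (Finset.Iic l \ T).card • f l := by rw [hcard]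
    _ ≤ ∑ i ∈ Finset.Iic l \ T, f i := by
        refine Finset.card_nsmul_le_sum _ _ _ fun i hi => hf ?_
        simp only [Finset.mem_sdiff, Finset.mem_Iic] at hi
        exact hi.1

/-- The partial sums of μ⁺ maximize the sums of μ over index sets of given size. This lets dominance
be checked on arbitrary index sets, without knowing how μ is sorted. -/
theorem sum_le_sum_Iic_plus (μ : Fin N →₀ ℕ) {l : Fin N} {S : Finset (Fin N)}
    (hS : S.card = (Finset.Iic l).card) : ∑ i ∈ S, μ i ≤ ∑ i ∈ Finset.Iic l, plus μ i := by
  have h : ∑ i ∈ S, μ i = ∑ i ∈ S.map (shortest μ)⁻¹.toEmbedding, plus μ i := by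
    simp [plus_apply]
  rw [h]
  exact sum_le_sum_Iic_of_antitone (fun i j hij => isPartition_plus μ i j hij)
    (by rw [Finset.card_map, hS])

theorem sum_Iic_plus (μ : Fin N →₀ ℕ) (l : Fin N) :
    ∑ i ∈ Finset.Iic l, plus μ i = ∑ i ∈ (Finset.Iic l).map (shortest μ).toEmbedding, μ i := by
  simp [plus_apply]

theorem sum_sq_eq_of_plus_eq {μ ν : Fin N →₀ ℕ} (h : plus ν = plus μ) :
    ∑ i, ν i ^ 2 = ∑ i, μ i ^ 2 := by
  have key : ∀ κ : Fin N →₀ ℕ, ∑ i, plus κ i ^ 2 = ∑ i, κ i ^ 2 := by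
    intro κ
    simp only [plus_apply]
    exact Equiv.sum_comp (shortest κ) fun i => κ i ^ 2
  rw [← key ν, ← key μ, h]

theorem sum_eq_add_add_sum_compl {j k : Fin N} (hjk : j ≠ k) (f : Fin N → ℕ) :
    ∑ i, f i = f j + f k + ∑ i ∈ ({j, k} : Finset (Fin N))ᶜ, f i := by
  rw [← Finset.sum_pair hjk, Finset.sum_add_sum_compl]

/-- Moving two entries of a composition strictly towards each other lowers it. -/
theorem below_of_squeeze {μ ν : Fin N →₀ ℕ} {j k : Fin N} (hjk : j ≠ k)
    (hsum : ν j + ν k = μ j + μ k) (h1 : μ k < ν j) (h2 : μ k < ν k)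
    (hne : ∀ i, i ≠ j → i ≠ k → ν i = μ i) : Below ν μ := by
  have hcompl : ∀ f : ℕ → ℕ, ∑ i ∈ ({j, k} : Finset (Fin N))ᶜ, f (ν i)
      = ∑ i ∈ ({j, k} : Finset (Fin N))ᶜ, f (μ i) := by
    intro f
    refine Finset.sum_congr rfl fun i hi => ?_
    simp only [Finset.mem_compl, Finset.mem_insert, Finset.mem_singleton, not_or] at hi
    rw [hne i hi.1 hi.2]
  have hdeg : deg ν = deg μ := by
    have := hcompl id
    simp only [id] at this
    rw [deg, deg, sum_eq_add_add_sum_compl hjk, sum_eq_add_add_sum_compl hjk μ, this, hsum]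
  -- Squeezing strictly decreases the sum of squares, which is constant on orbits.
  have hsq : plus ν ≠ plus μ := by
    intro h
    have h := sum_sq_eq_of_plus_eq h
    rw [sum_eq_add_add_sum_compl hjk, sum_eq_add_add_sum_compl hjk, hcompl (· ^ 2)] at h
    obtain ⟨c, hc⟩ := Nat.exists_eq_add_of_lt h1
    obtain ⟨d, hd⟩ := Nat.exists_eq_add_of_lt h2
    have hj : μ j = μ k + c + d + 2 := by omega
    rw [hc, hd, hj] at h
    nlinarith
  refine ⟨fun h => hsq (by rw [h]), Or.inl (Or.inl ⟨fun h => hsq (mem_orbit_plus_iff.mp h), hsq,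
    by rw [deg_plus, deg_plus, hdeg], fun l => ?_⟩)⟩
  rw [sum_Iic_plus ν]
  set S := (Finset.Iic l).map (shortest ν).toEmbedding
  have hS : S.card = (Finset.Iic l).card := Finset.card_map _
  have hsplit : ∀ f : Fin N → ℕ, ∑ i ∈ S, f i = ∑ i ∈ S \ {j, k}, f i
      + ((if j ∈ S then f j else 0) + if k ∈ S then f k else 0) := by
    intro f
    rw [← Finset.sum_inter_add_sum_sdiff S {j, k} f, add_comm]
    congr 1
    rw [Finset.inter_comm, ← Finset.filter_mem_eq_inter, Finset.sum_filter, Finset.sum_pair hjk]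
  have hout : ∑ i ∈ S \ {j, k}, ν i = ∑ i ∈ S \ {j, k}, μ i := by
    refine Finset.sum_congr rfl fun i hi => ?_
    simp only [Finset.mem_sdiff, Finset.mem_insert, Finset.mem_singleton, not_or] at hi
    exact hne i hi.2.1 hi.2.2
  -- S carries the first entries of ν⁺. Since ν_j and ν_k are both smaller than μ_j, replacing ν by
  -- μ does not decrease the sum over S, except when S contains k but not j; then k is traded for j.
  by_cases hc : k ∈ S ∧ j ∉ S
  · let S' := S.map (Equiv.swap j k).toEmbedding
    refine le_trans ?_ (sum_le_sum_Iic_plus μ (S := S') ((Finset.card_map _).trans hS))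
    rw [Finset.sum_map S, hsplit, hsplit, hout, if_neg hc.2, if_pos hc.1, if_neg hc.2, if_pos hc.1]
    simp only [Equiv.coe_toEmbedding, Equiv.swap_apply_right]
    have : ∑ i ∈ S \ {j, k}, μ (Equiv.swap j k i) = ∑ i ∈ S \ {j, k}, μ i := by
      refine Finset.sum_congr rfl fun i hi => ?_
      simp only [Finset.mem_sdiff, Finset.mem_insert, Finset.mem_singleton, not_or] at hi
      rw [Equiv.swap_apply_of_ne_of_ne hi.2.1 hi.2.2]
    rw [this]
    omega
  · refine le_trans ?_ (sum_le_sum_Iic_plus μ hS)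
    rw [hsplit, hsplit, hout]
    by_cases hj : j ∈ S <;> by_cases hk : k ∈ S <;> simp only [hj, hk, if_true, if_false] <;>
      first | omega | exact absurd ⟨hk, hj⟩ hc

/-- Exchanging two entries that stand in decreasing order lowers a composition. -/
theorem below_actComp_swap {μ : Fin N →₀ ℕ} {j k : Fin N} (hjk : j < k) (h : μ k < μ j) :
    Below (actComp (Equiv.swap j k) μ) μ := by
  have hap : ∀ i, actComp (Equiv.swap j k) μ i = μ (Equiv.swap j k i) := fun i => by
    simp [actComp_apply]
  refine ⟨fun e => ?_, Or.inl (Or.inr ⟨?_, ?_⟩)⟩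
  · have := DFunLike.congr_fun e j
    rw [hap, Equiv.swap_apply_left] at this
    omega
  · exact orbit_trans ⟨_, rfl⟩ (mem_orbit_plus μ)
  · have hv : vec μ - vec (actComp (Equiv.swap j k) μ) = (μ j - μ k) • (eps j - eps k) := by
      funext i
      simp only [Pi.sub_apply, Pi.smul_apply, vec, hap, eps, nsmul_eq_mul]
      rw [Nat.cast_sub h.le]
      by_cases hij : i = j
      · subst hij
        simp [hjk.ne]
      · by_cases hik : i = k
        · subst hik
          simp [hjk.ne']
        · simp [Equiv.swap_apply_of_ne_of_ne hij hik, hij, hik]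
    rw [hv]
    exact nsmul_mem (eps_sub_mem_posRootLattice hjk) _

end Sorting

/-! ## Dunkl operators for signed permutations -/

section Generic

variable {N : ℕ}

/-- The algebra map `x_i ↦ ε_i x_{τ i}`. -/
def signedPerm (ε : Fin N → ℤˣ) (τ : Equiv.Perm (Fin N)) :
    MvPolynomial (Fin N) ℂ →ₐ[ℂ] MvPolynomial (Fin N) ℂ :=
  aeval fun i => ((ε i : ℤ) : MvPolynomial (Fin N) ℂ) * X (τ i)

theorem signedPerm_X (ε : Fin N → ℤˣ) (τ : Equiv.Perm (Fin N)) (i : Fin N) :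
    signedPerm ε τ (X i) = ((ε i : ℤ) : MvPolynomial (Fin N) ℂ) * X (τ i) := aeval_X _ _

/-- The reflection `x_j ↦ s x_k`, `x_k ↦ s x_j`. -/
def refl (s : ℤˣ) (j k : Fin N) : MvPolynomial (Fin N) ℂ →ₐ[ℂ] MvPolynomial (Fin N) ℂ :=
  signedPerm (fun i => if i = j ∨ i = k then s else 1) (Equiv.swap j k)

theorem refl_X (s : ℤˣ) (j k i : Fin N) :
    refl s j k (X i) = (((if i = j ∨ i = k then s else 1 : ℤˣ) : ℤ) : MvPolynomial (Fin N) ℂ)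
      * X (Equiv.swap j k i) := signedPerm_X _ _ _

theorem refl_X_left (s : ℤˣ) (j k : Fin N) :
    refl s j k (X j) = ((s : ℤ) : MvPolynomial (Fin N) ℂ) * X k := by
  simp [refl_X]

theorem refl_X_right (s : ℤˣ) (j k : Fin N) :
    refl s j k (X k) = ((s : ℤ) : MvPolynomial (Fin N) ℂ) * X j := by
  simp [refl_X]

theorem refl_X_of_ne (s : ℤˣ) {j k i : Fin N} (hj : i ≠ j) (hk : i ≠ k) :
    refl s j k (X i) = X i := by
  simp [refl_X, hj, hk, Equiv.swap_apply_of_ne_of_ne hj hk]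

theorem units_mul_self (s : ℤˣ) :
    ((s : ℤ) : MvPolynomial (Fin N) ℂ) * ((s : ℤ) : MvPolynomial (Fin N) ℂ) = 1 := by
  rcases Int.units_eq_one_or s with rfl | rfl <;> simp

theorem refl_refl (s : ℤˣ) (j k : Fin N) (f : MvPolynomial (Fin N) ℂ) :
    refl s j k (refl s j k f) = f := by
  have h : (refl s j k).comp (refl s j k) = AlgHom.id ℂ (MvPolynomial (Fin N) ℂ) := by
    apply MvPolynomial.algHom_ext
    intro i
    rw [AlgHom.comp_apply, AlgHom.id_apply]
    by_cases hj : i = j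
    · rw [hj, refl_X_left, map_mul, map_intCast, refl_X_right, ← mul_assoc, units_mul_self, one_mul]
    · by_cases hk : i = k
      · rw [hk, refl_X_right, map_mul, map_intCast, refl_X_left, ← mul_assoc, units_mul_self,
          one_mul]
      · rw [refl_X_of_ne s hj hk, refl_X_of_ne s hj hk]
  exact DFunLike.congr_fun h f

theorem refl_comm (s : ℤˣ) (j k : Fin N) : refl s j k = refl s k j := by
  simp only [refl, Equiv.swap_comm j k, or_comm]

theorem exch_eq_refl (j k : Fin N) : exch j k = refl 1 j k := by
  apply MvPolynomial.algHom_ext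
  intro i
  simp [exch, refl_X]

theorem sgn_X (j i : Fin N) :
    sgn j (X i) = (((if i = j then -1 else 1 : ℤˣ) : ℤ) : MvPolynomial (Fin N) ℂ) * X i := by
  simp only [sgn, aeval_X]
  split_ifs <;> simp

theorem sgn_eq_signedPerm (j : Fin N) : sgn j = signedPerm (fun i => if i = j then -1 else 1) 1 := by
  apply MvPolynomial.algHom_ext
  intro i
  rw [sgn_X, signedPerm_X, Equiv.Perm.one_apply]

theorem sgnExch_eq_refl {j k : Fin N} (hjk : k ≠ j) : sgnExch j k = refl (-1) j k := by
  apply MvPolynomial.algHom_ext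
  intro i
  simp only [sgnExch, exch, AlgHom.comp_apply, rename_X, refl_X]
  by_cases hj : i = j
  · subst hj; simp [sgn_X, hjk]
  · by_cases hk : i = k
    · subst hk; simp [sgn_X, hjk.symm]
    · simp [Equiv.swap_apply_of_ne_of_ne hj hk, hj, hk, sgn_X]

theorem sgn_comp_sgn_eq {j k : Fin N} (hjk : k ≠ j) (f : MvPolynomial (Fin N) ℂ) :
    refl (-1) j k (refl 1 j k f) = sgn j (sgn k f) := by
  have h : (refl (-1) j k).comp (refl 1 j k) = (sgn j).comp (sgn k) := by
    rw [← sgnExch_eq_refl hjk, ← exch_eq_refl]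
    apply MvPolynomial.algHom_ext
    intro i
    simp [sgnExch, exch, AlgHom.comp_apply, rename_X]
  exact DFunLike.congr_fun h f

theorem linear_ne_zero (s : ℤˣ) {j k : Fin N} (hjk : k ≠ j) :
    (X j - ((s : ℤ) : MvPolynomial (Fin N) ℂ) * X k) ≠ 0 := by
  intro h
  have h1 := congrArg (eval fun i => if i = j then (1 : ℂ) else 0) h
  simp [hjk] at h1

theorem refl_dvd (s : ℤˣ) (j k i : Fin N) :
    (X j - ((s : ℤ) : MvPolynomial (Fin N) ℂ) * X k) ∣ X i - refl s j k (X i) := by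
  by_cases hj : i = j
  · rw [hj, refl_X_left]
  · by_cases hk : i = k
    · rw [hk, refl_X_right]
      exact ⟨-((s : ℤ) : MvPolynomial (Fin N) ℂ), by
        linear_combination (-X k : MvPolynomial (Fin N) ℂ) * units_mul_self (N := N) s⟩
    · rw [refl_X_of_ne s hj hk, sub_self]
      exact dvd_zero _

/-- The divided difference `f ↦ (x_j - s x_k)⁻¹ (f - S^s_{jk} f)`. -/
def divRefl (s : ℤˣ) (j k : Fin N) : Module.End ℂ (MvPolynomial (Fin N) ℂ) :=
  if h : k ≠ j then divDiff (X j - ((s : ℤ) : MvPolynomial (Fin N) ℂ) * X k)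
    (linear_ne_zero s h) (refl s j k) (refl_dvd s j k) else 0

theorem mul_divRefl (s : ℤˣ) {j k : Fin N} (hjk : k ≠ j) (f : MvPolynomial (Fin N) ℂ) :
    (X j - ((s : ℤ) : MvPolynomial (Fin N) ℂ) * X k) * divRefl s j k f = f - refl s j k f := by
  rw [divRefl, dif_pos hjk, mul_divDiff]

/-- The default value on the diagonal, which lets the sums in `dunkl` run over all k. -/
theorem divRefl_self (s : ℤˣ) (j : Fin N) : divRefl s j j = 0 := by
  simp [divRefl]

/-- The divided difference `f ↦ x_j⁻¹ (f - t_j f)`. -/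
def divSgn (j : Fin N) : Module.End ℂ (MvPolynomial (Fin N) ℂ) :=
  divDiff (X j) (X_ne_zero j) (sgn j) (sgn_dvd j)

theorem mul_divSgn (j : Fin N) (f : MvPolynomial (Fin N) ℂ) :
    X j * divSgn j f = f - sgn j f := mul_divDiff _ _ _ _ _

/-- The Dunkl operator with multiplicity `A s` on the mirrors `x_j = s x_k` and `b` on the
mirrors `x_j = 0`. -/
def dunkl (A : ℤˣ → ℝ) (b : ℝ) (j : Fin N) : Module.End ℂ (MvPolynomial (Fin N) ℂ) :=
  (pderiv j).toLinearMap + ∑ s, (A s : ℂ) • ∑ k, divRefl s j k + (b : ℂ) • divSgn j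

theorem dunkl_apply (A : ℤˣ → ℝ) (b : ℝ) (j : Fin N) (f : MvPolynomial (Fin N) ℂ) :
    dunkl A b j f
      = pderiv j f + ∑ s, (A s : ℂ) • ∑ k, divRefl s j k f + (b : ℂ) • divSgn j f := by
  simp [dunkl, LinearMap.add_apply, LinearMap.sum_apply, LinearMap.smul_apply]

/-- The sum of reflections in a Cherednik operator. -/
def reflSum (A : ℤˣ → ℝ) (j : Fin N) (T : Finset (Fin N)) :
    Module.End ℂ (MvPolynomial (Fin N) ℂ) :=
  ∑ s, (A s : ℂ) • ∑ k ∈ T, (refl s j k).toLinearMap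

theorem reflSum_apply (A : ℤˣ → ℝ) (j : Fin N) (T : Finset (Fin N)) (f : MvPolynomial (Fin N) ℂ) :
    reflSum A j T f = ∑ s, (A s : ℂ) • ∑ k ∈ T, refl s j k f := by
  simp [reflSum, LinearMap.sum_apply]

/-- The part `(x_j - (2ω)⁻¹ ∇_j) ∇_j` of a Cherednik operator. -/
def energy (A : ℤˣ → ℝ) (b ω : ℝ) (j : Fin N) : Module.End ℂ (MvPolynomial (Fin N) ℂ) :=
  (LinearMap.mulLeft ℂ (X j) - ((1 / (2 * ω) : ℝ) : ℂ) • dunkl A b j) * dunkl A b j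

theorem energy_apply (A : ℤˣ → ℝ) (b ω : ℝ) (j : Fin N) (f : MvPolynomial (Fin N) ℂ) :
    energy A b ω j f = X j * dunkl A b j f
      - ((1 / (2 * ω) : ℝ) : ℂ) • dunkl A b j (dunkl A b j f) := rfl

/-- The Cherednik operator with multiplicities `A` and `b`. -/
def cherednik (A : ℤˣ → ℝ) (b ω : ℝ) (j : Fin N) : Module.End ℂ (MvPolynomial (Fin N) ℂ) :=
  energy A b ω j + reflSum A j (Finset.Ioi j) + (b : ℂ) • (sgn j).toLinearMap

theorem cherednik_apply (A : ℤˣ → ℝ) (b ω : ℝ) (j : Fin N) (f : MvPolynomial (Fin N) ℂ) :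
    cherednik A b ω j f
      = energy A b ω j f + reflSum A j (Finset.Ioi j) f + (b : ℂ) • sgn j f := rfl

/-! ### The operators of type A and B -/

/-- The multiplicities of type A. -/
def multA (a : ℝ) (s : ℤˣ) : ℝ := if s = 1 then a else 0

/-- The multiplicities of type B. -/
def multB (a : ℝ) (_ : ℤˣ) : ℝ := a

theorem divDiff_eq_divRefl (s : ℤˣ) {j k : Fin N} (hjk : k ≠ j) {l : MvPolynomial (Fin N) ℂ}
    (hl : l ≠ 0) {σ : MvPolynomial (Fin N) ℂ →ₐ[ℂ] MvPolynomial (Fin N) ℂ}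
    (h : ∀ i, l ∣ X i - σ (X i)) (hls : l = X j - ((s : ℤ) : MvPolynomial (Fin N) ℂ) * X k)
    (hσ : σ = refl s j k) : divDiff l hl σ h = divRefl s j k := by
  subst hls hσ
  rw [divRefl, dif_pos hjk]

theorem sum_units {M : Type*} [AddCommMonoid M] (f : ℤˣ → M) : ∑ s, f s = f 1 + f (-1) := by
  rw [UnitsInt.univ, Finset.sum_pair (by decide)]

theorem sum_subtype_ne_eq {M : Type*} [AddCommMonoid M] (j : Fin N) (f : Fin N → M) (hf : f j = 0) :
    ∑ k : {k : Fin N // k ≠ j}, f k.1 = ∑ k, f k := by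
  classical
  rw [← Finset.sum_subtype (Finset.univ.erase j) (by simp) f,
    ← Finset.sum_erase_add _ _ (Finset.mem_univ j), hf, add_zero]

theorem dunklA_eq (a : ℝ) (j : Fin N) : dunklA a j = dunkl (multA a) 0 j := by
  rw [dunklA, dunkl, sum_units, ← sum_subtype_ne_eq j (fun k => divRefl 1 j k) (divRefl_self 1 j)]
  simp only [multA, if_true, show ¬((-1 : ℤˣ) = 1) by decide, if_false, Complex.ofReal_zero,
    zero_smul, add_zero]
  congr 2
  refine Finset.sum_congr rfl fun k _ => divDiff_eq_divRefl 1 k.2 _ _ (by simp) (exch_eq_refl _ _)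

theorem dunklB_eq (a b : ℝ) (j : Fin N) : dunklB a b j = dunkl (multB a) b j := by
  rw [dunklB, dunkl, sum_units, ← sum_subtype_ne_eq j (fun k => divRefl 1 j k) (divRefl_self 1 j),
    ← sum_subtype_ne_eq j (fun k => divRefl (-1) j k) (divRefl_self (-1) j)]
  simp only [multB]
  rw [Finset.sum_add_distrib, smul_add]
  congr 4
  · exact Finset.sum_congr rfl fun k _ =>
      divDiff_eq_divRefl 1 k.2 _ _ (by simp) (exch_eq_refl _ _)
  · exact Finset.sum_congr rfl fun k _ =>
      divDiff_eq_divRefl (-1) k.2 _ _ (by simp) (sgnExch_eq_refl k.2)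

theorem creat_mul_annih {ω : ℝ} (hω : 0 < ω) (j : Fin N)
    (D : Module.End ℂ (MvPolynomial (Fin N) ℂ)) :
    ((2 * ω : ℝ) : ℂ) • (creat ω j D * annih ω D)
      = (LinearMap.mulLeft ℂ (X j) - ((1 / (2 * ω) : ℝ) : ℂ) • D) * D := by
  rw [creat, annih, mul_smul_comm, smul_smul, ← Complex.ofReal_mul,
    mul_one_div_cancel (by positivity), Complex.ofReal_one, one_smul]

theorem cherednikA_eq (a : ℝ) {ω : ℝ} (hω : 0 < ω) (j : Fin N) :
    cherednikA a ω j = cherednik (multA a) 0 ω j := by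
  rw [cherednikA, cherednik, creat_mul_annih hω, dunklA_eq, energy, reflSum, sum_units]
  simp [multA, exch_eq_refl]

theorem cherednikB_eq (a b : ℝ) {ω : ℝ} (hω : 0 < ω) (j : Fin N) :
    cherednikB a b ω j = cherednik (multB a) b ω j := by
  rw [cherednikB, cherednik, creat_mul_annih hω, dunklB_eq, energy, reflSum, sum_units]
  simp only [multB, exch_eq_refl, Finset.sum_add_distrib, smul_add]
  congr 4
  refine Finset.sum_congr rfl fun k hk => ?_
  rw [sgnExch_eq_refl (Finset.mem_Ioi.mp hk).ne']

/-! ### Equivariance -/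

theorem signedPerm_refl (ε : Fin N → ℤˣ) (τ : Equiv.Perm (Fin N)) (s : ℤˣ) (j k : Fin N)
    (hjk : k ≠ j) (f : MvPolynomial (Fin N) ℂ) :
    signedPerm ε τ (refl s j k f) = refl (s * (ε j * ε k)) (τ j) (τ k) (signedPerm ε τ f) := by
  have h : (signedPerm ε τ).comp (refl s j k)
      = (refl (s * (ε j * ε k)) (τ j) (τ k)).comp (signedPerm ε τ) := by
    apply MvPolynomial.algHom_ext
    intro i
    rw [AlgHom.comp_apply, AlgHom.comp_apply, signedPerm_X, map_mul, map_intCast]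
    by_cases hj : i = j
    · subst hj
      rw [refl_X_left, refl_X_left, map_mul, map_intCast, signedPerm_X]
      push_cast
      linear_combination (-(((s : ℤ) : MvPolynomial (Fin N) ℂ) * ((ε k : ℤ) : MvPolynomial (Fin N) ℂ)
        * X (τ k))) * units_mul_self (N := N) (ε i)
    · by_cases hk : i = k
      · subst hk
        rw [refl_X_right, refl_X_right, map_mul, map_intCast, signedPerm_X]
        push_cast
        linear_combination (-(((s : ℤ) : MvPolynomial (Fin N) ℂ)
          * ((ε j : ℤ) : MvPolynomial (Fin N) ℂ) * X (τ j))) * units_mul_self (N := N) (ε i)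
      · rw [refl_X_of_ne s hj hk, signedPerm_X,
          refl_X_of_ne _ (τ.injective.ne hj) (τ.injective.ne hk)]
  exact DFunLike.congr_fun h f

theorem signedPerm_sgn (ε : Fin N → ℤˣ) (τ : Equiv.Perm (Fin N)) (j : Fin N)
    (f : MvPolynomial (Fin N) ℂ) :
    signedPerm ε τ (sgn j f) = sgn (τ j) (signedPerm ε τ f) := by
  have h : (signedPerm ε τ).comp (sgn j) = (sgn (τ j)).comp (signedPerm ε τ) := by
    apply MvPolynomial.algHom_ext
    intro i
    rw [AlgHom.comp_apply, AlgHom.comp_apply, signedPerm_X, map_mul, map_intCast, sgn_X, sgn_X,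
      map_mul, map_intCast, signedPerm_X]
    simp only [EmbeddingLike.apply_eq_iff_eq]
    ring
  exact DFunLike.congr_fun h f

theorem signedPerm_divRefl (ε : Fin N → ℤˣ) (τ : Equiv.Perm (Fin N)) (s : ℤˣ) (j k : Fin N)
    (f : MvPolynomial (Fin N) ℂ) :
    signedPerm ε τ (divRefl s j k f) = ((ε j : ℤ) : MvPolynomial (Fin N) ℂ)
      * divRefl (s * (ε j * ε k)) (τ j) (τ k) (signedPerm ε τ f) := by
  by_cases hjk : k = j
  · subst hjk
    rw [divRefl_self, divRefl_self]
    simp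
  have hτ : τ k ≠ τ j := τ.injective.ne hjk
  apply mul_left_cancel₀ (linear_ne_zero (s * (ε j * ε k)) hτ)
  have h1 := mul_divRefl (s * (ε j * ε k)) hτ (signedPerm ε τ f)
  have h2 := congrArg (signedPerm ε τ) (mul_divRefl s hjk f)
  rw [map_mul, map_sub, map_sub, map_mul, signedPerm_X, signedPerm_X, map_intCast,
    signedPerm_refl ε τ s j k hjk] at h2
  push_cast at h1 ⊢
  linear_combination ((ε j : ℤ) : MvPolynomial (Fin N) ℂ) * h2
    - ((ε j : ℤ) : MvPolynomial (Fin N) ℂ) * h1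
    - (X (τ j) * signedPerm ε τ (divRefl s j k f)) * units_mul_self (N := N) (ε j)

theorem signedPerm_divSgn (ε : Fin N → ℤˣ) (τ : Equiv.Perm (Fin N)) (j : Fin N)
    (f : MvPolynomial (Fin N) ℂ) :
    signedPerm ε τ (divSgn j f)
      = ((ε j : ℤ) : MvPolynomial (Fin N) ℂ) * divSgn (τ j) (signedPerm ε τ f) := by
  apply mul_left_cancel₀ (X_ne_zero (R := ℂ) (τ j))
  have h1 := mul_divSgn (τ j) (signedPerm ε τ f)
  have h2 := congrArg (signedPerm ε τ) (mul_divSgn j f)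
  rw [map_mul, map_sub, signedPerm_X, signedPerm_sgn] at h2
  linear_combination ((ε j : ℤ) : MvPolynomial (Fin N) ℂ) * h2
    - ((ε j : ℤ) : MvPolynomial (Fin N) ℂ) * h1
    - (X (τ j) * signedPerm ε τ (divSgn j f)) * units_mul_self (N := N) (ε j)

theorem signedPerm_pderiv (ε : Fin N → ℤˣ) (τ : Equiv.Perm (Fin N)) (j : Fin N)
    (f : MvPolynomial (Fin N) ℂ) :
    signedPerm ε τ (pderiv j f)
      = ((ε j : ℤ) : MvPolynomial (Fin N) ℂ) * pderiv (τ j) (signedPerm ε τ f) := by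
  induction f using MvPolynomial.induction_on with
  | C c => simp [signedPerm]
  | add p q hp hq => simp only [map_add, hp, hq, mul_add]
  | mul_X p i hp =>
    have hc : pderiv (τ j) ((ε i : ℤ) : MvPolynomial (Fin N) ℂ) = 0 :=
      Derivation.map_intCast _ _
    rw [Derivation.leibniz, map_mul, Derivation.leibniz]
    simp only [smul_eq_mul, map_add, map_mul]
    rw [hp, signedPerm_X, Derivation.leibniz, hc]
    simp only [smul_eq_mul]
    by_cases hij : i = j
    · subst hij
      rw [pderiv_X_self, pderiv_X_self, map_one]
      linear_combination (-(signedPerm ε τ p)) * units_mul_self (N := N) (ε i)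
    · rw [pderiv_X_of_ne hij, pderiv_X_of_ne (τ.injective.ne hij), map_zero]
      ring

/-- Sign changes are allowed only if the multiplicities do not depend on the sign. -/
def Compatible (A : ℤˣ → ℝ) (ε : Fin N → ℤˣ) : Prop := ∀ i k s, A (s * (ε i * ε k)) = A s

/-- For each k the substitution s ↦ s ε_j ε_k permutes the two signs, and compatibility says that it
preserves the multiplicity. -/
theorem sum_signs_sum_eq {M : Type*} [AddCommMonoid M] [Module ℂ M] {A : ℤˣ → ℝ} {ε : Fin N → ℤˣ}
    (hA : Compatible A ε) (j : Fin N) (T : Finset (Fin N)) (F : ℤˣ → Fin N → M) :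
    ∑ s, (A s : ℂ) • ∑ k ∈ T, F (s * (ε j * ε k)) k = ∑ s, (A s : ℂ) • ∑ k ∈ T, F s k := by
  simp only [Finset.smul_sum]
  rw [Finset.sum_comm, Finset.sum_comm (s := Finset.univ)]
  refine Finset.sum_congr rfl fun k _ => ?_
  refine Fintype.sum_equiv (Equiv.mulRight (ε j * ε k)) _ _ fun s => ?_
  rw [Equiv.coe_mulRight, hA]

/-- The Dunkl operators transform like the coordinate vector fields: a signed permutation permutes
the mirrors, preserves their multiplicities, and turns each linear form into a signed one. The sign
cancels in `signedPerm_energy`, where operators of index j occur in pairs. -/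
theorem signedPerm_dunkl {A : ℤˣ → ℝ} {ε : Fin N → ℤˣ} (hA : Compatible A ε) (b : ℝ)
    (τ : Equiv.Perm (Fin N)) (j : Fin N) (f : MvPolynomial (Fin N) ℂ) :
    signedPerm ε τ (dunkl A b j f) = ((ε j : ℤ) : MvPolynomial (Fin N) ℂ)
      * dunkl A b (τ j) (signedPerm ε τ f) := by
  rw [dunkl_apply, dunkl_apply, map_add, map_add, signedPerm_pderiv, map_smul, signedPerm_divSgn,
    map_sum, mul_add, mul_add, mul_smul_comm]
  refine congrArg₂ _ (congrArg₂ _ rfl ?_) rfl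
  simp only [map_smul, map_sum, signedPerm_divRefl]
  rw [sum_signs_sum_eq hA j Finset.univ fun s k => ((ε j : ℤ) : MvPolynomial (Fin N) ℂ)
      * divRefl s (τ j) (τ k) (signedPerm ε τ f), Finset.mul_sum]
  refine Finset.sum_congr rfl fun s _ => ?_
  rw [mul_smul_comm, Finset.mul_sum]
  refine congrArg _ ?_
  exact Equiv.sum_comp τ fun k => ((ε j : ℤ) : MvPolynomial (Fin N) ℂ)
    * divRefl s (τ j) k (signedPerm ε τ f)

theorem signedPerm_energy {A : ℤˣ → ℝ} {ε : Fin N → ℤˣ} (hA : Compatible A ε) (b ω : ℝ)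
    (τ : Equiv.Perm (Fin N)) (j : Fin N) (f : MvPolynomial (Fin N) ℂ) :
    signedPerm ε τ (energy A b ω j f) = energy A b ω (τ j) (signedPerm ε τ f) := by
  have hlin : ∀ (D : Module.End ℂ (MvPolynomial (Fin N) ℂ)) (z : ℤ) g,
      D ((z : MvPolynomial (Fin N) ℂ) * g) = (z : MvPolynomial (Fin N) ℂ) * D g := by
    intro D z g
    rw [← zsmul_eq_mul, map_zsmul, zsmul_eq_mul]
  rw [energy_apply, energy_apply, map_sub, map_mul, map_smul, signedPerm_dunkl hA, signedPerm_X,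
    signedPerm_dunkl hA, signedPerm_dunkl hA, hlin, ← mul_assoc ((ε j : ℤ) : MvPolynomial (Fin N) ℂ),
    units_mul_self, one_mul]
  congr 1
  linear_combination (X (τ j) * dunkl A b (τ j) (signedPerm ε τ f)) * units_mul_self (N := N) (ε j)

theorem signedPerm_reflSum {A : ℤˣ → ℝ} {ε : Fin N → ℤˣ} (hA : Compatible A ε)
    (τ : Equiv.Perm (Fin N)) (j : Fin N) {T : Finset (Fin N)} (hT : j ∉ T)
    (f : MvPolynomial (Fin N) ℂ) :
    signedPerm ε τ (reflSum A j T f)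
      = reflSum A (τ j) (T.map τ.toEmbedding) (signedPerm ε τ f) := by
  rw [reflSum_apply, reflSum_apply, map_sum]
  simp only [Finset.sum_map, Equiv.coe_toEmbedding]
  refine Eq.trans ?_
    (sum_signs_sum_eq hA j T fun s k => refl s (τ j) (τ k) (signedPerm ε τ f))
  refine Finset.sum_congr rfl fun s _ => ?_
  rw [map_smul, map_sum]
  refine congrArg _ (Finset.sum_congr rfl fun k hk => ?_)
  exact signedPerm_refl ε τ s j k (fun h => hT (h ▸ hk)) f

theorem compatible_one (A : ℤˣ → ℝ) : Compatible A (fun _ : Fin N => 1) := by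
  intro i k s; simp

theorem compatible_of_even {A : ℤˣ → ℝ} (hA : A (-1) = A 1) (ε : Fin N → ℤˣ) : Compatible A ε := by
  have h : ∀ s, A s = A 1 := by
    intro s
    rcases Int.units_eq_one_or s with rfl | rfl
    · rfl
    · exact hA
  intro i k s
  rw [h, h s]

/-! ### Commutation with sign changes and adjacent exchanges -/

theorem sgn_cherednik {A : ℤˣ → ℝ} (hA : A (-1) = A 1) (b ω : ℝ) (i j : Fin N)
    (f : MvPolynomial (Fin N) ℂ) :
    sgn i (cherednik A b ω j f) = cherednik A b ω j (sgn i f) := by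
  have hc := compatible_of_even hA (fun k : Fin N => if k = i then (-1 : ℤˣ) else 1)
  rw [cherednik_apply, cherednik_apply, sgn_eq_signedPerm i, map_add, map_add, map_smul,
    signedPerm_energy hc, signedPerm_reflSum hc _ _ (by simp), signedPerm_sgn,
    show (1 : Equiv.Perm (Fin N)).toEmbedding = Function.Embedding.refl (Fin N) from rfl,
    Finset.map_refl, Equiv.Perm.one_apply]

/-- The operator `K_{j,j+1}`. -/
def adjExch (j : SimpleIndex N) : MvPolynomial (Fin N) ℂ →ₐ[ℂ] MvPolynomial (Fin N) ℂ :=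
  refl 1 j.lo j.hi

theorem adjExch_eq_signedPerm (j : SimpleIndex N) :
    adjExch j = signedPerm (fun _ => 1) (simpleRefl j) := by
  simp [adjExch, refl, simpleRefl]

theorem reflSum_insert (A : ℤˣ → ℝ) (j : Fin N) {k : Fin N} {T : Finset (Fin N)} (hk : k ∉ T)
    (f : MvPolynomial (Fin N) ℂ) :
    reflSum A j (insert k T) f = reflSum A j T f + ∑ s, (A s : ℂ) • refl s j k f := by
  simp only [reflSum_apply, Finset.sum_insert hk, smul_add, Finset.sum_add_distrib]
  rw [add_comm]

/-- The reflections in the two mirrors of one pair of coordinates differ by the double sign change,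
so after K they become the identity and t_j t_{j+1}. This is the error term in the exchange
relations. -/
theorem sum_refl_adjExch (A : ℤˣ → ℝ) (j : SimpleIndex N) (f : MvPolynomial (Fin N) ℂ) :
    ∑ s, (A s : ℂ) • refl s j.lo j.hi (adjExch j f)
      = (A 1 : ℂ) • f + (A (-1) : ℂ) • sgn j.lo (sgn j.hi f) := by
  rw [sum_units, adjExch, refl_refl, sgn_comp_sgn_eq j.lo_lt_hi.ne']

theorem map_Ioi_simpleRefl_of_ne {j : SimpleIndex N} {i : Fin N} (hlo : i ≠ j.lo) (hhi : i ≠ j.hi) :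
    (Finset.Ioi i).map (simpleRefl j).toEmbedding = Finset.Ioi i := by
  have h1 : (j.lo : ℕ) = j.1 := rfl
  have h2 : (j.hi : ℕ) = j.1 + 1 := rfl
  ext k
  simp only [Finset.mem_map_equiv, Finset.mem_Ioi, simpleRefl, Equiv.symm_swap]
  simp only [ne_eq, Fin.ext_iff, Fin.lt_def, Equiv.swap_apply_def] at *
  split_ifs <;> omega

theorem map_Ioi_simpleRefl_lo (j : SimpleIndex N) :
    (Finset.Ioi j.lo).map (simpleRefl j).toEmbedding = insert j.lo (Finset.Ioi j.hi) := by
  have h1 : (j.lo : ℕ) = j.1 := rfl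
  have h2 : (j.hi : ℕ) = j.1 + 1 := rfl
  ext k
  simp only [Finset.mem_map_equiv, Finset.mem_Ioi, simpleRefl, Equiv.symm_swap, Finset.mem_insert]
  simp only [Fin.ext_iff, Fin.lt_def, Equiv.swap_apply_def] at *
  split_ifs <;> omega

theorem Ioi_lo (j : SimpleIndex N) : Finset.Ioi j.lo = insert j.hi (Finset.Ioi j.hi) := by
  have h1 : (j.lo : ℕ) = j.1 := rfl
  have h2 : (j.hi : ℕ) = j.1 + 1 := rfl
  ext k
  simp only [Finset.mem_Ioi, Finset.mem_insert]
  simp only [Fin.ext_iff, Fin.lt_def] at *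
  omega

theorem map_Ioi_simpleRefl_hi (j : SimpleIndex N) :
    (Finset.Ioi j.hi).map (simpleRefl j).toEmbedding = Finset.Ioi j.hi := by
  have h1 : (j.lo : ℕ) = j.1 := rfl
  have h2 : (j.hi : ℕ) = j.1 + 1 := rfl
  ext k
  simp only [Finset.mem_map_equiv, Finset.mem_Ioi, simpleRefl, Equiv.symm_swap]
  simp only [Fin.ext_iff, Fin.lt_def, Equiv.swap_apply_def] at *
  split_ifs <;> omega

theorem cherednik_adjExch_of_ne (A : ℤˣ → ℝ) (b ω : ℝ) {j : SimpleIndex N} {i : Fin N}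
    (hlo : i ≠ j.lo) (hhi : i ≠ j.hi) (f : MvPolynomial (Fin N) ℂ) :
    cherednik A b ω i (adjExch j f) = adjExch j (cherednik A b ω i f) := by
  have hfix : simpleRefl j i = i := Equiv.swap_apply_of_ne_of_ne hlo hhi
  rw [cherednik_apply, cherednik_apply, adjExch_eq_signedPerm, map_add, map_add, map_smul,
    signedPerm_energy (compatible_one A), signedPerm_reflSum (compatible_one A) _ _ (by simp),
    signedPerm_sgn, map_Ioi_simpleRefl_of_ne hlo hhi, hfix]

/-- Everything in d_j is equivariant except the range of the reflection sum: K carries the indices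
beyond j to the indices beyond j + 1 together with j. The extra index accounts for the correction;
in `cherednik_lo_adjExch` it is instead missing, whence the opposite sign. -/
theorem cherednik_hi_adjExch (A : ℤˣ → ℝ) (b ω : ℝ) (j : SimpleIndex N)
    (f : MvPolynomial (Fin N) ℂ) :
    cherednik A b ω j.hi (adjExch j f) = adjExch j (cherednik A b ω j.lo f)
      - ((A 1 : ℂ) • f + (A (-1) : ℂ) • sgn j.lo (sgn j.hi f)) := by
  rw [← sum_refl_adjExch, cherednik_apply, cherednik_apply, adjExch_eq_signedPerm, map_add, map_add,
    map_smul, signedPerm_energy (compatible_one A),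
    signedPerm_reflSum (compatible_one A) _ _ (by simp),
    signedPerm_sgn, map_Ioi_simpleRefl_lo, simpleRefl_lo,
    reflSum_insert _ _ (by simpa using j.lo_lt_hi.le)]
  simp only [refl_comm _ j.hi j.lo]
  abel

theorem cherednik_lo_adjExch (A : ℤˣ → ℝ) (b ω : ℝ) (j : SimpleIndex N)
    (f : MvPolynomial (Fin N) ℂ) :
    cherednik A b ω j.lo (adjExch j f) = adjExch j (cherednik A b ω j.hi f)
      + ((A 1 : ℂ) • f + (A (-1) : ℂ) • sgn j.lo (sgn j.hi f)) := by
  rw [← sum_refl_adjExch, cherednik_apply, cherednik_apply, adjExch_eq_signedPerm, map_add, map_add,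
    map_smul, signedPerm_energy (compatible_one A),
    signedPerm_reflSum (compatible_one A) _ _ (by simp),
    signedPerm_sgn, map_Ioi_simpleRefl_hi, simpleRefl_hi, Ioi_lo,
    reflSum_insert _ _ (by simp)]
  abel

end Generic

/-! ## Triangularity -/

section Triangular

variable {N : ℕ}

/-- The span of the monomials below `μ`. -/
def lowSpan (μ : Fin N →₀ ℕ) : Submodule ℂ (MvPolynomial (Fin N) ℂ) :=
  restrictSupport ℂ {ν | Below ν μ}

/-- The span of the monomials of degree less than `n`. -/
def degSpan (N n : ℕ) : Submodule ℂ (MvPolynomial (Fin N) ℂ) :=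
  restrictSupport ℂ {ν | deg ν < n}

theorem mem_lowSpan_iff {μ : Fin N →₀ ℕ} {p : MvPolynomial (Fin N) ℂ} :
    p ∈ lowSpan μ ↔ ∀ ν, p.coeff ν ≠ 0 → Below ν μ := by
  simp [lowSpan, mem_restrictSupport_iff, Set.subset_def, mem_support_iff]

theorem mem_degSpan_iff {n : ℕ} {p : MvPolynomial (Fin N) ℂ} :
    p ∈ degSpan N n ↔ ∀ ν, p.coeff ν ≠ 0 → deg ν < n := by
  simp [degSpan, mem_restrictSupport_iff, Set.subset_def, mem_support_iff]

theorem monomial_mem_lowSpan {μ ν : Fin N →₀ ℕ} (h : Below ν μ) (c : ℂ) :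
    monomial ν c ∈ lowSpan μ := by
  rw [mem_lowSpan_iff]
  intro κ hκ
  rw [coeff_monomial] at hκ
  split_ifs at hκ with he
  · exact he ▸ h
  · exact absurd rfl hκ

theorem monomial_mem_degSpan {n : ℕ} {ν : Fin N →₀ ℕ} (h : deg ν < n) (c : ℂ) :
    monomial ν c ∈ degSpan N n := by
  rw [mem_degSpan_iff]
  intro κ hκ
  rw [coeff_monomial] at hκ
  split_ifs at hκ with he
  · exact he ▸ h
  · exact absurd rfl hκ

theorem degSpan_le_lowSpan (μ : Fin N →₀ ℕ) : degSpan N (deg μ) ≤ lowSpan μ := by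
  intro p hp
  rw [mem_lowSpan_iff]
  intro ν hν
  have h := mem_degSpan_iff.mp hp ν hν
  exact ⟨fun e => h.ne (congrArg deg e), Or.inr h⟩

theorem map_mem_of_monomials {W : Submodule ℂ (MvPolynomial (Fin N) ℂ)}
    (D : Module.End ℂ (MvPolynomial (Fin N) ℂ)) {p : MvPolynomial (Fin N) ℂ}
    (h : ∀ ν, p.coeff ν ≠ 0 → D (monomial ν 1) ∈ W) : D p ∈ W := by
  rw [p.as_sum, map_sum]
  refine Submodule.sum_mem _ fun ν hν => ?_
  have : monomial ν (p.coeff ν) = p.coeff ν • monomial ν (1 : ℂ) := by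
    rw [smul_monomial, smul_eq_mul, mul_one]
  rw [this, map_smul]
  exact Submodule.smul_mem _ _ (h ν (mem_support_iff.mp hν))

theorem deg_add (μ ν : Fin N →₀ ℕ) : deg (μ + ν) = deg μ + deg ν := by
  simp [deg, Finset.sum_add_distrib]

theorem deg_single (j : Fin N) (m : ℕ) : deg (Finsupp.single j m) = m := by
  simp [deg, Finsupp.single_apply]

/-! ### Divided differences of monomials and triangularity -/

theorem refl_monomial_of_eq (s : ℤˣ) {j k : Fin N} (hjk : k ≠ j) {κ : Fin N →₀ ℕ}
    (hκ : κ j = κ k) : refl s j k (monomial κ 1) = monomial κ 1 := by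
  have hs : (((s : ℤ) : MvPolynomial (Fin N) ℂ) ^ κ k) * (((s : ℤ) : MvPolynomial (Fin N) ℂ) ^ κ k)
      = 1 := by rw [← mul_pow, units_mul_self, one_pow]
  rw [monomial_eq, C_1, one_mul, Finsupp.prod_fintype _ _ (by simp)]
  rw [← Finset.prod_compl_mul_prod ({j, k} : Finset (Fin N)), map_mul, map_prod,
    Finset.prod_pair hjk.symm]
  congr 1
  · refine Finset.prod_congr rfl fun i hi => ?_
    simp only [Finset.mem_compl, Finset.mem_insert, Finset.mem_singleton, not_or] at hi
    rw [map_pow, refl_X_of_ne s hi.1 hi.2]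
  · rw [map_mul, map_pow, map_pow, refl_X_left, refl_X_right, hκ, mul_pow, mul_pow]
    linear_combination (X j ^ κ k * X k ^ κ k) * hs

/-- `∑_{i < m} x_j^i (s x_k)^{m-1-i}`. -/
def geomSum (s : ℤˣ) (j k : Fin N) (m : ℕ) : MvPolynomial (Fin N) ℂ :=
  ∑ i ∈ Finset.range m, X j ^ i * (((s : ℤ) : MvPolynomial (Fin N) ℂ) * X k) ^ (m - 1 - i)

theorem mul_geomSum (s : ℤˣ) (j k : Fin N) (m : ℕ) :
    (X j - ((s : ℤ) : MvPolynomial (Fin N) ℂ) * X k) * geomSum s j k m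
      = X j ^ m - (((s : ℤ) : MvPolynomial (Fin N) ℂ) * X k) ^ m := by
  rw [geomSum, mul_comm]
  exact (Commute.all _ _).geom_sum₂_mul m

theorem monomial_add_single_one (κ : Fin N →₀ ℕ) (j : Fin N) (m : ℕ) :
    monomial (κ + Finsupp.single j m) (1 : ℂ) = monomial κ 1 * X j ^ m := by
  rw [X_pow_eq_monomial, monomial_mul, one_mul]

theorem divRefl_add_single_left (s : ℤˣ) {j k : Fin N} (hjk : k ≠ j) {κ : Fin N →₀ ℕ}
    (hκ : κ j = κ k) (m : ℕ) :
    divRefl s j k (monomial (κ + Finsupp.single j m) 1) = monomial κ 1 * geomSum s j k m := by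
  apply mul_left_cancel₀ (linear_ne_zero s hjk)
  rw [mul_divRefl s hjk, monomial_add_single_one, map_mul, map_pow, refl_monomial_of_eq s hjk hκ,
    refl_X_left]
  linear_combination (-(monomial κ (1 : ℂ))) * mul_geomSum s j k m

theorem divRefl_add_single_right (s : ℤˣ) {j k : Fin N} (hjk : k ≠ j) {κ : Fin N →₀ ℕ}
    (hκ : κ j = κ k) (m : ℕ) :
    divRefl s j k (monomial (κ + Finsupp.single k m) 1)
      = -(((s : ℤ) : MvPolynomial (Fin N) ℂ) ^ m * (monomial κ 1 * geomSum s j k m)) := by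
  apply mul_left_cancel₀ (linear_ne_zero s hjk)
  have hs : (((s : ℤ) : MvPolynomial (Fin N) ℂ) ^ m) * (((s : ℤ) : MvPolynomial (Fin N) ℂ) ^ m)
      = 1 := by rw [← mul_pow, units_mul_self, one_pow]
  have h := mul_geomSum s j k m
  rw [mul_pow] at h
  rw [mul_divRefl s hjk, monomial_add_single_one, map_mul, map_pow, refl_monomial_of_eq s hjk hκ,
    refl_X_right, mul_pow]
  linear_combination ((((s : ℤ) : MvPolynomial (Fin N) ℂ) ^ m) * (monomial κ (1 : ℂ))) * h
    - ((monomial κ (1 : ℂ)) * X k ^ m) * hs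

theorem intCast_mul_mem {V : Submodule ℂ (MvPolynomial (Fin N) ℂ)} {p : MvPolynomial (Fin N) ℂ}
    (hp : p ∈ V) (z : ℤ) (n : ℕ) : (z : MvPolynomial (Fin N) ℂ) ^ n * p ∈ V := by
  rw [← Int.cast_pow, ← zsmul_eq_mul]
  exact zsmul_mem hp _

theorem monomial_mul_geomSum_mem (s : ℤˣ) (j k : Fin N) (κ : Fin N →₀ ℕ) (m : ℕ) :
    monomial κ 1 * geomSum s j k m ∈ degSpan N (deg κ + m) := by
  rw [geomSum, Finset.mul_sum]
  refine Submodule.sum_mem _ fun i hi => ?_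
  have him := Finset.mem_range.mp hi
  have : monomial κ 1 * (X j ^ i * (((s : ℤ) : MvPolynomial (Fin N) ℂ) * X k) ^ (m - 1 - i))
      = ((s : ℤ) : MvPolynomial (Fin N) ℂ) ^ (m - 1 - i)
        * monomial (κ + Finsupp.single j i + Finsupp.single k (m - 1 - i)) 1 := by
    rw [monomial_add_single_one, monomial_add_single_one, mul_pow]
    ring
  rw [this]
  refine intCast_mul_mem (monomial_mem_degSpan ?_ _) _ _
  rw [deg_add, deg_add, deg_single, deg_single]
  omega

/-- Splitting off the excess of the larger of the two exponents leaves a monomial that the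
reflections fix, so a divided difference only acts on a pure power and becomes a geometric sum. -/
theorem exists_eq_add_single (μ : Fin N →₀ ℕ) {j k : Fin N} (hjk : k ≠ j) :
    ∃ (κ : Fin N →₀ ℕ) (m : ℕ), κ j = κ k ∧
      (μ = κ + Finsupp.single j m ∨ μ = κ + Finsupp.single k m) := by
  have key : ∀ i i' : Fin N, i' ≠ i → μ i' ≤ μ i →
      (μ - Finsupp.single i (μ i - μ i')) i = (μ - Finsupp.single i (μ i - μ i')) i' ∧
      μ = μ - Finsupp.single i (μ i - μ i') + Finsupp.single i (μ i - μ i') := by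
    intro i i' hi h
    refine ⟨by simp [hi]; omega, (tsub_add_cancel_of_le ?_).symm⟩
    rw [Finsupp.single_le_iff]
    omega
  rcases le_total (μ k) (μ j) with h | h
  · exact ⟨_, _, (key j k hjk h).1, Or.inl (key j k hjk h).2⟩
  · exact ⟨_, _, (key k j hjk.symm h).1.symm, Or.inr (key k j hjk.symm h).2⟩

theorem divRefl_monomial_mem (s : ℤˣ) (j k : Fin N) (μ : Fin N →₀ ℕ) :
    divRefl s j k (monomial μ 1) ∈ degSpan N (deg μ) := by
  by_cases hjk : k = j
  · subst hjk
    rw [divRefl_self]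
    exact Submodule.zero_mem _
  obtain ⟨κ, m, hκ, rfl | rfl⟩ := exists_eq_add_single μ hjk
  · rw [divRefl_add_single_left s hjk hκ, deg_add, deg_single]
    exact monomial_mul_geomSum_mem s j k κ m
  · rw [divRefl_add_single_right s hjk hκ, deg_add, deg_single]
    exact Submodule.neg_mem _ (intCast_mul_mem (monomial_mul_geomSum_mem s j k κ m) _ _)

theorem sgn_monomial (j : Fin N) (μ : Fin N →₀ ℕ) :
    sgn j (monomial μ 1) = ((-1 : ℂ) ^ μ j) • monomial μ 1 := by
  rw [monomial_eq, C_1, one_mul, Finsupp.prod_fintype _ _ (by simp), map_prod,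
    ← Finset.mul_prod_erase _ _ (Finset.mem_univ j), ← Finset.mul_prod_erase _ _ (Finset.mem_univ j),
    map_pow, sgn_X, if_pos rfl, mul_pow, ← smul_mul_assoc]
  congr 1
  · rw [smul_eq_C_mul]; simp
  · refine Finset.prod_congr rfl fun i hi => ?_
    rw [map_pow, sgn_X, if_neg (Finset.ne_of_mem_erase hi)]
    simp

theorem coeff_sgn (j : Fin N) (p : MvPolynomial (Fin N) ℂ) (μ : Fin N →₀ ℕ) :
    (sgn j p).coeff μ = (-1 : ℂ) ^ μ j * p.coeff μ := by
  induction p using MvPolynomial.induction_on' with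
  | monomial ν c =>
    have : monomial ν c = c • monomial ν (1 : ℂ) := by rw [smul_monomial, smul_eq_mul, mul_one]
    rw [this, map_smul, sgn_monomial, coeff_smul, coeff_smul, coeff_smul, coeff_monomial]
    split_ifs with h
    · subst h; simp [mul_comm]
    · simp
  | add p q hp hq => rw [map_add, coeff_add, coeff_add, hp, hq, mul_add]

theorem sgn_sgn (i : Fin N) (p : MvPolynomial (Fin N) ℂ) : sgn i (sgn i p) = p := by
  ext μ
  rw [coeff_sgn, coeff_sgn, ← mul_assoc, ← mul_pow]
  simp

theorem divSgn_monomial_mem (j : Fin N) (μ : Fin N →₀ ℕ) :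
    divSgn j (monomial μ 1) ∈ degSpan N (deg μ) := by
  rcases Nat.eq_zero_or_pos (μ j) with h | h
  · have : divSgn j (monomial μ 1) = 0 := by
      apply mul_left_cancel₀ (X_ne_zero (R := ℂ) j)
      rw [mul_divSgn, sgn_monomial, h, pow_zero, one_smul, sub_self, mul_zero]
    rw [this]
    exact Submodule.zero_mem _
  · obtain ⟨κ, hκ⟩ : ∃ κ, μ = κ + Finsupp.single j 1 :=
      ⟨μ - Finsupp.single j 1, (tsub_add_cancel_of_le (Finsupp.single_le_iff.mpr h)).symm⟩
    have : divSgn j (monomial μ 1) = (1 - (-1 : ℂ) ^ μ j) • monomial κ 1 := by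
      apply mul_left_cancel₀ (X_ne_zero (R := ℂ) j)
      rw [mul_divSgn, sgn_monomial, mul_smul_comm, mul_comm, ← pow_one (X j),
        ← monomial_add_single_one, ← hκ, sub_smul, one_smul]
    rw [this]
    refine Submodule.smul_mem _ _ (monomial_mem_degSpan ?_ _)
    rw [hκ, deg_add, deg_single]
    omega

theorem pderiv_monomial_mem (j : Fin N) (μ : Fin N →₀ ℕ) :
    pderiv j (monomial μ (1 : ℂ)) ∈ degSpan N (deg μ) := by
  rw [pderiv_monomial, one_mul]
  rcases Nat.eq_zero_or_pos (μ j) with h | h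
  · rw [h, Nat.cast_zero, monomial_zero]
    exact Submodule.zero_mem _
  · refine monomial_mem_degSpan ?_ _
    have := congrArg deg (tsub_add_cancel_of_le (Finsupp.single_le_iff.mpr h : Finsupp.single j 1 ≤ μ))
    rw [deg_add, deg_single] at this
    omega

theorem dunkl_monomial_mem (A : ℤˣ → ℝ) (b : ℝ) (j : Fin N) (μ : Fin N →₀ ℕ) :
    dunkl A b j (monomial μ 1) ∈ degSpan N (deg μ) := by
  rw [dunkl_apply]
  refine Submodule.add_mem _ (Submodule.add_mem _ (pderiv_monomial_mem j μ) ?_)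
    (Submodule.smul_mem _ _ (divSgn_monomial_mem j μ))
  exact Submodule.sum_mem _ fun s _ => Submodule.smul_mem _ _ <|
    Submodule.sum_mem _ fun k _ => divRefl_monomial_mem s j k μ

theorem dunkl_mem_degSpan (A : ℤˣ → ℝ) (b : ℝ) (j : Fin N) {n : ℕ} {p : MvPolynomial (Fin N) ℂ}
    (hp : p ∈ degSpan N n) : dunkl A b j p ∈ degSpan N n := by
  refine map_mem_of_monomials _ fun ν hν => ?_
  have hν := mem_degSpan_iff.mp hp ν hν
  rw [mem_degSpan_iff]
  exact fun κ hκ => (mem_degSpan_iff.mp (dunkl_monomial_mem A b j ν) κ hκ).trans hν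

theorem X_mul_geomSum (s : ℤˣ) (j k : Fin N) (κ : Fin N →₀ ℕ) (m : ℕ) :
    X j * (monomial κ 1 * geomSum s j k (m + 1))
      = ∑ i ∈ Finset.range m, ((s : ℤ) : MvPolynomial (Fin N) ℂ) ^ (m - i)
        * monomial (κ + Finsupp.single j (i + 1) + Finsupp.single k (m - i)) 1
        + monomial (κ + Finsupp.single j (m + 1)) 1 := by
  rw [geomSum, Finset.mul_sum, Finset.mul_sum, Finset.sum_range_succ]
  congr 1
  · refine Finset.sum_congr rfl fun i _ => ?_
    rw [monomial_add_single_one, monomial_add_single_one, mul_pow, Nat.add_sub_cancel]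
    ring
  · rw [monomial_add_single_one, Nat.add_sub_cancel, Nat.sub_self, pow_zero]
    ring

theorem actComp_swap_add_single {κ : Fin N →₀ ℕ} {j k : Fin N} (hκ : κ j = κ k) (m : ℕ) :
    actComp (Equiv.swap j k) (κ + Finsupp.single j m) = κ + Finsupp.single k m := by
  ext i
  simp only [actComp_apply, Equiv.swap_inv, Finsupp.add_apply]
  by_cases hj : i = j
  · subst hj
    by_cases hk : i = k
    · subst hk; simp
    · simp [hk, hκ]
  · by_cases hk : i = k
    · subst hk
      simp [hκ]
    · simp [Equiv.swap_apply_of_ne_of_ne hj hk, hj, hk]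

theorem below_add_single {κ : Fin N →₀ ℕ} {j k : Fin N} (hjk : j < k) (hκ : κ j = κ k) (m : ℕ) :
    Below (κ + Finsupp.single k (m + 1)) (κ + Finsupp.single j (m + 1)) := by
  rw [← actComp_swap_add_single hκ]
  apply below_actComp_swap hjk
  simp [hκ, hjk.ne]

theorem below_add_single_add_single {κ : Fin N →₀ ℕ} {j k : Fin N} (hjk : j ≠ k) (hκ : κ j = κ k)
    {p q : ℕ} (hp : 0 < p) (hq : 0 < q) :
    Below (κ + Finsupp.single j p + Finsupp.single k q) (κ + Finsupp.single j (p + q)) := by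
  apply below_of_squeeze hjk
  · simp [hjk, hjk.symm]; omega
  · simp [hjk.symm]; omega
  · simp [hjk.symm]; omega
  · intro i hi hi'
    simp [hi, hi']

/-- This is the contribution of one mirror to d_j x^μ. If μ_j = μ_k, the divided difference vanishes
and the reflection fixes x^μ. If μ_j > μ_k, the geometric sum ends in x^μ, its other terms have the
two exponents squeezed together, and a reflection with j < k moves the larger exponent to the right,
which is lower. If μ_j < μ_k, the last term of the geometric sum is minus the reflected monomial:
for j < k it is higher than x^μ but cancels against the reflection term, while for k < j it is
lower. This is why d_j carries reflections only for k > j. -/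
theorem pair_triangular (s : ℤˣ) (j k : Fin N) (μ : Fin N →₀ ℕ) :
    X j * divRefl s j k (monomial μ 1) + (if j < k then refl s j k (monomial μ 1) else 0)
      - (if pos μ j < pos μ k then monomial μ 1 else 0) ∈ lowSpan μ := by
  by_cases hjk : k = j
  · subst hjk
    simp [divRefl_self]
  have hps := pos_lt_pos_iff (μ := μ) (j := j) (k := k)
  obtain ⟨κ, m, hκ, hμ⟩ := exists_eq_add_single μ hjk
  rcases Nat.eq_zero_or_pos m with rfl | hm
  · have hμ : μ = κ := by rcases hμ with h | h <;> simpa using h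
    subst hμ
    have h0 : divRefl s j k (monomial μ 1) = 0 := by
      apply mul_left_cancel₀ (linear_ne_zero s hjk)
      rw [mul_divRefl s hjk, refl_monomial_of_eq s hjk hκ, sub_self, mul_zero]
    rw [h0, refl_monomial_of_eq s hjk hκ]
    have : (pos μ j < pos μ k) ↔ j < k := by
      rw [hps]; omega
    simp [this]
  obtain ⟨m, rfl⟩ : ∃ n, m = n + 1 := ⟨m - 1, by omega⟩
  rcases hμ with hμ | hμ
  · have h1 : pos μ j < pos μ k := hps.mpr (Or.inl (by rw [hμ]; simp [hjk, hκ]))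
    rw [if_pos h1, hμ, divRefl_add_single_left s hjk hκ, X_mul_geomSum]
    have h2 : (if j < k then refl s j k (monomial (κ + Finsupp.single j (m + 1)) 1) else 0)
        ∈ lowSpan μ := by
      split_ifs with hlt
      · rw [monomial_add_single_one, map_mul, refl_monomial_of_eq s hjk hκ, map_pow, refl_X_left,
          mul_pow, mul_left_comm, ← monomial_add_single_one, hμ]
        exact intCast_mul_mem (monomial_mem_lowSpan (below_add_single hlt hκ m) _) _ _
      · exact Submodule.zero_mem _
    rw [add_right_comm, add_sub_cancel_right, ← hμ]
    rw [← hμ] at h2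
    refine Submodule.add_mem _ (Submodule.sum_mem _ fun i hi => ?_) h2
    have hi := Finset.mem_range.mp hi
    refine intCast_mul_mem (monomial_mem_lowSpan ?_ _) _ _
    rw [hμ, show m + 1 = (i + 1) + (m - i) by omega]
    exact below_add_single_add_single (Ne.symm hjk) hκ (by omega) (by omega)
  · have h1 : ¬pos μ j < pos μ k := by
      rw [hps, hμ]
      simp [Ne.symm hjk, hκ]
    rw [if_neg h1, sub_zero, hμ, divRefl_add_single_right s hjk hκ]
    have hr : refl s j k (monomial (κ + Finsupp.single k (m + 1)) 1)
        = ((s : ℤ) : MvPolynomial (Fin N) ℂ) ^ (m + 1)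
          * monomial (κ + Finsupp.single j (m + 1)) 1 := by
      rw [monomial_add_single_one, map_mul, refl_monomial_of_eq s hjk hκ, map_pow, refl_X_right,
          mul_pow, mul_left_comm, ← monomial_add_single_one]
    have hx : X j * -(((s : ℤ) : MvPolynomial (Fin N) ℂ) ^ (m + 1)
          * (monomial κ 1 * geomSum s j k (m + 1)))
        = -(((s : ℤ) : MvPolynomial (Fin N) ℂ) ^ (m + 1)
          * (X j * (monomial κ 1 * geomSum s j k (m + 1)))) := by ring
    rw [hr, hx, X_mul_geomSum, mul_add, neg_add, add_assoc, ← hμ]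
    refine Submodule.add_mem _ (Submodule.neg_mem _ (intCast_mul_mem
      (Submodule.sum_mem _ fun i hi => ?_) _ _)) ?_
    · have hi := Finset.mem_range.mp hi
      refine intCast_mul_mem (monomial_mem_lowSpan ?_ _) _ _
      rw [hμ, show m + 1 = (m - i) + (i + 1) by omega, add_right_comm]
      exact below_add_single_add_single hjk hκ.symm (by omega) (by omega)
    · split_ifs with hlt
      · rw [neg_add_cancel]
        exact Submodule.zero_mem _
      · rw [add_zero]
        refine Submodule.neg_mem _ (intCast_mul_mem (monomial_mem_lowSpan ?_ _) _ _)
        rw [hμ]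
        exact below_add_single (lt_of_le_of_ne (not_lt.mp hlt) hjk) hκ.symm m

/-- The eigenvalue of the Cherednik operator `d_j` at `μ`. -/
def eigenval (A : ℤˣ → ℝ) (b : ℝ) (μ : Fin N →₀ ℕ) (j : Fin N) : ℝ :=
  μ j + (A 1 + A (-1)) * ((N : ℝ) - 1 - (pos μ j : ℕ)) + b

/-- The diagonal terms add up as follows: x_j ∂_j gives μ_j, the two terms with t_j combine to b,
and each k sorted behind j gives q. The part with ∇_j² has lower degree. -/
theorem cherednik_triangular (A : ℤˣ → ℝ) (b ω : ℝ) (j : Fin N) (μ : Fin N →₀ ℕ) :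
    cherednik A b ω j (monomial μ 1) - (eigenval A b μ j : ℂ) • monomial μ 1 ∈ lowSpan μ := by
  set f : MvPolynomial (Fin N) ℂ := monomial μ 1 with hf
  have hpd : X j * pderiv j f = (μ j : ℂ) • f := by
    rw [hf, X_mul_pderiv_monomial, nsmul_eq_mul, smul_eq_C_mul]; simp
  have hs := mul_divSgn j f
  have hpos : ∑ k, (if pos μ j < pos μ k then f else 0) = ((N : ℂ) - 1 - (pos μ j : ℕ)) • f := by
    rw [← Finset.sum_filter, Finset.sum_const, card_pos_lt, ← Nat.cast_smul_eq_nsmul ℂ]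
    have : (pos μ j : ℕ) < N := (pos μ j).2
    rw [Nat.sub_sub, Nat.cast_sub (by omega)]
    push_cast
    congr 1
    ring
  have hmain : cherednik A b ω j f - (eigenval A b μ j : ℂ) • f
      = (∑ s, (A s : ℂ) • ∑ k, (X j * divRefl s j k f + (if j < k then refl s j k f else 0)
          - (if pos μ j < pos μ k then f else 0)))
        - ((1 / (2 * ω) : ℝ) : ℂ) • dunkl A b j (dunkl A b j f) := by
    simp only [Finset.sum_sub_distrib, Finset.sum_add_distrib, hpos]
    rw [cherednik_apply, energy_apply, reflSum_apply, eigenval]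
    -- Only the Dunkl operator standing next to x_j is expanded; ∇_j² stays whole, as only its
    -- degree matters.
    conv_lhs =>
      enter [1, 1, 1, 1, 2]
      rw [dunkl_apply]
    simp only [← Finset.sum_filter, Finset.filter_lt_eq_Ioi, mul_add, hpd, mul_smul_comm, hs,
      Finset.mul_sum, sum_units]
    simp only [smul_eq_C_mul, Complex.ofReal_add, Complex.ofReal_sub, Complex.ofReal_mul,
      Complex.ofReal_natCast, Complex.ofReal_one, C_add, C_mul, C_sub]
    ring
  rw [hmain]
  refine Submodule.sub_mem _ (Submodule.sum_mem _ fun s _ => Submodule.smul_mem _ _ <|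
    Submodule.sum_mem _ fun k _ => pair_triangular s j k μ) (Submodule.smul_mem _ _ ?_)
  exact degSpan_le_lowSpan μ (dunkl_mem_degSpan A b j (dunkl_monomial_mem A b j μ))

end Triangular

/-! ## Weighted integrals of polynomials -/

section Weights

open MeasureTheory Filter Topology

variable {N : ℕ} {ι : Type*} [Fintype ι]

/-- Evaluation of a polynomial at a real point. -/
abbrev ev (x : Fin N → ℝ) : MvPolynomial (Fin N) ℂ →+* ℂ := eval fun i => (x i : ℂ)

theorem continuous_ev (p : MvPolynomial (Fin N) ℂ) : Continuous fun x : Fin N → ℝ => ev x p :=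
  (MvPolynomial.continuous_eval p).comp
    (continuous_pi fun i => Complex.continuous_ofReal.comp (continuous_apply i))

theorem hasLineDerivAt_ev (p : MvPolynomial (Fin N) ℂ) (x : Fin N → ℝ) (j : Fin N) :
    HasLineDerivAt ℝ (fun x => ev x p) (ev x (pderiv j p)) x (Pi.single j 1) := by
  rw [HasLineDerivAt]
  induction p using MvPolynomial.induction_on with
  | C c => simpa using hasDerivAt_const (0 : ℝ) c
  | add p q hp hq => simpa only [map_add] using hp.fun_add hq
  | mul_X p i hp =>
    have hX : HasDerivAt (fun t : ℝ => ev (x + t • Pi.single j 1) (X i)) (ev x (pderiv j (X i))) 0 := by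
      simp only [eval_X, Pi.add_apply, Pi.smul_apply, smul_eq_mul]
      by_cases hij : i = j
      · subst hij
        simp only [Pi.single_eq_same, mul_one, pderiv_X_self, map_one]
        exact ((hasDerivAt_id (0 : ℝ)).const_add (x i)).ofReal_comp
      · simp only [Pi.single_eq_of_ne hij, mul_zero, pderiv_X_of_ne hij, map_zero]
        exact hasDerivAt_const _ _
    have h := hp.fun_mul hX
    simp only [zero_smul, add_zero] at h
    rw [Derivation.leibniz, map_add, smul_eq_mul, smul_eq_mul, map_mul, map_mul]
    simp only [map_mul]
    exact h.congr_deriv (by ring)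

theorem integrable_ev_mul_exp {ω : ℝ} (hω : 0 < ω) (p : MvPolynomial (Fin N) ℂ) :
    Integrable fun x : Fin N → ℝ => ev x p * (Real.exp (-ω * ∑ m, x m ^ 2) : ℂ) := by
  induction p using MvPolynomial.induction_on' with
  | monomial μ c =>
    have h1 : ∀ i : Fin N, Integrable fun t : ℝ => ((t ^ μ i * Real.exp (-ω * t ^ 2) : ℝ) : ℂ) := by
      intro i
      have := integrable_rpow_mul_exp_neg_mul_sq hω (s := (μ i : ℝ))
        (by have : (0 : ℝ) ≤ μ i := Nat.cast_nonneg _; linarith)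
      simp only [Real.rpow_natCast] at this
      exact this.ofReal
    have h2 := (Integrable.fintype_prod h1).const_mul c
    refine h2.congr (Filter.Eventually.of_forall fun x => ?_)
    simp only [eval_monomial, Finsupp.prod_fintype _ _ (fun i => pow_zero _)]
    rw [Finset.mul_sum, Real.exp_sum]
    push_cast
    rw [Finset.prod_mul_distrib]
    ring
  | add p q hp hq =>
    refine (hp.add hq).congr (Filter.Eventually.of_forall fun x => ?_)
    simp only [Pi.add_apply, map_add]
    ring

/-- The regularized weight `∏ (ℓ_i² + δ)^{κ_i} exp(-ω |x|²)`. -/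
def weight (l : ι → (Fin N → ℝ) →ₗ[ℝ] ℝ) (κ : ι → ℝ) (ω δ : ℝ) (x : Fin N → ℝ) : ℝ :=
  (∏ i, ((l i x) ^ 2 + δ) ^ κ i) * Real.exp (-ω * ∑ m, x m ^ 2)

variable {l : ι → (Fin N → ℝ) →ₗ[ℝ] ℝ} {κ : ι → ℝ} {ω δ : ℝ}

theorem continuous_weight (hκ : ∀ i, 0 ≤ κ i) : Continuous (weight l κ ω δ) := by
  have hl : ∀ i, Continuous (l i) := fun i => (l i).continuous_of_finiteDimensional
  unfold weight
  refine Continuous.mul ?_ (by fun_prop)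
  refine continuous_finsetProd _ fun i _ => ?_
  exact (((hl i).pow 2).add continuous_const).rpow_const fun x => Or.inr (hκ i)

theorem weight_nonneg (hδ : 0 ≤ δ) (x : Fin N → ℝ) : 0 ≤ weight l κ ω δ x :=
  mul_nonneg (Finset.prod_nonneg fun _ _ => Real.rpow_nonneg (by positivity) _) (Real.exp_nonneg _)

theorem tendsto_weight (hκ : ∀ i, 0 ≤ κ i) (x : Fin N → ℝ) :
    Tendsto (fun n : ℕ => weight l κ ω (1 / ((n : ℝ) + 1)) x) atTop (𝓝 (weight l κ ω 0 x)) := by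
  have hc : Continuous fun δ => weight l κ ω δ x := by
    unfold weight
    refine Continuous.mul ?_ continuous_const
    refine continuous_finsetProd _ fun i _ => ?_
    exact (continuous_const.add continuous_id).rpow_const fun x => Or.inr (hκ i)
  exact (hc.tendsto 0).comp tendsto_one_div_add_atTop_nhds_zero_nat

/-- A polynomial multiple of the Gaussian dominates the regularized weights. -/
def majorant (l : ι → (Fin N → ℝ) →ₗ[ℝ] ℝ) (κ : ι → ℝ) : MvPolynomial (Fin N) ℂ :=
  ∏ i, ((∑ m, C ((l i (Pi.single m 1) : ℝ) : ℂ) * X m) ^ 2 + 1) ^ ⌈κ i⌉₊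

theorem ev_majorant (x : Fin N → ℝ) :
    ev x (majorant l κ) = ((∏ i, ((l i x) ^ 2 + 1) ^ ⌈κ i⌉₊ : ℝ) : ℂ) := by
  simp only [majorant, map_prod, map_pow, map_add, map_sum, map_mul, eval_C, eval_X, map_one]
  push_cast
  refine Finset.prod_congr rfl fun i _ => ?_
  have : (l i x : ℂ) = ∑ m, ((l i (Pi.single m 1) : ℝ) : ℂ) * (x m : ℂ) := by
    rw [LinearMap.pi_apply_eq_sum_univ (l i) x]
    push_cast
    refine Finset.sum_congr rfl fun m _ => ?_
    rw [smul_eq_mul, mul_comm]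
    push_cast
    congr 4
    funext k
    simp [Pi.single_apply, eq_comm]
  rw [this]

/-- Raising δ to 1 and then κ to its integer ceiling enlarges each factor, since its base is then at
least 1. The bound is uniform in δ, as dominated convergence requires. -/
theorem weight_le (hκ : ∀ i, 0 ≤ κ i) (hδ : 0 ≤ δ) (hδ1 : δ ≤ 1) (x : Fin N → ℝ) :
    weight l κ ω δ x ≤ ‖ev x (majorant l κ) * (Real.exp (-ω * ∑ m, x m ^ 2) : ℂ)‖ := by
  have hp : 0 ≤ ∏ i, ((l i x) ^ 2 + 1) ^ ⌈κ i⌉₊ := Finset.prod_nonneg fun _ _ => by positivity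
  rw [ev_majorant, norm_mul, Complex.norm_real, Complex.norm_real, Real.norm_of_nonneg hp,
    Real.norm_of_nonneg (Real.exp_nonneg _)]
  refine mul_le_mul_of_nonneg_right ?_ (Real.exp_nonneg _)
  refine Finset.prod_le_prod (fun _ _ => Real.rpow_nonneg (by positivity) _) fun i _ => ?_
  calc ((l i x) ^ 2 + δ) ^ κ i ≤ ((l i x) ^ 2 + 1) ^ κ i :=
        Real.rpow_le_rpow (by positivity) (by linarith) (hκ i)
    _ ≤ ((l i x) ^ 2 + 1) ^ ((⌈κ i⌉₊ : ℕ) : ℝ) :=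
        Real.rpow_le_rpow_of_exponent_le (by nlinarith [sq_nonneg (l i x)]) (Nat.le_ceil _)
    _ = ((l i x) ^ 2 + 1) ^ ⌈κ i⌉₊ := Real.rpow_natCast _ _

theorem norm_weight_mul_le (hκ : ∀ i, 0 ≤ κ i) (hδ : 0 ≤ δ) (hδ1 : δ ≤ 1) {c : ℝ}
    {u : ℝ} (hu : |u| ≤ c) (p : MvPolynomial (Fin N) ℂ) (x : Fin N → ℝ) :
    ‖((weight l κ ω δ x * u : ℝ) : ℂ) * ev x p‖
      ≤ c * ‖ev x (majorant l κ * p) * (Real.exp (-ω * ∑ m, x m ^ 2) : ℂ)‖ := by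
  have h := weight_le (l := l) (ω := ω) hκ hδ hδ1 x
  rw [norm_mul, Complex.norm_real, norm_mul, Real.norm_of_nonneg (weight_nonneg hδ x), map_mul,
    Real.norm_eq_abs, norm_mul, norm_mul]
  rw [norm_mul] at h
  have h1 := mul_le_mul h hu (abs_nonneg u) (by positivity)
  have h2 := mul_le_mul_of_nonneg_right h1 (norm_nonneg (ev x p))
  linarith

theorem integrable_weight_mul (hω : 0 < ω) (hκ : ∀ i, 0 ≤ κ i) (hδ : 0 ≤ δ) (hδ1 : δ ≤ 1) {c : ℝ}
    {u : (Fin N → ℝ) → ℝ} (hu : Continuous u) (huc : ∀ x, |u x| ≤ c)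
    (p : MvPolynomial (Fin N) ℂ) :
    Integrable fun x => ((weight l κ ω δ x * u x : ℝ) : ℂ) * ev x p := by
  refine Integrable.mono' ((integrable_ev_mul_exp hω (majorant l κ * p)).norm.const_mul c)
    ?_ (Filter.Eventually.of_forall fun x => norm_weight_mul_le hκ hδ hδ1 (huc x) p x)
  refine Continuous.aestronglyMeasurable ?_
  exact (Complex.continuous_ofReal.comp ((continuous_weight hκ).mul hu)).mul (continuous_ev p)

theorem integrable_weight (hω : 0 < ω) (hκ : ∀ i, 0 ≤ κ i) (hδ : 0 ≤ δ) (hδ1 : δ ≤ 1)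
    (p : MvPolynomial (Fin N) ℂ) :
    Integrable fun x => (weight l κ ω δ x : ℂ) * ev x p := by
  have := integrable_weight_mul (l := l) hω hκ hδ hδ1 (c := 1) (u := fun _ => 1) continuous_const
    (by simp) p
  simpa using this

/-! ### Integration by parts for the regularized weight and its limit -/

theorem hasLineDerivAt_weight (hδ : 0 < δ) (x : Fin N → ℝ) (j : Fin N) :
    HasLineDerivAt ℝ (weight l κ ω δ)
      (weight l κ ω δ x * ((∑ i, κ i * (2 * l i x * l i (Pi.single j 1) / ((l i x) ^ 2 + δ)))
        - 2 * ω * x j)) x (Pi.single j 1) := by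
  have hpos : ∀ i y, 0 < (l i y) ^ 2 + δ := fun i y => by positivity
  -- For δ > 0 every factor is positive, so the weight is the exponential of a smooth function and
  -- its logarithmic derivative can be read off.
  have heq : weight l κ ω δ = fun y =>
      Real.exp ((∑ i, κ i * Real.log ((l i y) ^ 2 + δ)) + -ω * ∑ m, y m ^ 2) := by
    funext y
    rw [weight, Real.exp_add, Real.exp_sum]
    congr 1
    refine Finset.prod_congr rfl fun i _ => ?_
    rw [Real.rpow_def_of_pos (hpos i y), mul_comm]
  rw [heq, HasLineDerivAt]
  have hl : ∀ i, HasDerivAt (fun t : ℝ => l i (x + t • Pi.single j 1)) (l i (Pi.single j 1)) 0 := by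
    intro i
    simp only [map_add, map_smul, smul_eq_mul]
    simpa using ((hasDerivAt_id (0 : ℝ)).mul_const (l i (Pi.single j 1))).const_add (l i x)
  have h1 : HasDerivAt (fun t : ℝ => ∑ i, κ i * Real.log ((l i (x + t • Pi.single j 1)) ^ 2 + δ))
      (∑ i, κ i * (2 * l i x * l i (Pi.single j 1) / ((l i x) ^ 2 + δ))) 0 := by
    refine HasDerivAt.fun_sum fun i _ => ?_
    have := ((((hl i).pow 2).add_const δ).log (by simpa using (hpos i _).ne')).const_mul (κ i)
    simpa using this
  have h2 : HasDerivAt (fun t : ℝ => ∑ m, (x + t • (Pi.single j 1 : Fin N → ℝ)) m ^ 2) (2 * x j) 0 := by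
    have : ∀ m, HasDerivAt (fun t : ℝ => (x + t • (Pi.single j 1 : Fin N → ℝ)) m ^ 2)
        (if m = j then 2 * x j else 0) 0 := by
      intro m
      simp only [Pi.add_apply, Pi.smul_apply, smul_eq_mul]
      have h := (((hasDerivAt_id (0 : ℝ)).mul_const
        ((Pi.single j (1 : ℝ) : Fin N → ℝ) m)).const_add (x m)).fun_pow 2
      split_ifs with hm
      · subst hm; simpa using h
      · simpa [hm] using h
    simpa using HasDerivAt.fun_sum fun m (_ : m ∈ Finset.univ) => this m
  refine (h1.fun_add (h2.const_mul (-ω))).exp.congr_deriv ?_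
  simp only [zero_smul, add_zero]
  ring

/-- The bound may blow up as δ → 0: it only serves integrability at fixed δ. The limit uses the
kernel t² / (t² + δ), which is bounded by 1. -/
theorem abs_div_sq_add_le (hδ : 0 < δ) (t : ℝ) : |t / (t ^ 2 + δ)| ≤ 1 + 1 / δ := by
  have hp : 0 < t ^ 2 + δ := by positivity
  rw [abs_div, abs_of_pos hp, div_le_iff₀ hp]
  have h : 1 + 1 / δ = (δ + 1) / δ := by field_simp
  rw [h, div_mul_eq_mul_div, le_div_iff₀ hδ]
  nlinarith [sq_abs t, abs_nonneg t, sq_nonneg (|t| - 1), mul_nonneg hδ.le (sq_nonneg (|t| - 1)),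
    mul_nonneg hδ.le (sq_nonneg t), sq_nonneg t]

theorem abs_sq_div_sq_add_le (hδ : 0 < δ) (t : ℝ) : |t ^ 2 / (t ^ 2 + δ)| ≤ 1 := by
  have hp : 0 < t ^ 2 + δ := by positivity
  rw [abs_div, abs_of_pos hp, div_le_iff₀ hp, abs_of_nonneg (sq_nonneg t)]
  linarith

theorem continuous_div_sq_add (hδ : 0 < δ) (f : (Fin N → ℝ) →ₗ[ℝ] ℝ) :
    Continuous fun x => f x / ((f x) ^ 2 + δ) := by
  have hl : Continuous f := f.continuous_of_finiteDimensional
  exact hl.div₀ ((hl.pow 2).add continuous_const) fun x => by positivity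

theorem continuous_sq_div_sq_add (hδ : 0 < δ) (f : (Fin N → ℝ) →ₗ[ℝ] ℝ) :
    Continuous fun x => (f x) ^ 2 / ((f x) ^ 2 + δ) := by
  have hl : Continuous f := f.continuous_of_finiteDimensional
  exact (hl.pow 2).div₀ ((hl.pow 2).add continuous_const) fun x => by positivity

theorem integral_weight_by_parts (hω : 0 < ω) (hκ : ∀ i, 0 ≤ κ i) (hδ : 0 < δ) (hδ1 : δ ≤ 1)
    (j : Fin N) (G : MvPolynomial (Fin N) ℂ) :
    (∫ x, (weight l κ ω δ x : ℂ) * ev x (pderiv j G - C ((2 * ω : ℝ) : ℂ) * X j * G))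
      + ∑ i, ((κ i * l i (Pi.single j 1) : ℝ) : ℂ)
        * ∫ x, ((weight l κ ω δ x * (l i x / ((l i x) ^ 2 + δ)) : ℝ) : ℂ) * ev x (2 * G) = 0 := by
  have hI := fun p => integrable_weight (l := l) hω hκ hδ.le hδ1 p
  have hJ := fun i p => integrable_weight_mul (l := l) hω hκ hδ.le hδ1
    (continuous_div_sq_add hδ (l i)) (fun x => abs_div_sq_add_le hδ (l i x)) p
  have hd : ∀ x, ev x G * ((weight l κ ω δ x
      * ((∑ i, κ i * (2 * l i x * l i (Pi.single j 1) / ((l i x) ^ 2 + δ))) - 2 * ω * x j) : ℝ) : ℂ)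
      = ∑ i, ((κ i * l i (Pi.single j 1) : ℝ) : ℂ)
          * (((weight l κ ω δ x * (l i x / ((l i x) ^ 2 + δ)) : ℝ) : ℂ) * ev x (2 * G))
        - (weight l κ ω δ x : ℂ) * ev x (C ((2 * ω : ℝ) : ℂ) * X j * G) := by
    intro x
    simp only [map_mul, eval_C, eval_X, map_ofNat]
    push_cast
    rw [mul_sub, mul_sub, Finset.mul_sum, Finset.mul_sum]
    congr 1
    · refine Finset.sum_congr rfl fun i _ => ?_
      ring
    · ring
  have hS : Integrable fun x => ∑ i, ((κ i * l i (Pi.single j 1) : ℝ) : ℂ)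
          * (((weight l κ ω δ x * (l i x / ((l i x) ^ 2 + δ)) : ℝ) : ℂ) * ev x (2 * G)) :=
    integrable_finsetSum _ fun i _ => (hJ i _).const_mul _
  have key := integral_bilinear_hasLineDerivAt_right_eq_neg_left_of_integrable
    (μ := (volume : Measure (Fin N → ℝ))) (B := ContinuousLinearMap.mul ℝ ℂ)
    (f := fun x => ev x G) (f' := fun x => ev x (pderiv j G)) (v := Pi.single j 1)
    (g := fun x => (weight l κ ω δ x : ℂ))
    (g' := fun x => ((weight l κ ω δ x
      * ((∑ i, κ i * (2 * l i x * l i (Pi.single j 1) / ((l i x) ^ 2 + δ))) - 2 * ω * x j) : ℝ) : ℂ))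
    (by simpa only [ContinuousLinearMap.mul_apply', mul_comm] using hI (pderiv j G))
    (by
      simp only [ContinuousLinearMap.mul_apply', hd]
      exact hS.sub (hI _))
    (by simpa only [ContinuousLinearMap.mul_apply', mul_comm] using hI G)
    (fun x _ => hasLineDerivAt_ev G x j)
    (fun x _ => (hasLineDerivAt_weight hδ x j).ofReal_comp)
  simp only [ContinuousLinearMap.mul_apply', hd] at key
  rw [integral_sub hS (hI _), integral_finsetSum _
    fun i _ => (hJ i _).const_mul _] at key
  simp only [integral_const_mul] at key
  simp only [map_sub, mul_sub]
  rw [integral_sub (hI _) (hI _)]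
  simp only [mul_comm (ev _ (pderiv j G))] at key
  linear_combination key

theorem tendsto_integral_weight (hω : 0 < ω) (hκ : ∀ i, 0 ≤ κ i) (p : MvPolynomial (Fin N) ℂ) :
    Tendsto (fun n : ℕ => ∫ x, (weight l κ ω (1 / ((n : ℝ) + 1)) x : ℂ) * ev x p) atTop
      (𝓝 (∫ x, (weight l κ ω 0 x : ℂ) * ev x p)) := by
  have h01 : ∀ n : ℕ, 0 ≤ 1 / ((n : ℝ) + 1) ∧ 1 / ((n : ℝ) + 1) ≤ 1 := fun n =>
    ⟨by positivity, by rw [div_le_one (by positivity)]; linarith [Nat.cast_nonneg (α := ℝ) n]⟩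
  refine tendsto_integral_of_dominated_convergence _
    (fun n => (integrable_weight hω hκ (h01 n).1 (h01 n).2 p).aestronglyMeasurable)
    ((integrable_ev_mul_exp hω (majorant l κ * p)).norm.const_mul 1) (fun n => ?_) ?_
  · refine Filter.Eventually.of_forall fun x => ?_
    have := norm_weight_mul_le (l := l) (ω := ω) hκ (h01 n).1 (h01 n).2 (c := 1) (u := 1) (by simp) p x
    simpa using this
  · refine Filter.Eventually.of_forall fun x => ?_
    exact ((Complex.continuous_ofReal.tendsto _).comp (tendsto_weight hκ x)).mul_const _

/-- The extra factor tends to 1 off the mirror and is 0 on it. With κ i ≠ 0 the limiting weight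
vanishes on the mirror, so the integrands converge at every point. -/
theorem tendsto_integral_weight_mul (hω : 0 < ω) (hκ : ∀ i, 0 ≤ κ i) {i : ι} (hi : κ i ≠ 0)
    (p : MvPolynomial (Fin N) ℂ) :
    Tendsto (fun n : ℕ => ∫ x, ((weight l κ ω (1 / ((n : ℝ) + 1)) x
        * ((l i x) ^ 2 / ((l i x) ^ 2 + 1 / ((n : ℝ) + 1))) : ℝ) : ℂ) * ev x p) atTop
      (𝓝 (∫ x, (weight l κ ω 0 x : ℂ) * ev x p)) := by
  have h01 : ∀ n : ℕ, 0 < 1 / ((n : ℝ) + 1) ∧ 1 / ((n : ℝ) + 1) ≤ 1 := fun n =>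
    ⟨by positivity, by rw [div_le_one (by positivity)]; linarith [Nat.cast_nonneg (α := ℝ) n]⟩
  refine tendsto_integral_of_dominated_convergence _
    (fun n => (integrable_weight_mul hω hκ (h01 n).1.le (h01 n).2
      (continuous_sq_div_sq_add (h01 n).1 (l i))
      (fun x => abs_sq_div_sq_add_le (h01 n).1 (l i x)) p).aestronglyMeasurable)
    ((integrable_ev_mul_exp hω (majorant l κ * p)).norm.const_mul 1) (fun n => ?_) ?_
  · exact Filter.Eventually.of_forall fun x => norm_weight_mul_le hκ (h01 n).1.le (h01 n).2
      (abs_sq_div_sq_add_le (h01 n).1 (l i x)) p x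
  · refine Filter.Eventually.of_forall fun x => Tendsto.mul_const _ ?_
    refine (Complex.continuous_ofReal.tendsto _).comp ?_
    by_cases hx : l i x = 0
    · have : weight l κ ω 0 x = 0 := by
        rw [weight, Finset.prod_eq_zero (Finset.mem_univ i), zero_mul]
        rw [hx, zero_pow two_ne_zero, add_zero, Real.zero_rpow hi]
      rw [this]
      simp [hx]
    · have h1 : Tendsto (fun n : ℕ => (l i x) ^ 2 / ((l i x) ^ 2 + 1 / ((n : ℝ) + 1))) atTop
          (𝓝 ((l i x) ^ 2 / ((l i x) ^ 2 + 0))) :=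
        tendsto_const_nhds.div (tendsto_const_nhds.add tendsto_one_div_add_atTop_nhds_zero_nat)
          (by positivity)
      rw [add_zero, div_self (by positivity)] at h1
      simpa using (tendsto_weight (l := l) (ω := ω) hκ x).mul h1

/-- Integration by parts for the singular weight: if `2 G - H_i = ℓ_i Q_i` with `H_i` even for
the reflection at `ℓ_i = 0`, then the integral of
`∂_j G + ∑ κ_i ∂_jℓ_i Q_i - 2 ω x_j G` vanishes. -/
theorem integral_weight_eq_zero (hω : 0 < ω) (hκ : ∀ i, 0 ≤ κ i) (j : Fin N)
    (G : MvPolynomial (Fin N) ℂ) (H Q : ι → MvPolynomial (Fin N) ℂ)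
    (hQ : ∀ i, κ i ≠ 0 → ∀ x, ev x (2 * G) = (l i x : ℂ) * ev x (Q i) + ev x (H i))
    (hH : ∀ i, κ i ≠ 0 → ∀ δ, 0 < δ →
      ∫ x, ((weight l κ ω δ x * (l i x / ((l i x) ^ 2 + δ)) : ℝ) : ℂ) * ev x (H i) = 0) :
    ∫ x, (weight l κ ω 0 x : ℂ) * ev x (pderiv j G
      + ∑ i, ((κ i * l i (Pi.single j 1) : ℝ) : ℂ) • Q i - C ((2 * ω : ℝ) : ℂ) * X j * G) = 0 := by
  have h01 : ∀ n : ℕ, 0 < 1 / ((n : ℝ) + 1) ∧ 1 / ((n : ℝ) + 1) ≤ 1 := fun n =>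
    ⟨by positivity, by rw [div_le_one (by positivity)]; linarith [Nat.cast_nonneg (α := ℝ) n]⟩
  have hI := fun p => integrable_weight (l := l) hω hκ le_rfl zero_le_one p
  have hstep : ∀ n : ℕ, (∫ x, (weight l κ ω (1 / ((n : ℝ) + 1)) x : ℂ)
        * ev x (pderiv j G - C ((2 * ω : ℝ) : ℂ) * X j * G))
      + ∑ i, ((κ i * l i (Pi.single j 1) : ℝ) : ℂ)
        * ∫ x, ((weight l κ ω (1 / ((n : ℝ) + 1)) x
        * ((l i x) ^ 2 / ((l i x) ^ 2 + 1 / ((n : ℝ) + 1))) : ℝ) : ℂ) * ev x (Q i) = 0 := by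
    intro n
    obtain ⟨h0, h1⟩ := h01 n
    rw [← integral_weight_by_parts (l := l) hω hκ h0 h1 j G]
    congr 1
    refine Finset.sum_congr rfl fun i _ => ?_
    by_cases hi : κ i = 0
    · simp [hi]
    congr 1
    -- Inserting 2 G = ℓ Q + H turns the singular kernel ℓ / (ℓ² + δ) into ℓ² / (ℓ² + δ) on Q; the
    -- part with H integrates to zero by parity.
    have hsplit : ∀ x, ((weight l κ ω (1 / ((n : ℝ) + 1)) x
          * (l i x / ((l i x) ^ 2 + 1 / ((n : ℝ) + 1))) : ℝ) : ℂ) * ev x (2 * G)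
        = ((weight l κ ω (1 / ((n : ℝ) + 1)) x
          * ((l i x) ^ 2 / ((l i x) ^ 2 + 1 / ((n : ℝ) + 1))) : ℝ) : ℂ) * ev x (Q i)
        + ((weight l κ ω (1 / ((n : ℝ) + 1)) x
          * (l i x / ((l i x) ^ 2 + 1 / ((n : ℝ) + 1))) : ℝ) : ℂ) * ev x (H i) := by
      intro x
      rw [hQ i hi x]
      push_cast
      ring
    simp only [hsplit]
    rw [integral_add, hH i hi _ h0, add_zero]
    · exact integrable_weight_mul hω hκ h0.le h1 (continuous_sq_div_sq_add h0 (l i))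
        (fun x => abs_sq_div_sq_add_le h0 (l i x)) _
    · exact integrable_weight_mul hω hκ h0.le h1 (continuous_div_sq_add h0 (l i))
        (fun x => abs_div_sq_add_le h0 (l i x)) _
  have hlim := (tendsto_integral_weight (l := l) hω hκ
    (pderiv j G - C ((2 * ω : ℝ) : ℂ) * X j * G)).add
    (tendsto_finsetSum Finset.univ fun i _ => show Tendsto (fun n : ℕ =>
      ((κ i * l i (Pi.single j 1) : ℝ) : ℂ) * ∫ x, ((weight l κ ω (1 / ((n : ℝ) + 1)) x
        * ((l i x) ^ 2 / ((l i x) ^ 2 + 1 / ((n : ℝ) + 1))) : ℝ) : ℂ) * ev x (Q i)) atTop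
      (𝓝 (((κ i * l i (Pi.single j 1) : ℝ) : ℂ)
        * ∫ x, (weight l κ ω 0 x : ℂ) * ev x (Q i))) from by
        by_cases hi : κ i = 0
        · simp [hi]
        · exact (tendsto_integral_weight_mul hω hκ hi (Q i)).const_mul _)
  simp only [hstep] at hlim
  have h0 := tendsto_nhds_unique tendsto_const_nhds hlim
  rw [h0]
  simp only [← integral_const_mul]
  rw [← integral_finsetSum _ fun i _ => (hI (Q i)).const_mul _,
    ← integral_add (hI _) (integrable_finsetSum _ fun i _ => (hI (Q i)).const_mul _)]
  refine integral_congr_ae (Filter.Eventually.of_forall fun x => ?_)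
  simp only [map_sub, map_add, map_sum, smul_eval]
  have : ∑ i, ((κ i * l i (Pi.single j 1) : ℝ) : ℂ) * ((weight l κ ω 0 x : ℂ) * ev x (Q i))
      = (weight l κ ω 0 x : ℂ) * ∑ i, ((κ i * l i (Pi.single j 1) : ℝ) : ℂ) * ev x (Q i) := by
    rw [Finset.mul_sum]
    exact Finset.sum_congr rfl fun i _ => by ring
  rw [this]
  ring

end Weights

/-! ## The inner products and the adjoint of a Dunkl operator -/

section InnerProducts

open MeasureTheory Filter Topology

variable {N : ℕ}

/-- The change of variables dual to `signedPerm`. -/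
def signedAct (ε : Fin N → ℤˣ) (τ : Equiv.Perm (Fin N)) (x : Fin N → ℝ) : Fin N → ℝ :=
  fun i => ((ε i : ℤ) : ℝ) * x (τ i)

theorem ev_signedPerm (ε : Fin N → ℤˣ) (τ : Equiv.Perm (Fin N)) (x : Fin N → ℝ)
    (p : MvPolynomial (Fin N) ℂ) : ev x (signedPerm ε τ p) = ev (signedAct ε τ x) p := by
  have h : (ev x).comp (signedPerm ε τ : MvPolynomial (Fin N) ℂ →+* MvPolynomial (Fin N) ℂ)
      = ev (signedAct ε τ x) := by
    apply MvPolynomial.ringHom_ext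
    · intro c
      simp [signedPerm]
    · intro i
      simp [signedPerm_X, signedAct]
  exact DFunLike.congr_fun h p

/-- Sign changes and coordinate permutations preserve Lebesgue measure. No integrability is needed,
as both are measurable equivalences. -/
theorem integral_signedAct (ε : Fin N → ℤˣ) (τ : Equiv.Perm (Fin N)) (h : (Fin N → ℝ) → ℂ) :
    ∫ x, h (signedAct ε τ x) = ∫ x, h x := by
  have hunit : ∀ s : ℤˣ, ((s : ℤ) : ℝ) * ((s : ℤ) : ℝ) = 1 := by
    intro s
    rcases Int.units_eq_one_or s with rfl | rfl <;> simp
  let e : (Fin N → ℝ) ≃ᵐ (Fin N → ℝ) :=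
    { toFun := fun x i => ((ε i : ℤ) : ℝ) * x i
      invFun := fun x i => ((ε i : ℤ) : ℝ) * x i
      left_inv := fun x => by funext i; simp only [← mul_assoc, hunit, one_mul]
      right_inv := fun x => by funext i; simp only [← mul_assoc, hunit, one_mul]
      measurable_toFun := by
        refine measurable_pi_lambda _ fun i => ?_
        exact (measurable_pi_apply i).const_mul _
      measurable_invFun := by
        refine measurable_pi_lambda _ fun i => ?_
        exact (measurable_pi_apply i).const_mul _ }
  have he : MeasurePreserving e := by
    refine volume_preserving_pi (f := fun i t => ((ε i : ℤ) : ℝ) * t) fun i => ?_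
    rcases Int.units_eq_one_or (ε i) with h | h
    · simp only [h, Units.val_one, Int.cast_one, one_mul]
      exact MeasurePreserving.id volume
    · simpa [h] using Measure.measurePreserving_neg (volume : Measure ℝ)
  have hτ := volume_measurePreserving_piCongrLeft (fun _ : Fin N => ℝ) τ.symm
  have h1 := he.integral_comp e.measurableEmbedding h
  have h2 := hτ.integral_comp (MeasurableEquiv.measurableEmbedding _) (fun x => h (e x))
  rw [← h1, ← h2]
  refine integral_congr_ae (Filter.Eventually.of_forall fun x => ?_)
  refine congrArg h ?_
  funext i
  change _ = ((ε i : ℤ) : ℝ) * _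
  rw [signedAct]
  congr 1
  have := MeasurableEquiv.piCongrLeft_apply_apply (β := fun _ : Fin N => ℝ) τ.symm x (τ i)
  rw [Equiv.symm_apply_apply] at this
  exact this.symm

/-- The mirrors `x_j = s x_k` and `x_l = 0`. -/
abbrev Mirror (N : ℕ) : Type := (ℤˣ × Fin N × Fin N) ⊕ Fin N

/-- The linear form that vanishes on a mirror. -/
def mirrorForm : Mirror N → (Fin N → ℝ) →ₗ[ℝ] ℝ
  | Sum.inl p => LinearMap.proj p.2.1 - ((p.1 : ℤ) : ℝ) • LinearMap.proj p.2.2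
  | Sum.inr i => LinearMap.proj i

/-- The exponent of a mirror in the weight; a mirror `x_j = s x_k` occurs twice. -/
def mirrorExp (A : ℤˣ → ℝ) (b : ℝ) : Mirror N → ℝ
  -- Triples with equal indices are not mirrors; the exponent 0 makes their factor 1, also at zeros
  -- of the form.
  | Sum.inl p => if p.2.1 = p.2.2 then 0 else A p.1 / 2
  | Sum.inr _ => b

/-- The weight of the inner product. -/
def mirrorWeight (A : ℤˣ → ℝ) (b ω δ : ℝ) (x : Fin N → ℝ) : ℝ :=
  weight mirrorForm (mirrorExp A b) ω δ x

theorem mirrorForm_inl (s : ℤˣ) (j k : Fin N) (x : Fin N → ℝ) :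
    mirrorForm (Sum.inl (s, j, k)) x = x j - ((s : ℤ) : ℝ) * x k := rfl

theorem mirrorForm_inr (i : Fin N) (x : Fin N → ℝ) : mirrorForm (Sum.inr i) x = x i := rfl

/-- The multiplicities are nonnegative, and those of the mirrors `x_j = x_k` and `x_j = -x_k`
agree unless only the former occur. -/
structure Admissible (A : ℤˣ → ℝ) (b : ℝ) : Prop where
  nonneg : ∀ s, 0 ≤ A s
  nonneg' : 0 ≤ b
  even : A (-1) ≠ 0 ∨ b ≠ 0 → A (-1) = A 1

theorem Admissible.mirrorExp_nonneg {A : ℤˣ → ℝ} {b : ℝ} (h : Admissible A b) (i : Mirror N) :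
    0 ≤ mirrorExp A b i := by
  rcases i with p | i
  · simp only [mirrorExp]
    split_ifs
    · exact le_rfl
    · exact div_nonneg (h.nonneg _) zero_le_two
  · exact h.nonneg'

theorem units_cast_sq (s : ℤˣ) : ((s : ℤ) : ℝ) ^ 2 = 1 := by
  rcases Int.units_eq_one_or s with rfl | rfl <;> simp

/-- A signed permutation permutes the mirrors, carries their forms to each other up to sign, and by
compatibility keeps the exponents. The forms enter only through their squares. -/
theorem mirrorWeight_signedAct {A : ℤˣ → ℝ} {ε : Fin N → ℤˣ} (hA : Compatible A ε)
    (τ : Equiv.Perm (Fin N)) (b ω δ : ℝ) (x : Fin N → ℝ) :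
    mirrorWeight A b ω δ (signedAct ε τ x) = mirrorWeight A b ω δ x := by
  let e : Mirror N → Mirror N :=
    Sum.map (fun p => (p.1 * (ε p.2.1 * ε p.2.2), τ p.2.1, τ p.2.2)) τ
  have he : Function.Bijective e := by
    refine Finite.injective_iff_bijective.mp (Function.Injective.sumMap ?_ τ.injective)
    rintro ⟨s, j, k⟩ ⟨s', j', k'⟩ h
    simp only [Prod.mk.injEq, EmbeddingLike.apply_eq_iff_eq] at h
    obtain ⟨h1, rfl, rfl⟩ := h
    rw [mul_left_inj] at h1
    rw [h1]
  rw [mirrorWeight, mirrorWeight, weight, weight]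
  congr 1
  · refine Fintype.prod_bijective e he _ _ fun i => ?_
    rcases i with ⟨s, j, k⟩ | i
    · have h1 : mirrorExp A b (e (Sum.inl (s, j, k)))
          = mirrorExp A b (Sum.inl (s, j, k) : Mirror N) := by
        simp [e, mirrorExp, hA j k s]
      have h2 : (mirrorForm (Sum.inl (s, j, k)) (signedAct ε τ x)) ^ 2
          = (mirrorForm (e (Sum.inl (s, j, k))) x) ^ 2 := by
        have hj := units_cast_sq (ε j)
        simp only [e, Sum.map_inl, mirrorForm_inl, signedAct]
        push_cast
        linear_combination (x (τ j) ^ 2 - (((s : ℤ) : ℝ) * ((ε k : ℤ) : ℝ) * x (τ k)) ^ 2) * hj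
      rw [h1, h2]
    · have h2 : (mirrorForm (Sum.inr i) (signedAct ε τ x)) ^ 2
          = (mirrorForm (e (Sum.inr i)) x) ^ 2 := by
        simp only [e, Sum.map_inr, mirrorForm_inr, signedAct, mul_pow, units_cast_sq, one_mul]
      rw [h2]
      rfl
  · congr 2
    simp only [signedAct, mul_pow, units_cast_sq, one_mul]
    exact Equiv.sum_comp τ fun i => x i ^ 2

/-- The integral of a polynomial against the weight. -/
def moment (A : ℤˣ → ℝ) (b ω : ℝ) (p : MvPolynomial (Fin N) ℂ) : ℂ :=
  ∫ x, (mirrorWeight A b ω 0 x : ℂ) * ev x p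

variable {A : ℤˣ → ℝ} {b ω : ℝ}

theorem integrable_mirrorWeight (hA : Admissible A b) (hω : 0 < ω) (p : MvPolynomial (Fin N) ℂ) :
    Integrable fun x => (mirrorWeight A b ω 0 x : ℂ) * ev x p :=
  integrable_weight hω hA.mirrorExp_nonneg le_rfl zero_le_one p

theorem moment_add (hA : Admissible A b) (hω : 0 < ω) (p q : MvPolynomial (Fin N) ℂ) :
    moment A b ω (p + q) = moment A b ω p + moment A b ω q := by
  simp only [moment, map_add, mul_add]
  exact integral_add (integrable_mirrorWeight hA hω p) (integrable_mirrorWeight hA hω q)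

theorem moment_smul (c : ℂ) (p : MvPolynomial (Fin N) ℂ) :
    moment A b ω (c • p) = c * moment A b ω p := by
  simp only [moment, smul_eval, mul_left_comm _ c]
  exact integral_const_mul _ _

theorem moment_sub (hA : Admissible A b) (hω : 0 < ω) (p q : MvPolynomial (Fin N) ℂ) :
    moment A b ω (p - q) = moment A b ω p - moment A b ω q := by
  have h : p - q = p + (-1 : ℂ) • q := by rw [neg_one_smul, sub_eq_add_neg]
  rw [h, moment_add hA hω, moment_smul]
  ring

theorem moment_signedPerm {ε : Fin N → ℤˣ} (hε : Compatible A ε) (τ : Equiv.Perm (Fin N))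
    (p : MvPolynomial (Fin N) ℂ) : moment A b ω (signedPerm ε τ p) = moment A b ω p := by
  rw [moment, moment,
    ← integral_signedAct ε τ fun x => (mirrorWeight A b ω 0 x : ℂ) * ev x p]
  simp only [ev_signedPerm, mirrorWeight_signedAct hε]

theorem compatible_refl (hA : A (-1) = A 1 ∨ s = 1) (j k : Fin N) :
    Compatible A (fun i => if i = j ∨ i = k then s else 1) := by
  rcases hA with h | rfl
  · exact compatible_of_even h _
  · intro i k' t
    simp

/-- The substitution negates the linear form and fixes the weight and H, so the integral equals its
own negative. -/
theorem integral_odd_eq_zero {ε : Fin N → ℤˣ} (hε : Compatible A ε) (τ : Equiv.Perm (Fin N))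
    {i : Mirror N} (hi : ∀ x, mirrorForm i (signedAct ε τ x) = -mirrorForm i x)
    {H : MvPolynomial (Fin N) ℂ} (hH : signedPerm ε τ H = H) (δ : ℝ) :
    ∫ x, ((mirrorWeight A b ω δ x * (mirrorForm i x / ((mirrorForm i x) ^ 2 + δ)) : ℝ) : ℂ)
      * ev x H = 0 := by
  have h := integral_signedAct ε τ fun x =>
    ((mirrorWeight A b ω δ x * (mirrorForm i x / ((mirrorForm i x) ^ 2 + δ)) : ℝ) : ℂ) * ev x H
  simp only [mirrorWeight_signedAct hε, hi, ← ev_signedPerm, hH, neg_sq, neg_div, mul_neg,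
    Complex.ofReal_neg, neg_mul] at h
  rw [integral_neg] at h
  exact self_eq_neg.mp h.symm

/-- Each mirror is listed as (j, k) and as (k, j) with half the exponent. The ∂_j-derivative of its
form is 1 in one case and -s in the other; by the antisymmetry of F the two halves agree and add up
to c. -/
theorem sum_sum_single_sub {M : Type*} [AddCommGroup M] [Module ℂ M] (s : ℤˣ) (j : Fin N)
    (F : Fin N → Fin N → M) (hF : ∀ k, k ≠ j → F k j = -(((s : ℤ) : ℂ) • F j k)) (c : ℝ) :
    ∑ i, ∑ k, ((((if i = k then (0 : ℝ) else c / 2)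
        * ((Pi.single j (1 : ℝ) : Fin N → ℝ) i
          - ((s : ℤ) : ℝ) * (Pi.single j (1 : ℝ) : Fin N → ℝ) k) : ℝ) : ℂ) • F i k)
      = (c : ℂ) • ∑ k ∈ Finset.univ.erase j, F j k := by
  have hs : ((s : ℤ) : ℂ) * ((s : ℤ) : ℂ) = 1 := by
    rcases Int.units_eq_one_or s with rfl | rfl <;> simp
  have h1 : ∑ i, ∑ k, (((if i = k then (0 : ℝ) else c / 2)
        * (Pi.single j (1 : ℝ) : Fin N → ℝ) i : ℝ) : ℂ) • F i k
      = ((c / 2 : ℝ) : ℂ) • ∑ k ∈ Finset.univ.erase j, F j k := by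
    rw [Finset.sum_eq_single j (fun i _ hi => by simp [hi]) (by simp)]
    rw [← Finset.add_sum_erase _ _ (Finset.mem_univ j), Finset.smul_sum]
    simp only [if_true, zero_mul, Complex.ofReal_zero, zero_smul, zero_add]
    refine Finset.sum_congr rfl fun k hk => ?_
    rw [if_neg (Finset.ne_of_mem_erase hk).symm]
    simp
  have h2 : ∑ i, ∑ k, (((if i = k then (0 : ℝ) else c / 2)
        * (((s : ℤ) : ℝ) * (Pi.single j (1 : ℝ) : Fin N → ℝ) k) : ℝ) : ℂ) • F i k
      = -(((c / 2 : ℝ) : ℂ) • ∑ k ∈ Finset.univ.erase j, F j k) := by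
    rw [Finset.sum_comm, Finset.sum_eq_single j (fun i _ hi => by simp [hi]) (by simp)]
    rw [← Finset.add_sum_erase _ _ (Finset.mem_univ j), Finset.smul_sum, ← Finset.sum_neg_distrib]
    simp only [if_true, zero_mul, Complex.ofReal_zero, zero_smul, zero_add]
    refine Finset.sum_congr rfl fun k hk => ?_
    rw [if_neg (Finset.ne_of_mem_erase hk), hF k (Finset.ne_of_mem_erase hk), smul_neg, smul_smul]
    congr 2
    simp only [Pi.single_eq_same, mul_one]
    push_cast
    linear_combination ((c : ℂ) / 2) * hs
  simp only [mul_sub, Complex.ofReal_sub, sub_smul, Finset.sum_sub_distrib]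
  rw [h1, h2, sub_neg_eq_add, ← add_smul, ← Complex.ofReal_add, add_halves]

/-- This says that 2ω x_j - ∇_j is the adjoint of ∇_j for the bilinear form. Take G = f g, and for
the reflection σ in a mirror ℓ = 0 let H = σf · g + f · σg, which is σ-invariant. Then 2 G - H = ℓ
Q, with Q the Leibniz expression in the divided differences of f and g. Summing the Q over all
mirrors therefore rebuilds the difference parts of ∇_j f · g + f · ∇_j g. -/
theorem moment_dunkl_add (hA : Admissible A b) (hω : 0 < ω) (j : Fin N)
    (f g : MvPolynomial (Fin N) ℂ) :
    moment A b ω (dunkl A b j f * g + f * dunkl A b j g - C ((2 * ω : ℝ) : ℂ) * X j * (f * g))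
      = 0 := by
  let Q : Mirror N → MvPolynomial (Fin N) ℂ := fun i => match i with
    | Sum.inl p => divRefl p.1 p.2.1 p.2.2 f * g + f * divRefl p.1 p.2.1 p.2.2 g
    | Sum.inr i => divSgn i f * g + f * divSgn i g
  let H : Mirror N → MvPolynomial (Fin N) ℂ := fun i => match i with
    | Sum.inl p => refl p.1 p.2.1 p.2.2 f * g + f * refl p.1 p.2.1 p.2.2 g
    | Sum.inr i => sgn i f * g + f * sgn i g
  have key := integral_weight_eq_zero (l := mirrorForm) hω hA.mirrorExp_nonneg j (f * g) H Q ?_ ?_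
  · rw [moment]
    convert key using 5
    congr 1
    rw [Fintype.sum_sum_type, Fintype.sum_prod_type, Derivation.leibniz, smul_eq_mul, smul_eq_mul,
      dunkl_apply, dunkl_apply]
    have hinl : ∀ s : ℤˣ, ∑ q : Fin N × Fin N,
        ((mirrorExp A b (Sum.inl (s, q)) * mirrorForm (Sum.inl (s, q)) (Pi.single j 1) : ℝ) : ℂ)
          • Q (Sum.inl (s, q)) = (A s : ℂ) • ∑ k, (divRefl s j k f * g + f * divRefl s j k g) := by
      intro s
      rw [Fintype.sum_prod_type]
      have hF := sum_sum_single_sub s j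
        (fun i k => divRefl s i k f * g + f * divRefl s i k g) ?_ (A s)
      · have hR : ∑ k, (divRefl s j k f * g + f * divRefl s j k g)
            = ∑ k ∈ Finset.univ.erase j, (divRefl s j k f * g + f * divRefl s j k g) := by
          rw [← Finset.add_sum_erase _ _ (Finset.mem_univ j), divRefl_self, LinearMap.zero_apply,
            LinearMap.zero_apply, zero_mul, mul_zero, add_zero, zero_add]
        rw [hR, ← hF]
        rfl
      · intro k hk
        -- The two forms of one mirror are proportional: x_k - s x_j = -s (x_j - s x_k).
        have hneg : ∀ p, divRefl s k j p = -(((s : ℤ) : ℂ) • divRefl s j k p) := by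
          intro p
          apply mul_left_cancel₀ (linear_ne_zero s (Ne.symm hk))
          have h1 := mul_divRefl s hk p
          have h3 := units_mul_self (N := N) s
          rw [mul_divRefl s (Ne.symm hk), refl_comm, ← h1, smul_eq_C_mul, map_intCast]
          linear_combination (-(X j * divRefl s j k p)) * h3
        rw [hneg, hneg]
        simp only [smul_eq_C_mul]
        ring
    have hinr : ∑ i : Fin N,
        ((mirrorExp A b (Sum.inr i : Mirror N) * mirrorForm (Sum.inr i) (Pi.single j 1) : ℝ) : ℂ)
          • Q (Sum.inr i) = (b : ℂ) • (divSgn j f * g + f * divSgn j g) := by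
      rw [Finset.sum_eq_single j]
      · simp [mirrorExp, mirrorForm_inr, Q]
      · intro i _ hi
        simp [mirrorForm_inr, hi]
      · simp
    rw [hinr]
    simp only [hinl, Finset.sum_add_distrib, smul_add, add_mul, mul_add, Finset.sum_mul,
      Finset.mul_sum, smul_mul_assoc, mul_smul_comm]
    simp only [Finset.smul_sum]
    ring
  · rintro (⟨s, i, k⟩ | i) hi x
    · have hik : k ≠ i := by
        rintro rfl
        simp [mirrorExp] at hi
      have h1 := congrArg (ev x) (mul_divRefl s hik f)
      have h2 := congrArg (ev x) (mul_divRefl s hik g)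
      simp only [map_mul, map_sub, eval_X, map_intCast] at h1 h2
      simp only [mirrorForm_inl, Q, H, map_mul, map_add, map_ofNat]
      push_cast
      linear_combination (-(ev x g)) * h1 - (ev x f) * h2
    · have h1 := congrArg (ev x) (mul_divSgn i f)
      have h2 := congrArg (ev x) (mul_divSgn i g)
      simp only [map_mul, map_sub, eval_X] at h1 h2
      simp only [mirrorForm_inr, Q, H, map_mul, map_add, map_ofNat]
      linear_combination (-(ev x g)) * h1 - (ev x f) * h2
  · rintro (⟨s, i, k⟩ | i) hi δ _
    · have hik : k ≠ i := by
        rintro rfl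
        simp [mirrorExp] at hi
      have hs : A (-1) = A 1 ∨ s = 1 := by
        rcases Int.units_eq_one_or s with rfl | rfl
        · exact Or.inr rfl
        · refine Or.inl (hA.even (Or.inl ?_))
          intro h0
          simp [mirrorExp, h0] at hi
      refine integral_odd_eq_zero (compatible_refl hs i k) (Equiv.swap i k) ?_ ?_ δ
      · intro x
        have h3 := units_cast_sq s
        simp only [mirrorForm_inl, signedAct, true_or, or_true, if_true, Equiv.swap_apply_left,
          Equiv.swap_apply_right]
        linear_combination (-(x i)) * h3
      · change refl s i k (refl s i k f * g + f * refl s i k g) = _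
        rw [map_add, map_mul, map_mul, refl_refl, refl_refl]
        exact add_comm _ _
    · have hb : b ≠ 0 := hi
      refine integral_odd_eq_zero (compatible_of_even (hA.even (Or.inr hb))
        (fun m => if m = i then -1 else 1)) 1 ?_ ?_ δ
      · intro x
        simp [mirrorForm_inr, signedAct]
      · rw [← sgn_eq_signedPerm]
        change sgn i (sgn i f * g + f * sgn i g) = _
        rw [map_add, map_mul, map_mul, sgn_sgn, sgn_sgn]
        exact add_comm _ _

end InnerProducts

/-! ## Self-adjointness of the Cherednik operators -/

section SelfAdjoint

open MeasureTheory

variable {N : ℕ} {A : ℤˣ → ℝ} {b ω : ℝ}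

/-- The left factor x_j - (2ω)⁻¹ ∇_j is (2ω)⁻¹ times the adjoint of ∇_j. The right side is symmetric
in f and g, which gives self-adjointness at once. -/
theorem moment_energy_mul (hA : Admissible A b) (hω : 0 < ω) (j : Fin N)
    (f g : MvPolynomial (Fin N) ℂ) :
    moment A b ω (energy A b ω j f * g)
      = ((1 / (2 * ω) : ℝ) : ℂ) * moment A b ω (dunkl A b j f * dunkl A b j g) := by
  have h := moment_dunkl_add hA hω j (dunkl A b j f) g
  rw [moment_sub hA hω, moment_add hA hω, mul_assoc, ← smul_eq_C_mul, moment_smul] at h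
  have hc : ((1 / (2 * ω) : ℝ) : ℂ) * ((2 * ω : ℝ) : ℂ) = 1 := by
    rw [← Complex.ofReal_mul, one_div_mul_cancel (by positivity), Complex.ofReal_one]
  rw [energy_apply, sub_mul, smul_mul_assoc, moment_sub hA hω, moment_smul, mul_assoc]
  linear_combination (-((1 / (2 * ω) : ℝ) : ℂ)) * h
    - moment A b ω (X j * (dunkl A b j f * g)) * hc

theorem moment_energy (hA : Admissible A b) (hω : 0 < ω) (j : Fin N)
    (f g : MvPolynomial (Fin N) ℂ) :
    moment A b ω (energy A b ω j f * g) = moment A b ω (f * energy A b ω j g) := by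
  rw [moment_energy_mul hA hω, mul_comm f, moment_energy_mul hA hω, mul_comm (dunkl A b j f)]

theorem moment_refl {s : ℤˣ} (hs : A (-1) = A 1 ∨ s = 1) (j k : Fin N)
    (f g : MvPolynomial (Fin N) ℂ) :
    moment A b ω (refl s j k f * g) = moment A b ω (f * refl s j k g) := by
  rw [← moment_signedPerm (compatible_refl hs j k) (Equiv.swap j k) (f * refl s j k g)]
  change _ = moment A b ω (refl s j k (f * refl s j k g))
  rw [map_mul, refl_refl]

theorem moment_sgn (hs : A (-1) = A 1) (j : Fin N) (f g : MvPolynomial (Fin N) ℂ) :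
    moment A b ω (sgn j f * g) = moment A b ω (f * sgn j g) := by
  rw [← moment_signedPerm (compatible_of_even hs fun i => if i = j then -1 else 1) 1 (f * sgn j g),
    ← sgn_eq_signedPerm, map_mul, sgn_sgn]

theorem moment_sum (hA : Admissible A b) (hω : 0 < ω) {κ : Type*} (T : Finset κ)
    (F : κ → MvPolynomial (Fin N) ℂ) :
    moment A b ω (∑ i ∈ T, F i) = ∑ i ∈ T, moment A b ω (F i) := by
  classical
  induction T using Finset.induction_on with
  | empty => simp [moment]
  | insert i T hi ih => rw [Finset.sum_insert hi, Finset.sum_insert hi, moment_add hA hω, ih]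

/-- The reflections and sign changes are involutions that preserve the weight. In type A sign
changes do not preserve it, but there every such term has coefficient 0. -/
theorem moment_cherednik (hA : Admissible A b) (hω : 0 < ω) (j : Fin N)
    (f g : MvPolynomial (Fin N) ℂ) :
    moment A b ω (cherednik A b ω j f * g) = moment A b ω (f * cherednik A b ω j g) := by
  have hrefl : moment A b ω (reflSum A j (Finset.Ioi j) f * g)
      = moment A b ω (f * reflSum A j (Finset.Ioi j) g) := by
    rw [reflSum_apply, reflSum_apply]
    simp only [Finset.smul_sum, Finset.sum_mul, Finset.mul_sum, smul_mul_assoc, mul_smul_comm,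
      moment_sum hA hω, moment_smul]
    refine Finset.sum_congr rfl fun s _ => Finset.sum_congr rfl fun k _ => ?_
    by_cases hs : A s = 0
    · simp [hs]
    · rw [moment_refl]
      rcases Int.units_eq_one_or s with rfl | rfl
      · exact Or.inr rfl
      · exact Or.inl (hA.even (Or.inl hs))
  have hsgn : (b : ℂ) * moment A b ω (sgn j f * g) = (b : ℂ) * moment A b ω (f * sgn j g) := by
    by_cases hb : b = 0
    · simp [hb]
    · rw [moment_sgn (hA.even (Or.inr hb))]
  rw [cherednik_apply, cherednik_apply]
  simp only [add_mul, mul_add, moment_add hA hω, smul_mul_assoc, mul_smul_comm, moment_smul]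
  rw [moment_energy hA hω, hrefl, hsgn]

/-! ### Complex conjugation -/

/-- Conjugation of the coefficients of a polynomial. -/
def conjPoly : MvPolynomial (Fin N) ℂ →+* MvPolynomial (Fin N) ℂ := map (starRingEnd ℂ)

theorem ev_conjPoly (x : Fin N → ℝ) (p : MvPolynomial (Fin N) ℂ) :
    ev x (conjPoly p) = (starRingEnd ℂ) (ev x p) := by
  have h : (ev x).comp conjPoly = (starRingEnd ℂ).comp (ev x) := by
    apply MvPolynomial.ringHom_ext
    · intro c; simp [conjPoly]
    · intro i; simp [conjPoly]
  exact DFunLike.congr_fun h p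

theorem conjPoly_X (i : Fin N) : conjPoly (X i) = X i := by simp [conjPoly]

theorem conjPoly_smul (c : ℂ) (p : MvPolynomial (Fin N) ℂ) :
    conjPoly (c • p) = (starRingEnd ℂ c) • conjPoly p := by
  simp [conjPoly, smul_eq_C_mul]

theorem conjPoly_signedPerm (ε : Fin N → ℤˣ) (τ : Equiv.Perm (Fin N))
    (p : MvPolynomial (Fin N) ℂ) :
    conjPoly (signedPerm ε τ p) = signedPerm ε τ (conjPoly p) := by
  have h : conjPoly.comp (signedPerm ε τ : MvPolynomial (Fin N) ℂ →+* MvPolynomial (Fin N) ℂ)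
      = (signedPerm ε τ : MvPolynomial (Fin N) ℂ →+* MvPolynomial (Fin N) ℂ).comp conjPoly := by
    apply MvPolynomial.ringHom_ext
    · intro c; simp [conjPoly, signedPerm]
    · intro i; simp [signedPerm_X, conjPoly_X]
  exact DFunLike.congr_fun h p

theorem conjPoly_refl (s : ℤˣ) (j k : Fin N) (p : MvPolynomial (Fin N) ℂ) :
    conjPoly (refl s j k p) = refl s j k (conjPoly p) := conjPoly_signedPerm _ _ _

theorem conjPoly_sgn (j : Fin N) (p : MvPolynomial (Fin N) ℂ) :
    conjPoly (sgn j p) = sgn j (conjPoly p) := by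
  rw [sgn_eq_signedPerm, conjPoly_signedPerm]

theorem conjPoly_divRefl (s : ℤˣ) (j k : Fin N) (p : MvPolynomial (Fin N) ℂ) :
    conjPoly (divRefl s j k p) = divRefl s j k (conjPoly p) := by
  by_cases hjk : k = j
  · subst hjk; simp [divRefl_self]
  apply mul_left_cancel₀ (linear_ne_zero s hjk)
  have h := congrArg conjPoly (mul_divRefl s hjk p)
  rw [map_mul, map_sub, map_sub, map_mul, conjPoly_X, conjPoly_X, map_intCast, conjPoly_refl] at h
  rw [mul_divRefl s hjk, h]

theorem conjPoly_divSgn (j : Fin N) (p : MvPolynomial (Fin N) ℂ) :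
    conjPoly (divSgn j p) = divSgn j (conjPoly p) := by
  apply mul_left_cancel₀ (X_ne_zero (R := ℂ) j)
  have h := congrArg conjPoly (mul_divSgn j p)
  rw [map_mul, map_sub, conjPoly_X, conjPoly_sgn] at h
  rw [mul_divSgn, h]

theorem conjPoly_dunkl (j : Fin N) (p : MvPolynomial (Fin N) ℂ) :
    conjPoly (dunkl A b j p) = dunkl A b j (conjPoly p) := by
  rw [dunkl_apply, dunkl_apply]
  simp only [map_add, map_sum, conjPoly_smul, conjPoly_divRefl, conjPoly_divSgn, Complex.conj_ofReal]
  rw [conjPoly, pderiv_map]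

theorem conjPoly_cherednik (j : Fin N) (p : MvPolynomial (Fin N) ℂ) :
    conjPoly (cherednik A b ω j p) = cherednik A b ω j (conjPoly p) := by
  rw [cherednik_apply, cherednik_apply, energy_apply, energy_apply, reflSum_apply, reflSum_apply]
  simp only [map_add, map_sub, map_mul, map_sum, conjPoly_smul, conjPoly_refl, conjPoly_sgn,
    conjPoly_X, conjPoly_dunkl, Complex.conj_ofReal]

/-! ### The inner product -/

/-- The inner product defined by the weight of the mirrors. -/
def polyInner (A : ℤˣ → ℝ) (b ω : ℝ) (f g : MvPolynomial (Fin N) ℂ) : ℂ :=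
  moment A b ω (conjPoly f * g)

theorem polyInner_cherednik (hA : Admissible A b) (hω : 0 < ω) (j : Fin N)
    (f g : MvPolynomial (Fin N) ℂ) :
    polyInner A b ω (cherednik A b ω j f) g = polyInner A b ω f (cherednik A b ω j g) := by
  rw [polyInner, polyInner, conjPoly_cherednik, moment_cherednik hA hω]

theorem polyInner_adjExch (j : SimpleIndex N) (f g : MvPolynomial (Fin N) ℂ) :
    polyInner A b ω (adjExch j f) g = polyInner A b ω f (adjExch j g) := by
  rw [polyInner, polyInner, adjExch, conjPoly_refl, moment_refl (Or.inr rfl)]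

theorem polyInner_add_left (hA : Admissible A b) (hω : 0 < ω) (f g h : MvPolynomial (Fin N) ℂ) :
    polyInner A b ω (f + g) h = polyInner A b ω f h + polyInner A b ω g h := by
  rw [polyInner, map_add, add_mul, moment_add hA hω]; rfl

theorem polyInner_add_right (hA : Admissible A b) (hω : 0 < ω) (f g h : MvPolynomial (Fin N) ℂ) :
    polyInner A b ω f (g + h) = polyInner A b ω f g + polyInner A b ω f h := by
  rw [polyInner, mul_add, moment_add hA hω]; rfl

theorem polyInner_smul_left (c : ℂ) (f g : MvPolynomial (Fin N) ℂ) :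
    polyInner A b ω (c • f) g = (starRingEnd ℂ) c * polyInner A b ω f g := by
  rw [polyInner, conjPoly_smul, smul_mul_assoc, moment_smul]; rfl

theorem polyInner_smul_right (c : ℂ) (f g : MvPolynomial (Fin N) ℂ) :
    polyInner A b ω f (c • g) = c * polyInner A b ω f g := by
  rw [polyInner, mul_smul_comm, moment_smul]; rfl

theorem polyInner_conj (f g : MvPolynomial (Fin N) ℂ) :
    (starRingEnd ℂ) (polyInner A b ω g f) = polyInner A b ω f g := by
  rw [polyInner, polyInner, moment, moment, ← integral_conj]
  refine integral_congr_ae (Filter.Eventually.of_forall fun x => ?_)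
  simp only [map_mul, Complex.conj_ofReal, ev_conjPoly, Complex.conj_conj]
  ring

theorem polyInner_self (f : MvPolynomial (Fin N) ℂ) :
    polyInner A b ω f f = ((∫ x, mirrorWeight A b ω 0 x * Complex.normSq (ev x f) : ℝ) : ℂ) := by
  rw [polyInner, moment, ← integral_complex_ofReal]
  refine integral_congr_ae (Filter.Eventually.of_forall fun x => ?_)
  simp only [map_mul, ev_conjPoly, Complex.ofReal_mul]
  rw [Complex.normSq_eq_conj_mul_self]

/-- The product of the equations of the mirrors. -/
def mirrorPoly (N : ℕ) : MvPolynomial (Fin N) ℂ :=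
  (∏ p : ℤˣ × Fin N × Fin N, if p.2.1 = p.2.2 then 1
    else X p.2.1 - ((p.1 : ℤ) : MvPolynomial (Fin N) ℂ) * X p.2.2) * ∏ i : Fin N, X i

theorem mirrorPoly_ne_zero : mirrorPoly N ≠ 0 := by
  refine mul_ne_zero (Finset.prod_ne_zero_iff.mpr fun p _ => ?_)
    (Finset.prod_ne_zero_iff.mpr fun i _ => X_ne_zero i)
  split_ifs with h
  · exact one_ne_zero
  · exact linear_ne_zero p.1 (Ne.symm h)

/-- At δ = 0 the weight can vanish only on a mirror, because elsewhere every base of a power is a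
positive square. -/
theorem mirrorWeight_pos {x : Fin N → ℝ} (hx : ev x (mirrorPoly N) ≠ 0) :
    0 < mirrorWeight A b ω 0 x := by
  rw [mirrorPoly, map_mul, map_prod, map_prod] at hx
  obtain ⟨h1, h2⟩ := mul_ne_zero_iff.mp hx
  rw [Finset.prod_ne_zero_iff] at h1 h2
  refine mul_pos (Finset.prod_pos fun i _ => ?_) (Real.exp_pos _)
  rw [add_zero]
  rcases i with ⟨s, j, k⟩ | i
  · by_cases hjk : j = k
    · simp [mirrorExp, hjk]
    · refine Real.rpow_pos_of_pos (sq_pos_of_ne_zero fun h => ?_) _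
      refine h1 (s, j, k) (Finset.mem_univ _) ?_
      rw [mirrorForm_inl] at h
      simp only [if_neg hjk, map_sub, map_mul, eval_X, map_intCast]
      exact_mod_cast h
  · refine Real.rpow_pos_of_pos (sq_pos_of_ne_zero fun h => ?_) _
    refine h2 i (Finset.mem_univ _) ?_
    rw [mirrorForm_inr] at h
    simp [h]

theorem polyInner_self_nonneg (f : MvPolynomial (Fin N) ℂ) : 0 ≤ (polyInner A b ω f f).re := by
  rw [polyInner_self, Complex.ofReal_re]
  exact integral_nonneg fun x => mul_nonneg (weight_nonneg le_rfl x) (Complex.normSq_nonneg _)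

/-- A continuous nonnegative function with integral zero vanishes identically, so f vanishes at all
real points off the mirrors. -/
theorem eq_zero_of_polyInner_self (hA : Admissible A b) (hω : 0 < ω)
    {f : MvPolynomial (Fin N) ℂ} (hf : polyInner A b ω f f = 0) : f = 0 := by
  rw [polyInner_self, Complex.ofReal_eq_zero] at hf
  have hint : Integrable fun x => mirrorWeight A b ω 0 x * Complex.normSq (ev x f) := by
    have h := (integrable_mirrorWeight hA hω (conjPoly f * f)).re
    refine h.congr (Filter.Eventually.of_forall fun x => ?_)
    simp only [map_mul, ev_conjPoly]
    rw [← Complex.normSq_eq_conj_mul_self, ← Complex.ofReal_mul]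
    exact Complex.ofReal_re _
  have hae := (integral_eq_zero_iff_of_nonneg
    (fun x => mul_nonneg (weight_nonneg le_rfl x) (Complex.normSq_nonneg _)) hint).mp hf
  have hcont : Continuous fun x => mirrorWeight A b ω 0 x * Complex.normSq (ev x f) :=
    (continuous_weight hA.mirrorExp_nonneg).mul (Complex.continuous_normSq.comp (continuous_ev f))
  have hzero := (hcont.ae_eq_iff_eq volume continuous_const).mp hae
  have hprod : mirrorPoly N * f = 0 := by
    -- Multiplication by the equations of the mirrors takes care of the points where the weight may
    -- vanish; the product is then zero on all of ℝ^N, which suffices for a complex polynomial since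
    -- ℝ is infinite.
    refine MvPolynomial.funext_set (fun _ => Set.range ((↑) : ℝ → ℂ))
      (fun _ => Set.infinite_range_of_injective Complex.ofReal_injective) fun y hy => ?_
    choose x hx using fun i => hy i (Set.mem_univ i)
    obtain rfl : (fun i => (x i : ℂ)) = y := funext hx
    rw [map_zero, map_mul]
    by_cases h : ev x (mirrorPoly N) = 0
    · rw [h, zero_mul]
    · have h1 := congrFun hzero x
      have h2 := (mul_eq_zero.mp h1).resolve_left (mirrorWeight_pos h).ne'
      rw [Complex.normSq_eq_zero.mp h2, mul_zero]
  exact (mul_eq_zero.mp hprod).resolve_left mirrorPoly_ne_zero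

/-! ### The inner products of type A and B -/

theorem sq_rpow_half (t a : ℝ) : (t ^ 2) ^ (a / 2) = |t| ^ a := by
  rw [← sq_abs, ← Real.rpow_natCast, ← Real.rpow_mul (abs_nonneg t)]
  congr 1
  push_cast
  ring

theorem sq_rpow (t a : ℝ) : (t ^ 2) ^ a = (|t| ^ a) ^ 2 := by
  rw [← sq_abs, ← Real.rpow_natCast, ← Real.rpow_natCast, ← Real.rpow_mul (abs_nonneg t),
    ← Real.rpow_mul (abs_nonneg t), mul_comm]

/-- The product over ordered pairs meets every unordered pair twice; this turns the halved exponents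
of the mirrors into |φ|². -/
theorem prod_prod_eq_sq (F : Fin N → Fin N → ℝ) (hsymm : ∀ j k, F j k = F k j) :
    ∏ j, ∏ k, (if j = k then 1 else F j k) = (∏ j, ∏ k ∈ Finset.Ioi j, F j k) ^ 2 := by
  have h := Finset.prod_prod_Ioi_mul_eq_prod_prod_off_diag F
  simp only [Finset.prod_mul_distrib] at h
  have h1 : ∏ i, ∏ j ∈ Finset.Ioi i, F j i = ∏ i, ∏ j ∈ Finset.Ioi i, F i j := by
    simp only [hsymm]
  rw [sq]
  nth_rewrite 1 [← h1]
  rw [h]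
  refine Finset.prod_congr rfl fun i _ => ?_
  rw [← Finset.prod_compl_mul_prod ({i} : Finset (Fin N)), Finset.prod_singleton, if_pos rfl, mul_one]
  refine Finset.prod_congr rfl fun k hk => ?_
  rw [if_neg, hsymm]
  rintro rfl
  simp at hk

theorem mirrorWeight_eq (A : ℤˣ → ℝ) (b ω : ℝ) (x : Fin N → ℝ) :
    mirrorWeight A b ω 0 x = (∏ s : ℤˣ, (∏ j, ∏ k ∈ Finset.Ioi j,
        |x j - ((s : ℤ) : ℝ) * x k| ^ A s) ^ 2) * (∏ i, |x i| ^ b) ^ 2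
      * Real.exp (-ω * ∑ m, x m ^ 2) := by
  rw [mirrorWeight, weight, Fintype.prod_sum_type, Fintype.prod_prod_type, ← Finset.prod_pow]
  congr 2
  · refine Finset.prod_congr rfl fun s _ => ?_
    rw [Fintype.prod_prod_type, ← prod_prod_eq_sq]
    · refine Finset.prod_congr rfl fun j _ => Finset.prod_congr rfl fun k _ => ?_
      simp only [mirrorForm_inl, mirrorExp, add_zero]
      split_ifs
      · exact Real.rpow_zero _
      · exact sq_rpow_half _ _
    · intro j k
      rcases Int.units_eq_one_or s with rfl | rfl
      · simp [abs_sub_comm]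
      · simp [add_comm]
  · refine Finset.prod_congr rfl fun i _ => ?_
    simp only [mirrorForm_inr, mirrorExp, add_zero]
    exact sq_rpow _ _

theorem exp_half_sq (ω S : ℝ) : Real.exp (-(1 / 2) * ω * S) ^ 2 = Real.exp (-ω * S) := by
  rw [← Real.exp_nat_mul]
  congr 1
  push_cast
  ring

theorem groundA_sq (a ω : ℝ) (x : Fin N → ℝ) :
    |groundA a ω x| ^ 2 = mirrorWeight (multA a) 0 ω 0 x := by
  rw [sq_abs, groundA, mul_pow, exp_half_sq, mirrorWeight_eq, UnitsInt.univ,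
    Finset.prod_pair (by decide)]
  simp [multA]

theorem groundB_sq (a b ω : ℝ) (x : Fin N → ℝ) :
    |groundB a b ω x| ^ 2 = mirrorWeight (multB a) b ω 0 x := by
  have h : ∏ j, ∏ k ∈ Finset.Ioi j, |x j ^ 2 - x k ^ 2| ^ a
      = (∏ j, ∏ k ∈ Finset.Ioi j, |x j - (((1 : ℤˣ) : ℤ) : ℝ) * x k| ^ a)
        * ∏ j, ∏ k ∈ Finset.Ioi j, |x j - (((-1 : ℤˣ) : ℤ) : ℝ) * x k| ^ a := by
    simp only [← Finset.prod_mul_distrib]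
    refine Finset.prod_congr rfl fun j _ => Finset.prod_congr rfl fun k _ => ?_
    rw [← Real.mul_rpow (abs_nonneg _) (abs_nonneg _), ← abs_mul]
    congr 2
    push_cast
    ring
  rw [sq_abs, groundB, mul_pow, mul_pow, exp_half_sq, mirrorWeight_eq, UnitsInt.univ,
    Finset.prod_pair (by decide), h, mul_pow]
  rfl

theorem innerWith_eq_polyInner {φ : (Fin N → ℝ) → ℝ}
    (hφ : ∀ x, |φ x| ^ 2 = mirrorWeight A b ω 0 x) (f g : MvPolynomial (Fin N) ℂ) :
    innerWith φ f g = polyInner A b ω f g := by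
  rw [innerWith, polyInner, moment]
  refine integral_congr_ae (Filter.Eventually.of_forall fun x => ?_)
  simp only [hφ, map_mul, ev_conjPoly, mul_assoc]

theorem innerA_eq (a ω : ℝ) (f g : MvPolynomial (Fin N) ℂ) :
    innerA a ω f g = polyInner (multA a) 0 ω f g := innerWith_eq_polyInner (groundA_sq a ω) f g

theorem innerB_eq (a b ω : ℝ) (f g : MvPolynomial (Fin N) ℂ) :
    innerB a b ω f g = polyInner (multB a) b ω f g := innerWith_eq_polyInner (groundB_sq a b ω) f g

theorem admissible_multA {a : ℝ} (ha : 0 ≤ a) : Admissible (multA a) 0 where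
  nonneg s := by rw [multA]; split_ifs <;> simp [ha]
  nonneg' := le_rfl
  even h := by simp [multA, show ¬((-1 : ℤˣ) = 1) by decide] at h

theorem admissible_multB {a b : ℝ} (ha : 0 ≤ a) (hb : 0 ≤ b) : Admissible (multB a) b where
  nonneg _ := ha
  nonneg' := hb
  even _ := rfl

end SelfAdjoint

/-! ## Joint eigenvectors of the Cherednik operators -/

section Spectral

variable {N : ℕ} {A : ℤˣ → ℝ} {b ω : ℝ}

/-- In an inner product space, every vector has an orthogonal projection to a
finite-dimensional subspace. -/
theorem exists_orthogonal_projection {E : Type*} [AddCommGroup E] [Module ℂ E]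
    (c : InnerProductSpace.Core ℂ E) (V : Submodule ℂ E) [FiniteDimensional ℂ V] (x : E) :
    ∃ v ∈ V, ∀ w ∈ V, c.inner w (x - v) = 0 := by
  let : NormedAddCommGroup E := @InnerProductSpace.Core.toNormedAddCommGroup ℂ E _ _ _ c
  let : InnerProductSpace ℂ E := InnerProductSpace.ofCore c.toCore
  obtain ⟨v, hv, z, hz, rfl⟩ := V.exists_add_mem_mem_orthogonal x
  refine ⟨v, hv, fun w hw => ?_⟩
  rw [add_sub_cancel_left]
  exact (Submodule.mem_orthogonal V z).mp hz w hw

/-- The inner product of polynomials as an `InnerProductSpace.Core`. -/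
abbrev polyCore (hA : Admissible A b) (hω : 0 < ω) :
    InnerProductSpace.Core ℂ (MvPolynomial (Fin N) ℂ) where
  inner := polyInner A b ω
  conj_inner_symm := polyInner_conj
  re_inner_nonneg := polyInner_self_nonneg
  add_left := polyInner_add_left hA hω
  smul_left f g c := polyInner_smul_left c f g
  definite _ := eq_zero_of_polyInner_self hA hω

instance finiteDimensional_lowSpan (μ : Fin N →₀ ℕ) : FiniteDimensional ℂ (lowSpan μ) := by
  rw [lowSpan, restrictSupport_eq_span]
  exact FiniteDimensional.span_of_finite ℂ ((finite_below μ).image _)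

/-- A joint eigenvector with the eigenvalues that belong to `μ`. -/
def IsEigen (A : ℤˣ → ℝ) (b ω : ℝ) (μ : Fin N →₀ ℕ) (f : MvPolynomial (Fin N) ℂ) : Prop :=
  ∀ j, cherednik A b ω j f = (eigenval A b μ j : ℂ) • f

/-- The defining properties of a non-symmetric Hermite or Laguerre polynomial. -/
def IsNonsym (A : ℤˣ → ℝ) (b ω : ℝ) (μ : Fin N →₀ ℕ) (f : MvPolynomial (Fin N) ℂ) : Prop :=
  IsMonicTriangular μ f ∧ IsEigen A b ω μ f

theorem lowSpan_mono {μ ν : Fin N →₀ ℕ} (h : Below ν μ) : lowSpan ν ≤ lowSpan μ := by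
  intro p hp
  rw [mem_lowSpan_iff] at *
  exact fun κ hκ => (hp κ hκ).trans h

theorem cherednik_mem_lowSpan {μ : Fin N →₀ ℕ} {p : MvPolynomial (Fin N) ℂ} (hp : p ∈ lowSpan μ)
    (j : Fin N) : cherednik A b ω j p ∈ lowSpan μ := by
  refine map_mem_of_monomials _ fun ν hν => ?_
  have hνμ := mem_lowSpan_iff.mp hp ν hν
  have h := lowSpan_mono hνμ (cherednik_triangular A b ω j ν)
  have := Submodule.add_mem _ h
    (Submodule.smul_mem _ (eigenval A b ν j : ℂ) (monomial_mem_lowSpan hνμ 1))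
  rwa [sub_add_cancel] at this

theorem isMonicTriangular_iff {μ : Fin N →₀ ℕ} {p : MvPolynomial (Fin N) ℂ} :
    IsMonicTriangular μ p ↔ p - monomial μ 1 ∈ lowSpan μ := by
  rw [mem_lowSpan_iff, IsMonicTriangular]
  constructor
  · rintro ⟨h1, h2⟩ ν hν
    by_cases he : ν = μ
    · subst he; simp [h1] at hν
    · rw [coeff_sub, coeff_monomial, if_neg (Ne.symm he), sub_zero] at hν
      exact ⟨he, h2 ν he hν⟩
  · intro h
    constructor
    · by_contra hne
      refine Below.irrefl μ (h μ ?_)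
      rw [coeff_sub, coeff_monomial, if_pos rfl]
      exact sub_ne_zero.mpr hne
    · intro ν he hν
      refine (h ν ?_).2
      rwa [coeff_sub, coeff_monomial, if_neg (Ne.symm he), sub_zero]

/-- Let h be the component of x^μ orthogonal to the lower span, and u = d_j h - e_j h. Triangularity
puts u into the lower span, which d_j preserves, so ⟨u, d_j h⟩ = ⟨d_j u, h⟩ = 0 and ⟨u, h⟩ = 0.
Hence ⟨u, u⟩ = 0. -/
theorem exists_isNonsym (hA : Admissible A b) (hω : 0 < ω) (μ : Fin N →₀ ℕ) :
    ∃ f, IsNonsym A b ω μ f := by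
  obtain ⟨v, hv, hort⟩ := exists_orthogonal_projection (polyCore (N := N) hA hω) (lowSpan μ)
    (monomial μ 1)
  change ∀ w ∈ lowSpan μ, polyInner A b ω w (monomial μ 1 - v) = 0 at hort
  refine ⟨monomial μ 1 - v, ?_, fun j => ?_⟩
  · rw [isMonicTriangular_iff, sub_sub_cancel_left]
    exact Submodule.neg_mem _ hv
  · set h : MvPolynomial (Fin N) ℂ := monomial μ 1 - v with hh
    rw [← sub_eq_zero]
    set u := cherednik A b ω j h - (eigenval A b μ j : ℂ) • h with hu
    have hmem : u ∈ lowSpan μ := by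
      have : u = (cherednik A b ω j (monomial μ 1) - (eigenval A b μ j : ℂ) • monomial μ 1)
          - (cherednik A b ω j v - (eigenval A b μ j : ℂ) • v) := by
        rw [hu, hh, map_sub, smul_sub]
        abel
      rw [this]
      exact Submodule.sub_mem _ (cherednik_triangular A b ω j μ)
        (Submodule.sub_mem _ (cherednik_mem_lowSpan hv j) (Submodule.smul_mem _ _ hv))
    apply eq_zero_of_polyInner_self hA hω
    have h1 : polyInner A b ω u u = polyInner A b ω u (cherednik A b ω j h)
        + (-(eigenval A b μ j : ℂ)) * polyInner A b ω u h := by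
      rw [← polyInner_smul_right, ← polyInner_add_right hA hω]
      congr 1
      rw [hu, neg_smul, sub_eq_add_neg]
    rw [h1, hort u hmem, ← polyInner_cherednik hA hω, hort _ (cherednik_mem_lowSpan hmem j)]
    simp

/-! ### Separation of the joint spectrum and uniqueness -/

theorem eigenval_lt_of_pos_lt (hA : Admissible A b) {μ : Fin N →₀ ℕ} {j k : Fin N}
    (h : pos μ j < pos μ k) :
    (μ k : ℝ) ≤ μ j ∧ (A 1 + A (-1)) ≤ (A 1 + A (-1)) * ((pos μ k : ℕ) - (pos μ j : ℕ) : ℝ) := by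
  constructor
  · rcases pos_lt_pos_iff.mp h with h' | h'
    · exact_mod_cast h'.le
    · rw [h'.1]
  · have hq : 0 ≤ A 1 + A (-1) := add_nonneg (hA.nonneg _) (hA.nonneg _)
    have hlt : ((pos μ j : ℕ) : ℝ) + 1 ≤ (pos μ k : ℕ) := by exact_mod_cast h
    nlinarith

/-- If q = 0, the eigenvalues are the entries shifted by b. If q > 0, they decrease strictly along
the sorted positions, so their order determines the positions and then the entries. -/
theorem eigenval_injective (hA : Admissible A b) {μ ν : Fin N →₀ ℕ}
    (h : ∀ j, eigenval A b μ j = eigenval A b ν j) : μ = ν := by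
  have hq : 0 ≤ A 1 + A (-1) := add_nonneg (hA.nonneg _) (hA.nonneg _)
  have hpos : ∀ j, (A 1 + A (-1)) * ((pos μ j : ℕ) : ℝ) = (A 1 + A (-1)) * ((pos ν j : ℕ) : ℝ) := by
    rcases hq.eq_or_lt with h0 | hq'
    · intro j; rw [← h0, zero_mul, zero_mul]
    have key : ∀ (κ : Fin N →₀ ℕ) (j k), pos κ j < pos κ k ↔ eigenval A b κ k < eigenval A b κ j := by
      have h1 : ∀ (κ : Fin N →₀ ℕ) (j k), pos κ j < pos κ k →
          eigenval A b κ k < eigenval A b κ j := by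
        intro κ j k hjk
        obtain ⟨h1, h2⟩ := eigenval_lt_of_pos_lt hA hjk
        rw [eigenval, eigenval]
        nlinarith
      intro κ j k
      refine ⟨h1 κ j k, fun hlt => ?_⟩
      rcases lt_trichotomy (pos κ j) (pos κ k) with h' | h' | h'
      · exact h'
      · rw [pos_injective κ h'] at hlt
        exact absurd hlt (lt_irrefl _)
      · exact absurd (h1 κ k j h') hlt.asymm
    intro j
    have : (pos μ j : ℕ) = pos ν j := by
      rw [← card_lt_pos μ j, ← card_lt_pos ν j]
      congr 1
      ext k
      simp only [Finset.mem_filter, Finset.mem_univ, true_and, key, h]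
    rw [this]
  ext j
  have hj := h j
  have hp := hpos j
  rw [eigenval, eigenval] at hj
  have : (μ j : ℝ) = ν j := by linarith
  exact_mod_cast this

/-- Among the elements of S at or above ν, one with the most compositions below it is maximal, since
these down-sets are finite and grow strictly with the order. -/
theorem exists_maximal_above {S : Finset (Fin N →₀ ℕ)} {ν : Fin N →₀ ℕ} (hν : ν ∈ S) :
    ∃ κ ∈ S, (ν = κ ∨ Below ν κ) ∧ ∀ γ ∈ S, ¬Below κ γ := by
  classical
  obtain ⟨κ, hκ, hmax⟩ := Finset.exists_max_image (S.filter fun κ => ν = κ ∨ Below ν κ)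
    (fun κ => {γ | Below γ κ}.ncard) ⟨ν, Finset.mem_filter.mpr ⟨hν, Or.inl rfl⟩⟩
  obtain ⟨hκS, hκν⟩ := Finset.mem_filter.mp hκ
  refine ⟨κ, hκS, hκν, fun γ hγ hlt => ?_⟩
  have hγν : Below ν γ := by
    rcases hκν with rfl | h
    · exact hlt
    · exact h.trans hlt
  refine absurd (hmax γ (Finset.mem_filter.mpr ⟨hγ, Or.inr hγν⟩)) (not_le.mpr ?_)
  refine Set.ncard_lt_ncard ⟨fun x hx => Below.trans hx hlt, fun hsub => ?_⟩ (finite_below γ)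
  exact Below.irrefl κ (hsub hlt)

/-- By triangularity, x^κ can arise from x^γ only if γ = κ or κ lies below γ, and the latter is
excluded. -/
theorem coeff_cherednik_of_maximal {f : MvPolynomial (Fin N) ℂ} {κ : Fin N →₀ ℕ}
    (hmax : ∀ γ ∈ f.support, ¬Below κ γ) (j : Fin N) :
    (cherednik A b ω j f).coeff κ = eigenval A b κ j * f.coeff κ := by
  have hmon : ∀ γ, f.coeff γ ≠ 0 → (cherednik A b ω j (monomial γ 1)).coeff κ
      = if γ = κ then (eigenval A b κ j : ℂ) else 0 := by
    intro γ hγ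
    have h := mem_lowSpan_iff.mp (cherednik_triangular A b ω j γ) κ
    have h0 : (cherednik A b ω j (monomial γ 1) - (eigenval A b γ j : ℂ) • monomial γ 1).coeff κ
        = 0 := by
      by_contra hne
      exact hmax γ (mem_support_iff.mpr hγ) (h hne)
    rw [coeff_sub, sub_eq_zero] at h0
    rw [h0, coeff_smul, coeff_monomial]
    split_ifs with he
    · rw [he, smul_eq_mul, mul_one]
    · simp
  have hsum : cherednik A b ω j f
      = ∑ γ ∈ f.support, f.coeff γ • cherednik A b ω j (monomial γ 1) := by
    conv_lhs => rw [f.as_sum, map_sum]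
    refine Finset.sum_congr rfl fun γ _ => ?_
    rw [← map_smul, smul_monomial, smul_eq_mul, mul_one]
  rw [hsum, coeff_sum]
  have : ∀ γ ∈ f.support, (f.coeff γ • cherednik A b ω j (monomial γ 1)).coeff κ
      = if γ = κ then eigenval A b κ j * f.coeff κ else 0 := by
    intro γ hγ
    rw [coeff_smul, hmon γ (mem_support_iff.mp hγ)]
    split_ifs with he
    · rw [he, smul_eq_mul, mul_comm]
    · simp
  rw [Finset.sum_congr rfl this, Finset.sum_ite_eq']
  split_ifs with hk
  · rfl
  · rw [notMem_support_iff.mp hk, mul_zero]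

/-- A joint eigenvector with the eigenvalues of `μ` only involves monomials up to `μ`. -/
theorem IsEigen.eq_or_below (hA : Admissible A b) {μ : Fin N →₀ ℕ} {f : MvPolynomial (Fin N) ℂ}
    (hf : IsEigen A b ω μ f) {ν : Fin N →₀ ℕ} (hν : f.coeff ν ≠ 0) :
    f.coeff μ ≠ 0 ∧ (ν = μ ∨ Below ν μ) := by
  obtain ⟨κ, hκ, h1, hmax⟩ := exists_maximal_above (mem_support_iff.mpr hν)
  have hκ := mem_support_iff.mp hκ
  obtain rfl : κ = μ := by
    refine eigenval_injective hA fun j => ?_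
    have h := congrArg (coeff κ) (hf j)
    rw [coeff_cherednik_of_maximal hmax, coeff_smul, smul_eq_mul] at h
    exact_mod_cast mul_right_cancel₀ hκ h
  exact ⟨hκ, h1⟩

/-- For joint eigenvectors triangularity is automatic, so new polynomials are recognized from their
eigenvalues and one coefficient. -/
theorem IsEigen.isNonsym (hA : Admissible A b) {μ : Fin N →₀ ℕ} {f : MvPolynomial (Fin N) ℂ}
    (hf : IsEigen A b ω μ f) (h1 : f.coeff μ = 1) : IsNonsym A b ω μ f :=
  ⟨⟨h1, fun _ hne hν => ((hf.eq_or_below hA hν).2.resolve_left hne).2⟩, hf⟩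

theorem IsNonsym.unique (hA : Admissible A b) {μ : Fin N →₀ ℕ} {f g : MvPolynomial (Fin N) ℂ}
    (hf : IsNonsym A b ω μ f) (hg : IsNonsym A b ω μ g) : f = g := by
  have hfg : IsEigen A b ω μ (f - g) := fun j => by rw [map_sub, hf.2 j, hg.2 j, smul_sub]
  rw [← sub_eq_zero]
  ext ν
  rw [coeff_zero]
  by_contra hν
  apply (hfg.eq_or_below hA hν).1
  rw [coeff_sub, hf.1.1, hg.1.1, sub_self]

theorem existsUnique_isNonsym (hA : Admissible A b) (hω : 0 < ω) (μ : Fin N →₀ ℕ) :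
    ∃! f, IsNonsym A b ω μ f := by
  obtain ⟨f, hf⟩ := exists_isNonsym hA hω μ
  exact ⟨f, hf, fun g hg => hg.unique hA hf⟩

/-- The polynomial with the defining properties. -/
def nonsym (A : ℤˣ → ℝ) (b ω : ℝ) (μ : Fin N →₀ ℕ) : MvPolynomial (Fin N) ℂ :=
  Classical.epsilon (IsNonsym A b ω μ)

theorem isNonsym_nonsym (hA : Admissible A b) (hω : 0 < ω) (μ : Fin N →₀ ℕ) :
    IsNonsym A b ω μ (nonsym A b ω μ) := Classical.epsilon_spec (exists_isNonsym hA hω μ)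

theorem polyInner_nonsym_ne_zero (hA : Admissible A b) (hω : 0 < ω) (μ : Fin N →₀ ℕ) :
    polyInner A b ω (nonsym A b ω μ) (nonsym A b ω μ) ≠ 0 := by
  intro h
  have h1 := (isNonsym_nonsym hA hω μ).1.1
  rw [eq_zero_of_polyInner_self hA hω h, coeff_zero] at h1
  exact zero_ne_one h1

/-- The operator t_i commutes with every d_j, so (-1)^{μ_i} t_i f has the eigenvalues and leading
coefficient of f, and uniqueness applies. -/
theorem sgn_of_isNonsym (hA : Admissible A b) (heven : A (-1) = A 1) {μ : Fin N →₀ ℕ}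
    {f : MvPolynomial (Fin N) ℂ} (hf : IsNonsym A b ω μ f) (i : Fin N) :
    sgn i f = ((-1 : ℂ) ^ μ i) • f := by
  have hsq : ((-1 : ℂ) ^ μ i) * (-1) ^ μ i = 1 := by rw [← mul_pow]; simp
  have h : IsNonsym A b ω μ (((-1 : ℂ) ^ μ i) • sgn i f) := by
    refine IsEigen.isNonsym hA (fun j => ?_) ?_
    · rw [map_smul, ← sgn_cherednik heven, hf.2 j, map_smul, smul_comm]
    · rw [coeff_smul, coeff_sgn, hf.1.1, smul_eq_mul, mul_one, hsq]
  have he := hf.unique hA h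
  conv_rhs => rw [he, smul_smul, hsq, one_smul]

/-! ## The norm formula -/

/-- The coupling of two entries that differ by `m`. -/
def coupling (A : ℤˣ → ℝ) (m : ℕ) : ℝ := A 1 + A (-1) * (-1) ^ m

/-- On f the error term of the exchange relation is a scalar, because t_i t_k acts by (-1)^{μ_i +
μ_k}. The sum of the entries has the parity of their difference and avoids truncated subtraction. If
A (-1) = 0, no sign symmetry is required. -/
theorem coupling_nonsym (hA : Admissible A b) {μ : Fin N →₀ ℕ} {f : MvPolynomial (Fin N) ℂ}
    (hf : IsNonsym A b ω μ f) (i k : Fin N) :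
    (A 1 : ℂ) • f + (A (-1) : ℂ) • sgn i (sgn k f) = (coupling A (μ i + μ k) : ℂ) • f := by
  by_cases h0 : A (-1) = 0
  · simp [coupling, h0]
  · have heven := hA.even (Or.inl h0)
    rw [sgn_of_isNonsym hA heven hf, map_smul, sgn_of_isNonsym hA heven hf, smul_smul, smul_smul,
      ← add_smul, coupling]
    congr 1
    push_cast
    ring

theorem abs_coupling_le (hA : Admissible A b) (m : ℕ) : |coupling A m| ≤ A 1 + A (-1) := by
  have h1 := hA.nonneg 1
  have h2 := hA.nonneg (-1)
  rw [coupling, abs_le]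
  rcases neg_one_pow_eq_or ℝ m with h | h <;> rw [h] <;> constructor <;> linarith

theorem eigenval_actComp (μ : Fin N →₀ ℕ) {j : SimpleIndex N} (h : μ j.lo ≠ μ j.hi) (i : Fin N) :
    eigenval A b (actComp (simpleRefl j) μ) i = eigenval A b μ (simpleRefl j i) := by
  rw [eigenval, eigenval, pos_actComp_simpleRefl h, actComp_apply, simpleRefl_inv]

theorem coeff_adjExch (j : SimpleIndex N) (μ : Fin N →₀ ℕ) (f : MvPolynomial (Fin N) ℂ) :
    (adjExch j f).coeff (actComp (simpleRefl j) μ) = f.coeff μ := by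
  rw [adjExch, ← exch_eq_refl, exch, actComp, Finsupp.equivMapDomain_eq_mapDomain]
  exact coeff_rename_mapDomain _ (simpleRefl j).injective _ _

theorem actComp_simpleRefl_actComp (j : SimpleIndex N) (μ : Fin N →₀ ℕ) :
    actComp (simpleRefl j) (actComp (simpleRefl j) μ) = μ := by
  ext i
  simp [actComp_apply, simpleRefl_inv, simpleRefl_simpleRefl]

theorem below_actComp_simpleRefl {μ : Fin N →₀ ℕ} {j : SimpleIndex N} (h : μ j.lo < μ j.hi) :
    Below μ (actComp (simpleRefl j) μ) := by
  have h1 : Below (actComp (simpleRefl j) (actComp (simpleRefl j) μ)) (actComp (simpleRefl j) μ) := by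
    refine below_actComp_swap j.lo_lt_hi ?_
    rw [actComp_apply, actComp_apply, simpleRefl_inv, simpleRefl_hi, simpleRefl_lo]
    exact h
  rwa [actComp_simpleRefl_actComp] at h1

/-- The entries differ by a positive amount and the positions by at least one. Together with
`abs_coupling_le` this gives |c| < 1 in the exchange step. -/
theorem eigenval_gap (hA : Admissible A b) {μ : Fin N →₀ ℕ} {i k : Fin N} (h : μ k < μ i) :
    A 1 + A (-1) < eigenval A b μ i - eigenval A b μ k := by
  obtain ⟨-, h2⟩ := eigenval_lt_of_pos_lt hA (pos_lt_pos_iff.mpr (Or.inl h))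
  have h1 : (μ k : ℝ) < μ i := by exact_mod_cast h
  rw [eigenval, eigenval]
  nlinarith

/-- Exchanging two neighbouring entries `μ_j < μ_{j+1}`. -/
theorem nonsym_actComp (hA : Admissible A b) (hω : 0 < ω) {μ : Fin N →₀ ℕ} {j : SimpleIndex N}
    (h : μ j.lo < μ j.hi) :
    nonsym A b ω (actComp (simpleRefl j) μ) = adjExch j (nonsym A b ω μ)
      + ((coupling A (μ j.lo + μ j.hi)
        / (eigenval A b μ j.hi - eigenval A b μ j.lo) : ℝ) : ℂ) • nonsym A b ω μ := by
  have hgap := eigenval_gap hA h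
  have hq : 0 ≤ A 1 + A (-1) := add_nonneg (hA.nonneg _) (hA.nonneg _)
  have hne : eigenval A b μ j.hi - eigenval A b μ j.lo ≠ 0 := by linarith
  have hf := isNonsym_nonsym hA hω μ
  set f := nonsym A b ω μ
  -- With K f + c f, the error term of the exchange relation is absorbed exactly when c times the
  -- eigenvalue gap equals the coupling.
  set c : ℝ := coupling A (μ j.lo + μ j.hi) / (eigenval A b μ j.hi - eigenval A b μ j.lo) with hc
  have hcE : (c : ℂ) * (eigenval A b μ j.hi - eigenval A b μ j.lo)
      = coupling A (μ j.lo + μ j.hi) := by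
    rw [← Complex.ofReal_sub, ← Complex.ofReal_mul, hc, div_mul_cancel₀ _ hne]
  refine (isNonsym_nonsym hA hω _).unique hA (IsEigen.isNonsym hA (fun i => ?_) ?_)
  · rw [eigenval_actComp μ h.ne, map_add, map_smul, hf.2 i]
    by_cases hlo : i = j.lo
    · subst hlo
      rw [cherednik_lo_adjExch, hf.2, map_smul, coupling_nonsym hA hf, simpleRefl_lo, ← hcE]
      module
    · by_cases hhi : i = j.hi
      · subst hhi
        rw [cherednik_hi_adjExch, hf.2, map_smul, coupling_nonsym hA hf, simpleRefl_hi, ← hcE]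
        module
      · have hfix : simpleRefl j i = i := Equiv.swap_apply_of_ne_of_ne hlo hhi
        rw [cherednik_adjExch_of_ne A b ω hlo hhi, hf.2, map_smul, hfix]
        module
  -- The exponent s_j μ lies above μ and does not occur in f, so its coefficient in K f + c f comes
  -- from K f alone.
  · have hb := below_actComp_simpleRefl h
    have h0 : f.coeff (actComp (simpleRefl j) μ) = 0 := by
      by_contra hne'
      exact Below.irrefl μ (hb.trans ⟨hb.1.symm, hf.1.2 _ hb.1.symm hne'⟩)
    rw [coeff_add, coeff_adjExch, hf.1.1, coeff_smul, h0, smul_zero, add_zero]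

theorem polyInner_eq_zero_of_eigenval_ne (hA : Admissible A b) (hω : 0 < ω) {μ ν : Fin N →₀ ℕ}
    {f g : MvPolynomial (Fin N) ℂ} (hf : IsEigen A b ω μ f) (hg : IsEigen A b ω ν g) {j : Fin N}
    (hne : eigenval A b μ j ≠ eigenval A b ν j) : polyInner A b ω f g = 0 := by
  have h := polyInner_cherednik hA hω j f g
  rw [hf j, hg j, polyInner_smul_left, polyInner_smul_right, Complex.conj_ofReal] at h
  have h' : ((eigenval A b μ j : ℂ) - eigenval A b ν j) * polyInner A b ω f g = 0 := by
    linear_combination h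
  refine (mul_eq_zero.mp h').resolve_left (sub_ne_zero.mpr ?_)
  exact_mod_cast hne

/-- Let g = K f + c f. Different eigenvalues make f and g orthogonal, and K² = 1 gives K g = (1 -
c²) f + c g. Hence ⟨g, g⟩ = ⟨K f, g⟩ = ⟨f, K g⟩ = (1 - c²) ⟨f, f⟩. -/
theorem polyInner_nonsym_actComp (hA : Admissible A b) (hω : 0 < ω) {μ : Fin N →₀ ℕ}
    {j : SimpleIndex N} (h : μ j.lo < μ j.hi) :
    polyInner A b ω (nonsym A b ω (actComp (simpleRefl j) μ))
        (nonsym A b ω (actComp (simpleRefl j) μ))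
      = ((1 - (coupling A (μ j.lo + μ j.hi)
        / (eigenval A b μ j.hi - eigenval A b μ j.lo)) ^ 2 : ℝ) : ℂ)
        * polyInner A b ω (nonsym A b ω μ) (nonsym A b ω μ) := by
  have hgap := eigenval_gap hA h
  have hq : 0 ≤ A 1 + A (-1) := add_nonneg (hA.nonneg _) (hA.nonneg _)
  have hu := nonsym_actComp hA hω h
  have hf := isNonsym_nonsym hA hω μ
  have hg := isNonsym_nonsym hA hω (actComp (simpleRefl j) μ)
  set c : ℝ := coupling A (μ j.lo + μ j.hi) / (eigenval A b μ j.hi - eigenval A b μ j.lo)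
  set f := nonsym A b ω μ
  set g := nonsym A b ω (actComp (simpleRefl j) μ)
  have hfg : polyInner A b ω f g = 0 := by
    refine polyInner_eq_zero_of_eigenval_ne hA hω hf.2 hg.2 (j := j.lo) ?_
    rw [eigenval_actComp μ h.ne, simpleRefl_lo]
    intro he
    linarith
  have hKg : adjExch j g = ((1 - c ^ 2 : ℝ) : ℂ) • f + (c : ℂ) • g := by
    have hKK : adjExch j (adjExch j f) = f := refl_refl _ _ _ _
    have hK : adjExch j f = g - (c : ℂ) • f := by rw [hu, add_sub_cancel_right]
    rw [hu, map_add, map_smul, hKK, hK, hu]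
    push_cast
    module
  calc polyInner A b ω g g = polyInner A b ω (adjExch j f + (c : ℂ) • f) g := by rw [← hu]
    _ = polyInner A b ω f (adjExch j g) := by
      rw [polyInner_add_left hA hω, polyInner_smul_left, hfg, mul_zero, add_zero, polyInner_adjExch]
    _ = ((1 - c ^ 2 : ℝ) : ℂ) * polyInner A b ω f f := by
      rw [hKg, polyInner_add_right hA hω, polyInner_smul_right, polyInner_smul_right, hfg, mul_zero,
        add_zero]

/-- `⟨α^∨, κ + q ρ⟩` for `α = ε_{p.1} - ε_{p.2}`. -/
def rootGap (A : ℤˣ → ℝ) (κ : Fin N →₀ ℕ) (p : Fin N × Fin N) : ℝ :=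
  (κ p.1 : ℝ) - κ p.2 + (A 1 + A (-1)) * ((p.2 : ℕ) - (p.1 : ℕ) : ℝ)

/-- The denominator of the norm formula. -/
def rootDenom (A : ℤˣ → ℝ) (κ : Fin N →₀ ℕ) (p : Fin N × Fin N) : ℝ :=
  rootGap A κ p ^ 2 - coupling A (κ p.1 + κ p.2) ^ 2

/-- Stability forces the entries at an inversion of w_μ to be different, so the gap exceeds q and
hence the absolute value of the coupling. At other pairs the denominator may vanish. -/
theorem rootDenom_pos (hA : Admissible A b) {μ : Fin N →₀ ℕ} {p : Fin N × Fin N}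
    (hp : p ∈ inversions (shortest μ)) : 0 < rootDenom A (plus μ) p := by
  obtain ⟨h1, h2⟩ := mem_inversions.mp hp
  have hlt : plus μ p.2 < plus μ p.1 := by
    rw [plus_apply, plus_apply]
    rcases stablySorts_shortest μ _ _ h1 with h | h
    · exact h
    · exact absurd h.2 h2.asymm
  have hlt' : (plus μ p.2 : ℝ) < plus μ p.1 := by exact_mod_cast hlt
  have hpp : ((p.1 : ℕ) : ℝ) + 1 ≤ (p.2 : ℕ) := by exact_mod_cast h1
  have hq : 0 ≤ A 1 + A (-1) := add_nonneg (hA.nonneg _) (hA.nonneg _)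
  have hc := abs_coupling_le hA (plus μ p.1 + plus μ p.2)
  have hg : |coupling A (plus μ p.1 + plus μ p.2)| < rootGap A (plus μ) p := by
    refine hc.trans_lt ?_
    rw [rootGap]
    nlinarith
  rw [rootDenom, sub_pos]
  exact sq_lt_sq' (by linarith [neg_abs_le (coupling A (plus μ p.1 + plus μ p.2))])
    (lt_of_abs_lt hg)

/-- Induction on the inversions of w_μ. At an ascent μ_j < μ_{j+1}, the composition ν = s_j μ has
exactly one inversion less, namely the pair p of sorted positions of the two entries. The quantities
at p computed from μ⁺ are the eigenvalue gap and the coupling of the exchange step from μ to ν. -/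
theorem norm_formula (hA : Admissible A b) (hω : 0 < ω) (μ : Fin N →₀ ℕ) :
    polyInner A b ω (nonsym A b ω μ) (nonsym A b ω μ)
      = ((∏ p ∈ inversions (shortest μ), rootGap A (plus μ) p ^ 2 / rootDenom A (plus μ) p : ℝ) : ℂ)
        * polyInner A b ω (nonsym A b ω (plus μ)) (nonsym A b ω (plus μ)) := by
  induction hn : (inversions (shortest μ)).card using Nat.strong_induction_on generalizing μ with
  | _ n ih =>
  by_cases hμ : IsPartition μ
  · have h1 : plus μ = μ := plus_eq_of_mem_orbit hμ (mem_orbit_refl μ)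
    have h2 : inversions (shortest μ) = ∅ := by
      rw [shortest_eq_one hμ]
      ext p
      simp only [mem_inversions, Equiv.Perm.one_apply, Finset.notMem_empty, iff_false, not_and]
      exact fun h => h.asymm
    rw [h1, h2]
    simp
  · obtain ⟨j, hj⟩ := exists_ascent_of_not_isPartition hμ
    set ν := actComp (simpleRefl j) μ with hνdef
    have hνlo : ν j.lo = μ j.hi := by
      rw [hνdef, actComp_apply, simpleRefl_inv, simpleRefl_lo]
    have hνhi : ν j.hi = μ j.lo := by
      rw [hνdef, actComp_apply, simpleRefl_inv, simpleRefl_hi]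
    have hμν : actComp (simpleRefl j) ν = μ := actComp_simpleRefl_actComp j μ
    have hplus : plus ν = plus μ :=
      plus_eq_of_mem_orbit (isPartition_plus μ) (orbit_trans ⟨_, rfl⟩ (mem_orbit_plus μ))
    obtain ⟨hnot, hins⟩ := inversions_shortest_actComp (μ := ν) (j := j)
      (by rw [hνlo, hνhi]; exact hj)
    rw [hμν] at hins
    have hcard : (inversions (shortest ν)).card < n := by
      rw [← hn, hins, Finset.card_insert_of_notMem hnot]
      exact Nat.lt_succ_self _
    have hrec := ih _ hcard ν rfl
    have hstep := polyInner_nonsym_actComp hA hω hj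
    rw [← hνdef, hrec, hplus] at hstep
    set p : Fin N × Fin N := (pos ν j.lo, pos ν j.hi) with hp
    have hk1 : plus μ p.1 = μ j.hi := by rw [← hplus, hp, plus_pos, hνlo]
    have hk2 : plus μ p.2 = μ j.lo := by rw [← hplus, hp, plus_pos, hνhi]
    have hp1 : p.1 = pos μ j.hi := by
      rw [hp, hνdef]
      change pos (actComp (simpleRefl j) μ) j.lo = _
      rw [pos_actComp_simpleRefl hj.ne, simpleRefl_lo]
    have hp2 : p.2 = pos μ j.lo := by
      rw [hp, hνdef]
      change pos (actComp (simpleRefl j) μ) j.hi = _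
      rw [pos_actComp_simpleRefl hj.ne, simpleRefl_hi]
    have hgap : rootGap A (plus μ) p = eigenval A b μ j.hi - eigenval A b μ j.lo := by
      rw [rootGap, hk1, hk2, hp1, hp2, eigenval, eigenval]
      ring
    have hcoup : coupling A (plus μ p.1 + plus μ p.2) = coupling A (μ j.lo + μ j.hi) := by
      rw [hk1, hk2, add_comm]
    have hpos : 0 < rootDenom A (plus μ) p :=
      rootDenom_pos hA (hins ▸ Finset.mem_insert_self _ _)
    have hgap0 : eigenval A b μ j.hi - eigenval A b μ j.lo ≠ 0 := by
      have := eigenval_gap hA hj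
      have := add_nonneg (hA.nonneg 1) (hA.nonneg (-1))
      linarith
    -- The factor of the new root is the inverse of 1 - c², so the step from μ up to ν can be solved
    -- for the norm of h_μ.
    have hfac : rootGap A (plus μ) p ^ 2 / rootDenom A (plus μ) p
        * (1 - (coupling A (μ j.lo + μ j.hi)
          / (eigenval A b μ j.hi - eigenval A b μ j.lo)) ^ 2) = 1 := by
      have hD : rootDenom A (plus μ) p = (eigenval A b μ j.hi - eigenval A b μ j.lo) ^ 2
          - coupling A (μ j.lo + μ j.hi) ^ 2 := by rw [rootDenom, hgap, hcoup]
      rw [hD] at hpos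
      rw [hD, hgap, div_pow, div_mul_eq_mul_div, div_eq_one_iff_eq hpos.ne', mul_sub, mul_one,
        mul_div_cancel₀ _ (pow_ne_zero 2 hgap0)]
    have hfac' := congrArg (fun t : ℝ => (t : ℂ)) hfac
    simp only [Complex.ofReal_mul, Complex.ofReal_one] at hfac'
    rw [hins, Finset.prod_insert hnot, Complex.ofReal_mul, mul_assoc, hstep, ← mul_assoc, hfac',
      one_mul]

/-! ## The polynomials of type A and B -/

/-- The compositions λ = ε_j isolate the single operators, and linearity in λ gives the converse. -/
theorem sum_smul_apply_iff {D : Fin N → Module.End ℂ (MvPolynomial (Fin N) ℂ)} {v : Fin N → ℝ}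
    {p : MvPolynomial (Fin N) ℂ} :
    (∀ lam : Fin N →₀ ℕ, (∑ j, (lam j : ℂ) • D j) p = ((form (vec lam) v : ℝ) : ℂ) • p)
      ↔ ∀ j, D j p = (v j : ℂ) • p := by
  constructor
  · intro h j
    have := h (Finsupp.single j 1)
    simpa [form, vec, Finsupp.single_apply, LinearMap.sum_apply] using this
  · intro h lam
    rw [LinearMap.sum_apply]
    simp only [LinearMap.smul_apply, h, form, vec, smul_smul]
    rw [← Finset.sum_smul]
    push_cast
    rfl

theorem isHermite_iff (a : ℝ) {ω : ℝ} (hω : 0 < ω) (μ : Fin N →₀ ℕ) :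
    IsHermite a ω μ = IsNonsym (multA a) 0 ω μ := by
  funext p
  rw [IsHermite, IsNonsym, sum_smul_apply_iff, IsEigen]
  refine propext (and_congr Iff.rfl (forall_congr' fun j => ?_))
  rw [cherednikA_eq a hω]
  have : (vec μ + a • rhoOf μ + fun _ => a * ((N : ℝ) - 1) / 2 : Fin N → ℝ) j = eigenval (multA a) 0 μ j := by
    simp only [Pi.add_apply, Pi.smul_apply, smul_eq_mul, rhoOf_apply, eigenval, vec, multA,
      show ¬((-1 : ℤˣ) = 1) by decide, if_true, if_false]
    ring
  rw [this]

theorem isLaguerre_iff (a b : ℝ) {ω : ℝ} (hω : 0 < ω) (μ : Fin N →₀ ℕ) :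
    IsLaguerre a b ω μ = IsNonsym (multB a) b ω μ := by
  funext p
  rw [IsLaguerre, IsNonsym, sum_smul_apply_iff, IsEigen]
  refine propext (and_congr Iff.rfl (forall_congr' fun j => ?_))
  rw [cherednikB_eq a b hω]
  have : (vec μ + (2 * a) • rhoOf μ + fun _ => a * ((N : ℝ) - 1) + b : Fin N → ℝ) j
      = eigenval (multB a) b μ j := by
    simp only [Pi.add_apply, Pi.smul_apply, smul_eq_mul, rhoOf_apply, eigenval, vec, multB]
    ring
  rw [this]

theorem hermite_eq (a : ℝ) {ω : ℝ} (hω : 0 < ω) (μ : Fin N →₀ ℕ) :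
    hermite a ω μ = nonsym (multA a) 0 ω μ := by
  rw [hermite, isHermite_iff a hω, nonsym]

theorem laguerre_eq (a b : ℝ) {ω : ℝ} (hω : 0 < ω) (μ : Fin N →₀ ℕ) :
    laguerre a b ω μ = nonsym (multB a) b ω μ := by
  rw [laguerre, isLaguerre_iff a b hω, nonsym]

theorem form_coroot_rho (q : ℝ) (κ : Fin N →₀ ℕ) {p : Fin N × Fin N} (hp : p.1 ≠ p.2) :
    form (coroot (eps p.1 - eps p.2)) (vec κ + q • rho N)
      = (κ p.1 : ℝ) - κ p.2 + q * ((p.2 : ℕ) - (p.1 : ℕ) : ℝ) := by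
  rw [form_coroot_eps_sub hp]
  simp only [Pi.add_apply, Pi.smul_apply, smul_eq_mul, rho_apply, vec]
  ring

theorem denomA_eq (a : ℝ) (κ : Fin N →₀ ℕ) {p : Fin N × Fin N} (hp : p.1 ≠ p.2) :
    denomA a κ (eps p.1 - eps p.2) = rootDenom (multA a) κ p := by
  rw [denomA, form_coroot_rho a κ hp, rootDenom, rootGap, coupling]
  simp [multA, show ¬((-1 : ℤˣ) = 1) by decide]

theorem factorA_eq (a : ℝ) (κ : Fin N →₀ ℕ) {p : Fin N × Fin N} (hp : p.1 ≠ p.2) :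
    factorA a κ (eps p.1 - eps p.2) = rootGap (multA a) κ p ^ 2 / rootDenom (multA a) κ p := by
  rw [factorA, denomA_eq a κ hp, form_coroot_rho a κ hp, rootGap]
  simp [multA, show ¬((-1 : ℤˣ) = 1) by decide]

theorem neg_one_zpow_floor (κ : Fin N →₀ ℕ) {p : Fin N × Fin N} (hp : p.1 ≠ p.2) :
    (-1 : ℝ) ^ ⌊form (coroot (eps p.1 - eps p.2)) (vec κ)⌋ = (-1) ^ (κ p.1 + κ p.2) := by
  have h : form (coroot (eps p.1 - eps p.2)) (vec κ) = (((κ p.1 : ℤ) - (κ p.2 : ℤ) : ℤ) : ℝ) := by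
    rw [form_coroot_eps_sub hp]
    simp [vec]
  rw [h, Int.floor_intCast, zpow_sub₀ (by norm_num), zpow_natCast, zpow_natCast, pow_add,
    div_eq_mul_inv]
  congr 1
  rcases neg_one_pow_eq_or ℝ (κ p.2) with h | h <;> rw [h] <;> norm_num

theorem denomB_eq (a : ℝ) (κ : Fin N →₀ ℕ) {p : Fin N × Fin N} (hp : p.1 ≠ p.2) :
    denomB a κ (eps p.1 - eps p.2) = rootDenom (multB a) κ p := by
  rw [denomB, form_coroot_rho (2 * a) κ hp, neg_one_zpow_floor κ hp, rootDenom, rootGap, coupling]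
  simp only [multB]
  ring

theorem factorB_eq (a : ℝ) (κ : Fin N →₀ ℕ) {p : Fin N × Fin N} (hp : p.1 ≠ p.2) :
    factorB a κ (eps p.1 - eps p.2) = rootGap (multB a) κ p ^ 2 / rootDenom (multB a) κ p := by
  rw [factorB, denomB_eq a κ hp, form_coroot_rho (2 * a) κ hp, rootGap]
  simp only [multB]
  ring

/-- The norm formula in terms of the roots in `R_{w_μ}`. -/
theorem norm_formula_roots (hA : Admissible A b) (hω : 0 < ω) {μp μ : Fin N →₀ ℕ}
    (hμp : IsPartition μp) (hμ : μ ∈ orbit μp) {denom factor : (Fin N → ℝ) → ℝ}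
    (hdenom : ∀ p : Fin N × Fin N, p.1 ≠ p.2 → denom (eps p.1 - eps p.2) = rootDenom A μp p)
    (hfactor : ∀ p : Fin N × Fin N, p.1 ≠ p.2 →
      factor (eps p.1 - eps p.2) = rootGap A μp p ^ 2 / rootDenom A μp p) :
    (∀ α ∈ inversionRoots (shortest μ), denom α ≠ 0) ∧
      polyInner A b ω (nonsym A b ω μ) (nonsym A b ω μ)
        = ((∏ α ∈ inversionRoots (shortest μ), factor α : ℝ) : ℂ)
          * polyInner A b ω (nonsym A b ω μp) (nonsym A b ω μp) := by
  have hplus := plus_eq_of_mem_orbit hμp hμ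
  constructor
  · intro α hα
    obtain ⟨p, hp, rfl⟩ := mem_inversionRoots_iff.mp hα
    rw [hdenom p (mem_inversions.mp hp).1.ne, ← hplus]
    exact (rootDenom_pos hA hp).ne'
  · have hprod : ∏ α ∈ inversionRoots (shortest μ), factor α
        = ∏ p ∈ inversions (shortest μ), rootGap A μp p ^ 2 / rootDenom A μp p := by
      rw [prod_inversionRoots]
      exact Finset.prod_congr rfl fun p hp => hfactor p (mem_inversions.mp hp).1.ne
    rw [hprod, norm_formula hA hω μ, hplus]

end Spectral

end Calogero

end

/-! ### The theorem for types A and B -/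

theorem mainTheorem8 (N : ℕ) (a b ω : ℝ) (ha : 0 ≤ a) (hb : 0 ≤ b) (hω : 0 < ω) :
    (∀ ν : Fin N →₀ ℕ,
      (∃! p, Calogero.IsHermite a ω ν p) ∧ (∃! p, Calogero.IsLaguerre a b ω ν p)) ∧
    ∀ μp : Fin N →₀ ℕ, Calogero.IsPartition μp → ∀ μ ∈ Calogero.orbit μp,
      -- type A
      ((∀ α ∈ Calogero.inversionRoots (Calogero.shortest μ), Calogero.denomA a μp α ≠ 0) ∧
        Calogero.innerA a ω (Calogero.hermite a ω μp) (Calogero.hermite a ω μp) ≠ 0 ∧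
        Calogero.innerA a ω (Calogero.hermite a ω μ) (Calogero.hermite a ω μ) =
          ((∏ α ∈ Calogero.inversionRoots (Calogero.shortest μ),
              Calogero.factorA a μp α : ℝ) : ℂ) *
            Calogero.innerA a ω (Calogero.hermite a ω μp) (Calogero.hermite a ω μp) ∧
        ∀ J : List (Calogero.SimpleIndex N),
          Calogero.IsReducedWord J (Calogero.shortest μ) →
          ((Calogero.wordRoots J).map (Calogero.factorA a μp)).prod =
            ∏ α ∈ Calogero.inversionRoots (Calogero.shortest μ), Calogero.factorA a μp α) ∧
      -- type B
      ((∀ α ∈ Calogero.inversionRoots (Calogero.shortest μ), Calogero.denomB a μp α ≠ 0) ∧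
        Calogero.innerB a b ω (Calogero.laguerre a b ω μp) (Calogero.laguerre a b ω μp) ≠ 0 ∧
        Calogero.innerB a b ω (Calogero.laguerre a b ω μ) (Calogero.laguerre a b ω μ) =
          ((∏ α ∈ Calogero.inversionRoots (Calogero.shortest μ),
              Calogero.factorB a μp α : ℝ) : ℂ) *
            Calogero.innerB a b ω (Calogero.laguerre a b ω μp)
              (Calogero.laguerre a b ω μp) ∧
        ∀ J : List (Calogero.SimpleIndex N),
          Calogero.IsReducedWord J (Calogero.shortest μ) →
          ((Calogero.wordRoots J).map (Calogero.factorB a μp)).prod =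
            ∏ α ∈ Calogero.inversionRoots (Calogero.shortest μ), Calogero.factorB a μp α) := by
  have hA := Calogero.admissible_multA ha
  have hB := Calogero.admissible_multB ha hb
  refine ⟨fun ν => ⟨?_, ?_⟩, fun μp hμp μ hμ => ⟨?_, ?_⟩⟩
  · rw [Calogero.isHermite_iff a hω]
    exact Calogero.existsUnique_isNonsym hA hω ν
  · rw [Calogero.isLaguerre_iff a b hω]
    exact Calogero.existsUnique_isNonsym hB hω ν
  · obtain ⟨h1, h2⟩ := Calogero.norm_formula_roots hA hω hμp hμ
      (fun p hp => Calogero.denomA_eq a μp hp) (fun p hp => Calogero.factorA_eq a μp hp)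
    refine ⟨h1, ?_, ?_, fun J hJ => Calogero.prod_wordRoots hJ _⟩
    · rw [Calogero.innerA_eq, Calogero.hermite_eq a hω]
      exact Calogero.polyInner_nonsym_ne_zero hA hω μp
    · rw [Calogero.innerA_eq, Calogero.innerA_eq, Calogero.hermite_eq a hω,
        Calogero.hermite_eq a hω]
      exact h2
  · obtain ⟨h1, h2⟩ := Calogero.norm_formula_roots hB hω hμp hμ
      (fun p hp => Calogero.denomB_eq a μp hp) (fun p hp => Calogero.factorB_eq a μp hp)
    refine ⟨h1, ?_, ?_, fun J hJ => Calogero.prod_wordRoots hJ _⟩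
    · rw [Calogero.innerB_eq, Calogero.laguerre_eq a b hω]
      exact Calogero.polyInner_nonsym_ne_zero hB hω μp
    · rw [Calogero.innerB_eq, Calogero.innerB_eq, Calogero.laguerre_eq a b hω,
        Calogero.laguerre_eq a b hω]
      exact h2
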